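/- \textbf{Proposition (Weighted Directed Cutwidth, $(2+\varepsilon)$-approximation).} An instance of \textsc{Weighted Directed Cutwidth} is a simple directed graph $G=(V,A)$ with $n$ vertices (no self-loops or parallel arcs; opposite arcs are allowed) and an arc-weight function $w\colon A\to\mathbb{N}$. For an ordering (bijection) $\pi\colon V\to\{1,\dots,n\}$ put \[\mathrm{cw}_\pi(G,w)=\max_{1\le i\le n-1}\ \sum_{(u,v)\in A,\ \pi(u)>i,\ \pi(v)\le i} w(u,v)\] (the maximum is $0$ if $n\le 1$), and let $\mathrm{cw}(G,w)=\min_\pi \mathrm{cw}_\pi(G,w)$. Let $w_{\max}$ be the largest arc weight ($0$ if $A=\emptyset$) and $k=\lfloor n/2\rfloor$. Let $\omega$ be the exponent of matrix multiplication, that is, the infimum of all real $\tau$ such that two $N\times N$ rational matrices can be multiplied by bilinear algorithms with $O(N^{\tau})$ essential multiplications. As usual, a running time with $\omega$ in the exponent is a bound for every exponent greater than $\omega$. For every real $\tau>\omega$ there are an algorithm and a constant $C$ such that for every real $\varepsilon>0$ and every instance $(G,w)$, the algorithm, given $(G,w)$ and the integer $\lceil 1/\varepsilon\rceil$, computes an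 ordering $\pi$ of $V$ with \[\mathrm{cw}_\pi(G,w)\le(2+\varepsilon)\,\mathrm{cw}(G,w)\] in time at most \[C\cdot 2^{\tau n/3}\cdot\max\{1,\log_2 w_{\max}\}\cdot\max\{1,1/\varepsilon\}^2\cdot\max\{1,k\}^2 .\] (The factor $\max\{1,\log_2 w_{\max}\}$ is read as $1$ if $w_{\max}=0$.) The machine model is the random access machine with addition and truncated subtraction under the logarithmic cost measure (an instruction costs one plus the total bit length of the operands and addresses it handles). The input is given as $n$, $\lceil 1/\varepsilon\rceil$ and the weighted adjacency matrix, one number per memory cell. In particular, for $n\ge2$, $w_{\max}\ge2$ and $\varepsilon\le1$ the running time is $O\!\left(2^{\tau n/3}\,\log(w_{\max})\,(1/\varepsilon)^2\,k^2\right)$, with a constant that depends only on $\tau$. -/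

import Mathlib

/-! ### Arc-weighted directed graphs, orderings and directed cutwidth -/

/-- A simple directed graph on the vertex set `Fin n` (no self-loops, no parallel arcs, opposite
arcs allowed) with natural-number arc weights.  Only the values of `weight` on arcs matter: every
definition below reads `weight u v` only when `Adj u v` holds. -/
structure WeightedDigraph (n : ℕ) extends Digraph (Fin n) where
  loopless : ∀ v, ¬ Adj v v
  weight : Fin n → Fin n → ℕ

/-- A vertex ordering: the vertex `v` stands at the (zero-based) position `π v`. -/
abbrev VertexOrdering (n : ℕ) : Type := Fin n ≃ Fin n

namespace WeightedDigraph

variable {n : ℕ} (G : WeightedDigraph n)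

open Classical in
/-- The arc set. -/
noncomputable def arcs : Finset (Fin n × Fin n) :=
  Finset.univ.filter fun a => G.Adj a.1 a.2

/-- The largest arc weight (`0` if there are no arcs). -/
noncomputable def wMax : ℕ := G.arcs.sup fun a => G.weight a.1 a.2

/-- The cut at position `i`: all arcs from a vertex that is not among the first `i` vertices of
the ordering to a vertex that is among them. -/
noncomputable def cut (π : VertexOrdering n) (i : ℕ) : Finset (Fin n × Fin n) :=
  G.arcs.filter fun a => i ≤ (π a.1 : ℕ) ∧ (π a.2 : ℕ) < i

/-- The weight of the cut at position `i`. -/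
noncomputable def cutWeight (π : VertexOrdering n) (i : ℕ) : ℕ :=
  ∑ a ∈ G.cut π i, G.weight a.1 a.2

/-- The objective value of an ordering: the maximum weight of a cut over the positions
`1, …, n - 1` (`0` if there is no such position). -/
noncomputable def orderingWidth (π : VertexOrdering n) : ℕ :=
  (Finset.Ico 1 n).sup fun i => G.cutWeight π i

/-- The weighted directed cutwidth: the minimum objective value over all orderings. -/
noncomputable def cutwidth : ℕ := ⨅ π : VertexOrdering n, G.orderingWidth π

end WeightedDigraph

/-! ### The exponent of matrix multiplication -/

/-- Two `N × N` matrices over `ℚ` can be multiplied by a bilinear algorithm with `r` essential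
multiplications, that is, the matrix multiplication tensor has rank at most `r`. -/
def HasBilinearMatMul (N r : ℕ) : Prop :=
  ∃ α β γ : Fin r → Matrix (Fin N) (Fin N) ℚ, ∀ A B : Matrix (Fin N) (Fin N) ℚ,
    A * B = ∑ l, ((∑ i, ∑ j, α l i j * A i j) * (∑ i, ∑ j, β l i j * B i j)) • γ l

/-- The matrix multiplication exponent `ω`: the infimum of all `τ` such that `N × N` matrices can
be multiplied with `O(N ^ τ)` essential multiplications. -/
noncomputable def matMulExponent : ℝ :=
  sInf {τ : ℝ | ∃ C : ℝ, ∀ N : ℕ, 1 ≤ N →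
    ∃ r : ℕ, (r : ℝ) ≤ C * (N : ℝ) ^ τ ∧ HasBilinearMatMul N r}

/-! ### The random access machine with logarithmic cost

Programs are finite.  A machine has registers, addressed by constants of the program, and a memory
that is addressed indirectly; every cell holds a natural number.  Arithmetic is not free: the cost
of an instruction is the total bit length of the numbers (operands and addresses) it handles, plus
one.  Only addition and truncated subtraction are available as arithmetic instructions. -/
namespace RAM

/-- Programs. -/
inductive Program : Type
  /-- `R_x := c` -/
  | const (x c : ℕ) : Program
  /-- `R_x := R_y + R_z` -/
  | add (x y z : ℕ) : Program
  /-- `R_x := R_y - R_z`, truncated at zero -/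
  | sub (x y z : ℕ) : Program
  /-- `R_x := M[R_y]` -/
  | load (x y : ℕ) : Program
  /-- `M[R_x] := R_y` -/
  | store (x y : ℕ) : Program
  /-- first `P`, then `Q` -/
  | seq (P Q : Program) : Program
  /-- if `R_x ≠ 0` then `P` else `Q` -/
  | cond (x : ℕ) (P Q : Program) : Program
  /-- while `R_x ≠ 0` do `P` -/
  | loop (x : ℕ) (P : Program) : Program

/-- A machine state: the contents of the registers and of the memory. -/
structure State where
  reg : ℕ → ℕ
  mem : ℕ → ℕ

/-- `R_x := v` -/
def State.setReg (s : State) (x v : ℕ) : State := ⟨Function.update s.reg x v, s.mem⟩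

/-- `M[a] := v` -/
def State.setMem (s : State) (a v : ℕ) : State := ⟨s.reg, Function.update s.mem a v⟩

/-- `Exec P s s' t`: started in the state `s`, the program `P` halts in the state `s'`, and the
run has total cost `t`.  Here `Nat.size` is the bit length. -/
inductive Exec : Program → State → State → ℕ → Prop
  | const (x c : ℕ) (s : State) :
      Exec (.const x c) s (s.setReg x c) (1 + c.size)
  | add (x y z : ℕ) (s : State) :
      Exec (.add x y z) s (s.setReg x (s.reg y + s.reg z))
        (1 + (s.reg y).size + (s.reg z).size)
  | sub (x y z : ℕ) (s : State) :
      Exec (.sub x y z) s (s.setReg x (s.reg y - s.reg z))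
        (1 + (s.reg y).size + (s.reg z).size)
  | load (x y : ℕ) (s : State) :
      Exec (.load x y) s (s.setReg x (s.mem (s.reg y)))
        (1 + (s.reg y).size + (s.mem (s.reg y)).size)
  | store (x y : ℕ) (s : State) :
      Exec (.store x y) s (s.setMem (s.reg x) (s.reg y))
        (1 + (s.reg x).size + (s.reg y).size)
  | seq {P Q : Program} {s s' s'' : State} {t t' : ℕ} :
      Exec P s s' t → Exec Q s' s'' t' → Exec (.seq P Q) s s'' (t + t')
  | condTrue {x : ℕ} {P Q : Program} {s s' : State} {t : ℕ} :
      s.reg x ≠ 0 → Exec P s s' t → Exec (.cond x P Q) s s' (1 + (s.reg x).size + t)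
  | condFalse {x : ℕ} {P Q : Program} {s s' : State} {t : ℕ} :
      s.reg x = 0 → Exec Q s s' t → Exec (.cond x P Q) s s' (1 + (s.reg x).size + t)
  | loopDone {x : ℕ} {P : Program} {s : State} :
      s.reg x = 0 → Exec (.loop x P) s s (1 + (s.reg x).size)
  | loopStep {x : ℕ} {P : Program} {s s' s'' : State} {t t' : ℕ} :
      s.reg x ≠ 0 → Exec P s s' t → Exec (.loop x P) s' s'' t' →
      Exec (.loop x P) s s'' (1 + (s.reg x).size + t + t')

open Classical in
/-- The entry of the weighted adjacency matrix that describes the pair `(u, v)`: `0` if it is not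
an arc, and the weight plus one if it is. -/
noncomputable def arcCode {n : ℕ} (G : WeightedDigraph n) (u v : Fin n) : ℕ :=
  if G.Adj u v then G.weight u v + 1 else 0

/-- The initial state for the input graph `G` and the accuracy parameter `q`: all registers are
`0`, `M[0] = n`, `M[1] = q`, then follows the weighted adjacency matrix row by row,
`M[2 + (n * u + v)] = arcCode G u v`, and all other memory cells are `0`. -/
noncomputable def initState {n : ℕ} (G : WeightedDigraph n) (q : ℕ) : State where
  reg := fun _ => 0
  mem := fun a =>
    if a = 0 then n
    else if a = 1 then q
    else if h : a - 2 < n * n then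
      arcCode G (finProdFinEquiv.symm ⟨a - 2, h⟩).1 (finProdFinEquiv.symm ⟨a - 2, h⟩).2
    else 0

/-- The output convention: the position of the vertex `v` stands in `M[v]`. -/
def State.Outputs {n : ℕ} (s : State) (π : VertexOrdering n) : Prop :=
  ∀ v : Fin n, s.mem v = π v

end RAM

/-!
An ordering of width at most twice the cutwidth is found in time `2 ^ (2 * n / 3)` up to factors
polynomial in `n` and linear in the bit length of the weights, which suffices as `2 ≤ ω`.
Enumerating the traces on a first part of `⌈2 * n / 3⌉` vertices and computing minimum cuts by
pushing and relabelling yields a balanced vertex set whose cut is at most the cutwidth. Both sides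
of this set are then ordered optimally by dynamic programming over subsets.
-/

/-! Write m = `part n` = ⌈2n/3⌉, let P be the set of the first m vertices, and let cut(S) be the
weight of the arcs that enter S.

Existence of a good split. Along an optimal ordering the prefixes pick up the vertices of P one at a
time, so some prefix contains exactly n - m of them, and its cut is at most the cutwidth cw
(`exists_setCut_le_cutwidth`). The algorithm runs through all 2^m subsets X of P, keeps those with n
- m elements, and computes a minimum cut among the sets S with S ∩ P = X. The prefix competes for
its own trace, so the best set found has cut at most cw. Every such S contains n - m vertices and
misses 2m - n vertices; since 3m ≥ 2n, both S and its complement have at most m vertices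
(`findSet_spec`).

From the split to an ordering. Place S before its complement. An arc that enters S ∩ Q or S ∪ Q
enters S or Q, hence cut(S ∩ Q) and cut(S ∪ Q) are at most cut(S) + cut(Q). With Q ranging over the
prefixes of an optimal ordering, this ordering restricted to S and to the complement gives cuts of
at most 2 cw. Dynamic programming over the at most 2^m subsets of each side does at least as well
(`order_spec`). The factor is thus 2 for every ε, and the accuracy parameter plays no role.

Running time. There are 2^m iterations of polynomial length on numbers whose bit length is
polynomial in n plus that of the largest weight. No fast matrix product is involved: the span of the
output matrices of a bilinear algorithm has dimension N², so ω ≥ 2 (`two_le_matMulExponent`), and τ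
> 2 leaves the factor 2^((τ-2)n/3) to absorb all polynomials in n.

The algorithm is written in a small structured language. `Cmd.runs` transfers effect and cost to the
machine, `Cmd.steps_le` bounds the cost by a polynomial times `big` to the nesting depth of long
loops, which is 1 here, and frames (`Cmd.frame`) record what a command leaves untouched.

Arrays: 0, 1, 2 residual capacities, excesses, labels; 3 bits of the current code; 4 best set; 5, 6
free vertices and their ranks; 7 current set; 8 table; 9 positions; 10 powers of two. Variables: 4
current code; 9 current cut; 10 best cut; 11, 12 the numbers m and n - m; 13 the side being ordered;
14 number of vertices not yet placed; 15 chosen vertex; 16 running minimum. -/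

section CutwidthProof

open Finset

namespace RAM

/-! ### A structured language over the random access machine -/

/-- The read-only parameters of a structured program: the number `n` that bounds the iterations
of ordinary loops, the number `big` that bounds the iterations of long loops, and the cap of all
assigned values, above which the arrays are stored. -/
structure Params where
  n : ℕ
  big : ℕ
  cap : ℕ

/-- Expressions without side effects. -/
inductive Expr : Type
  | const (c : ℕ) : Expr
  | var (x : ℕ) : Expr
  | size : Expr
  | big : Expr
  | cap : Expr
  | add (a b : Expr) : Expr
  | sub (a b : Expr) : Expr
  | ite (c a b : Expr) : Expr
  | mem (a : Expr) : Expr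
  | arr (k : Fin 16) (a : Expr) : Expr
  | sum (x : ℕ) (a : Expr) : Expr

/-- The cell `i` of the array `k`. -/
def State.arr (p : Params) (s : State) (k : Fin 16) (i : ℕ) : ℕ := s.mem (p.cap + 16 * i + k)

/-- `array k at i := v` -/
def State.setArr (p : Params) (s : State) (k : Fin 16) (i v : ℕ) : State :=
  s.setMem (p.cap + 16 * i + k) v

/-- The value of an expression. -/
def Expr.val (p : Params) : Expr → State → ℕ
  | .const c, _ => c
  | .var x, s => s.reg x
  | .size, _ => p.n
  | .big, _ => p.big
  | .cap, _ => p.cap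
  | .add a b, s => a.val p s + b.val p s
  | .sub a b, s => a.val p s - b.val p s
  | .ite c a b, s => if c.val p s = 0 then b.val p s else a.val p s
  | .mem a, s => s.mem (a.val p s)
  | .arr k a, s => s.arr p k (a.val p s)
  | .sum x a, s => ∑ i ∈ range p.n, a.val p (s.setReg x i)

/-- Commands. Assigned values are cut off at the cap. -/
inductive Cmd : Type
  | set (x : ℕ) (a : Expr) : Cmd
  | put (k : Fin 16) (i a : Expr) : Cmd
  | poke (i a : Expr) : Cmd
  | seq (P Q : Cmd) : Cmd
  | ite (c : Expr) (P Q : Cmd) : Cmd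
  | loop (x : ℕ) (P : Cmd) : Cmd
  | longLoop (x : ℕ) (P : Cmd) : Cmd

/-- Runs `f` on the states with the loop variable `x` set to `0, …, k - 1`. -/
def iter (f : State → State) (x : ℕ) : ℕ → State → State
  | 0, s => s
  | k + 1, s => f ((iter f x k s).setReg x k)

/-- The effect of a command. -/
def Cmd.eval (p : Params) : Cmd → State → State
  | .set x a, s => s.setReg x (min (a.val p s) p.cap)
  | .put k i a, s => s.setArr p k (i.val p s) (min (a.val p s) p.cap)
  | .poke i a, s => s.setMem (i.val p s) (min (a.val p s) p.cap)
  | .seq P Q, s => Q.eval p (P.eval p s)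
  | .ite c P Q, s => if c.val p s = 0 then Q.eval p s else P.eval p s
  | .loop x P, s => iter (P.eval p) x p.n s
  | .longLoop x P, s => iter (P.eval p) x p.big s

/-! ### Compilation -/

/-- A sequence of programs. -/
def Program.block : List Program → Program
  | [] => .const 5 0
  | [P] => P
  | P :: l => .seq P (Program.block l)

/-- The program that computes an expression in the temporary register `d`. Register `0`, `1`, `2`
hold the parameters, register `3` is zero, `2 * x + 4` is the variable `x`, and `2 * d + 5` is the
temporary `d`. -/
def Expr.code : Expr → ℕ → Program
  | .const c, d => .const (2 * d + 5) c
  | .var x, d => .add (2 * d + 5) (2 * x + 4) 3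
  | .size, d => .add (2 * d + 5) 0 3
  | .big, d => .add (2 * d + 5) 1 3
  | .cap, d => .add (2 * d + 5) 2 3
  | .add a b, d => .seq (a.code d) (.seq (b.code (d + 1))
      (.add (2 * d + 5) (2 * d + 5) (2 * (d + 1) + 5)))
  | .sub a b, d => .seq (a.code d) (.seq (b.code (d + 1))
      (.sub (2 * d + 5) (2 * d + 5) (2 * (d + 1) + 5)))
  | .ite c a b, d => .seq (c.code d) (.cond (2 * d + 5) (a.code d) (b.code d))
  | .mem a, d => .seq (a.code d) (.load (2 * d + 5) (2 * d + 5))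
  | .arr k a, d => .seq (a.code d) (.seq (arrayAddress k d) (.load (2 * d + 5) (2 * d + 5)))
  | .sum x a, d => Program.block [.const (2 * d + 5) 0, .add (2 * (d + 1) + 5) (2 * x + 4) 3,
      .add (2 * (d + 2) + 5) 0 3, .const (2 * x + 4) 0,
      .loop (2 * (d + 2) + 5) (Program.block [a.code (d + 3),
        .add (2 * d + 5) (2 * d + 5) (2 * (d + 3) + 5), .const (2 * (d + 3) + 5) 1,
        .add (2 * x + 4) (2 * x + 4) (2 * (d + 3) + 5),
        .sub (2 * (d + 2) + 5) (2 * (d + 2) + 5) (2 * (d + 3) + 5)]),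
      .add (2 * x + 4) (2 * (d + 1) + 5) 3]
where
  /-- Turns the index in the temporary `d` into the address of the cell of the array `k`. -/
  arrayAddress (k : Fin 16) (d : ℕ) : Program := Program.block
    [.add (2 * d + 5) (2 * d + 5) (2 * d + 5), .add (2 * d + 5) (2 * d + 5) (2 * d + 5),
      .add (2 * d + 5) (2 * d + 5) (2 * d + 5), .add (2 * d + 5) (2 * d + 5) (2 * d + 5),
      .const (2 * (d + 1) + 5) k, .add (2 * d + 5) (2 * (d + 1) + 5) (2 * d + 5),
      .add (2 * d + 5) (2 * d + 5) 2]

/-- The program that cuts the temporary `d` off at the cap. -/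
def capCode (d : ℕ) : Program :=
  .seq (.sub (2 * (d + 1) + 5) (2 * d + 5) 2)
    (.sub (2 * d + 5) (2 * d + 5) (2 * (d + 1) + 5))

/-- The program that runs `P` with the loop variable `x` set to `0, …, r - 1`, where `r` is the
contents of the register `g`. -/
def loopCode (g x d : ℕ) (P : Program) : Program :=
  Program.block [.const (2 * d + 5) 0, .add (2 * (d + 1) + 5) g 3,
    .loop (2 * (d + 1) + 5) (Program.block [.add (2 * x + 4) (2 * d + 5) 3, P,
      .const (2 * (d + 2) + 5) 1, .add (2 * d + 5) (2 * d + 5) (2 * (d + 2) + 5),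
      .sub (2 * (d + 1) + 5) (2 * (d + 1) + 5) (2 * (d + 2) + 5)])]

/-- The compiled command. Only temporaries from `d` on are used. -/
def Cmd.code : Cmd → ℕ → Program
  | .set x a, d => .seq (a.code d) (.seq (capCode d) (.add (2 * x + 4) (2 * d + 5) 3))
  | .put k i a, d => .seq (i.code d) (.seq (Expr.code.arrayAddress k d) (.seq (a.code (d + 1))
      (.seq (capCode (d + 1)) (.store (2 * d + 5) (2 * (d + 1) + 5)))))
  | .poke i a, d => .seq (i.code d) (.seq (a.code (d + 1))
      (.seq (capCode (d + 1)) (.store (2 * d + 5) (2 * (d + 1) + 5))))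
  | .seq P Q, d => .seq (P.code d) (Q.code d)
  | .ite c P Q, d => .seq (c.code d) (.cond (2 * d + 5) (P.code d) (Q.code d))
  | .loop x P, d => loopCode 0 x d (P.code (d + 2))
  | .longLoop x P, d => loopCode 1 x d (P.code (d + 2))

/-! ### Runs with a cost bound -/

/-- Started in `s`, the program halts with cost at most `c` in a state that satisfies `Q`. -/
def Runs (P : Program) (s : State) (c : ℕ) (Q : State → Prop) : Prop :=
  ∃ s' t, Exec P s s' t ∧ t ≤ c ∧ Q s'

theorem Runs.seq {P P' : Program} {s : State} {c c' : ℕ} {Q R : State → Prop}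
    (h : Runs P s c R) (h' : ∀ s', R s' → Runs P' s' c' Q) : Runs (.seq P P') s (c + c') Q := by
  obtain ⟨s', t, e, ht, r⟩ := h
  obtain ⟨s'', t', e', ht', q⟩ := h' s' r
  exact ⟨s'', t + t', .seq e e', by omega, q⟩

theorem Runs.mono {P : Program} {s : State} {c c' : ℕ} {Q R : State → Prop}
    (h : Runs P s c R) (hc : c ≤ c') (h' : ∀ s', R s' → Q s') : Runs P s c' Q := by
  obtain ⟨s', t, e, ht, r⟩ := h
  exact ⟨s', t, e, ht.trans hc, h' s' r⟩

theorem Runs.const {x c w : ℕ} {s : State} {Q : State → Prop} (hc : c < 2 ^ w)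
    (h : Q (s.setReg x c)) : Runs (.const x c) s (2 * w + 1) Q :=
  ⟨_, _, .const x c s, by have := Nat.size_le.2 hc; omega, h⟩

theorem Runs.add {x y z w : ℕ} {s : State} {Q : State → Prop} (hy : s.reg y < 2 ^ w)
    (hz : s.reg z < 2 ^ w) (h : Q (s.setReg x (s.reg y + s.reg z))) :
    Runs (.add x y z) s (2 * w + 1) Q :=
  ⟨_, _, .add x y z s, by have := Nat.size_le.2 hy; have := Nat.size_le.2 hz; omega, h⟩

theorem Runs.sub {x y z w : ℕ} {s : State} {Q : State → Prop} (hy : s.reg y < 2 ^ w)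
    (hz : s.reg z < 2 ^ w) (h : Q (s.setReg x (s.reg y - s.reg z))) :
    Runs (.sub x y z) s (2 * w + 1) Q :=
  ⟨_, _, .sub x y z s, by have := Nat.size_le.2 hy; have := Nat.size_le.2 hz; omega, h⟩

theorem Runs.load {x y w : ℕ} {s : State} {Q : State → Prop} (hy : s.reg y < 2 ^ w)
    (hz : s.mem (s.reg y) < 2 ^ w) (h : Q (s.setReg x (s.mem (s.reg y)))) :
    Runs (.load x y) s (2 * w + 1) Q :=
  ⟨_, _, .load x y s, by have := Nat.size_le.2 hy; have := Nat.size_le.2 hz; omega, h⟩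

theorem Runs.store {x y w : ℕ} {s : State} {Q : State → Prop} (hy : s.reg x < 2 ^ w)
    (hz : s.reg y < 2 ^ w) (h : Q (s.setMem (s.reg x) (s.reg y))) :
    Runs (.store x y) s (2 * w + 1) Q :=
  ⟨_, _, .store x y s, by have := Nat.size_le.2 hy; have := Nat.size_le.2 hz; omega, h⟩

theorem Runs.cond {x w c c' : ℕ} {P P' : Program} {s : State} {Q : State → Prop}
    (hx : s.reg x < 2 ^ w) (h : s.reg x ≠ 0 → Runs P s c Q) (h' : s.reg x = 0 → Runs P' s c' Q) :
    Runs (.cond x P P') s (2 * w + 1 + c + c') Q := by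
  have := Nat.size_le.2 hx
  by_cases h0 : s.reg x = 0
  · obtain ⟨s', t, e, ht, q⟩ := h' h0
    exact ⟨s', _, .condFalse h0 e, by omega, q⟩
  · obtain ⟨s', t, e, ht, q⟩ := h h0
    exact ⟨s', _, .condTrue h0 e, by omega, q⟩

/-- A loop that counts the register `x` down to zero. -/
theorem Runs.loop {x w c : ℕ} {P : Program} (I : ℕ → State → Prop)
    (hI : ∀ k s, I k s → s.reg x = k) :
    ∀ (k : ℕ) (s : State), k < 2 ^ w → I k s →
      (∀ j s, j < k → I (j + 1) s → Runs P s c (I j)) →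
      Runs (.loop x P) s (k * (2 * w + 1 + c) + (2 * w + 1)) (I 0)
  | 0, s, _, h, _ => ⟨s, _, .loopDone (hI _ _ h), by rw [hI _ _ h]; simp, h⟩
  | k + 1, s, hk, h, hP => by
    obtain ⟨s', t, e, ht, q⟩ := hP k s k.lt_succ_self h
    obtain ⟨s'', t', e', ht', q'⟩ := Runs.loop (w := w) I hI k s' (by omega) q
      fun j s hj => hP j s (by omega)
    have hx := hI _ _ h
    have := Nat.size_le.2 (hx.symm ▸ hk : s.reg x < 2 ^ w)
    refine ⟨s'', _, .loopStep (by omega) e e', ?_, q'⟩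
    rw [Nat.add_mul]; omega

end RAM
namespace RAM

/-! ### Correctness and cost of compiled expressions -/

/-- An exponent for a bound of all numbers that occur in the evaluation of an expression. -/
def Expr.weight : Expr → ℕ
  | .const c => c
  | .var _ | .size | .big | .cap => 0
  | .add a b | .sub a b => a.weight + b.weight + 1
  | .ite c a b => c.weight + a.weight + b.weight
  | .mem a => a.weight
  | .arr _ a => a.weight + 5
  | .sum _ a => a.weight + 1

/-- The number of instructions of the evaluation of an expression. -/
def Expr.steps (n : ℕ) : Expr → ℕ
  | .const _ | .var _ | .size | .big | .cap => 1
  | .add a b | .sub a b => a.steps n + b.steps n + 1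
  | .ite c a b => c.steps n + a.steps n + b.steps n + 1
  | .mem a => a.steps n + 1
  | .arr _ a => a.steps n + 8
  | .sum _ a => n * (a.steps n + 5) + 6

/-- The variables of a structured program, and the memory. -/
def State.user (s : State) : State := ⟨fun x => s.reg (2 * x + 4), s.mem⟩

/-- All cells are at most `M`. -/
def State.Bounded (M : ℕ) (s : State) : Prop := (∀ x, s.reg x ≤ M) ∧ ∀ a, s.mem a ≤ M

/-- The parameters are at most `M`. -/
structure Params.Bounded (p : Params) (M : ℕ) : Prop where
  pos : 1 ≤ M
  n_le : p.n ≤ M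
  big_le : p.big ≤ M
  cap_le : p.cap ≤ M

/-- The parameter registers of the machine hold the parameters, and the user part of the state is
bounded. -/
structure Ambient (p : Params) (M : ℕ) (s : State) : Prop where
  n_eq : s.reg 0 = p.n
  big_eq : s.reg 1 = p.big
  cap_eq : s.reg 2 = p.cap
  zero_eq : s.reg 3 = 0
  bounded : s.user.Bounded M

/-- Only temporaries from `d` on have changed. -/
def Keeps (d : ℕ) (s s' : State) : Prop :=
  s'.mem = s.mem ∧ ∀ y, y % 2 = 0 ∨ y < 2 * d + 5 → s'.reg y = s.reg y

theorem Keeps.refl (d : ℕ) (s : State) : Keeps d s s := ⟨rfl, fun _ _ => rfl⟩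

theorem Keeps.trans {d d' : ℕ} {s s' s'' : State} (h : Keeps d s s') (h' : Keeps d' s' s'')
    (hd : d ≤ d') : Keeps d s s'' :=
  ⟨h'.1.trans h.1, fun y hy => (h'.2 y (by omega)).trans (h.2 y hy)⟩

theorem Keeps.setReg {d y v : ℕ} {s s' : State} (h : Keeps d s s') (hy : y % 2 = 1)
    (hd : 2 * d + 5 ≤ y) : Keeps d s (s'.setReg y v) :=
  ⟨h.1, fun z hz => by
    rw [← h.2 z hz]
    exact Function.update_of_ne (by omega) _ _⟩

theorem Keeps.user {d : ℕ} {s s' : State} (h : Keeps d s s') : s'.user = s.user := by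
  obtain ⟨h1, h2⟩ := h
  simp only [State.user, h1]
  congr 1
  funext x
  exact h2 _ (by omega)

theorem Keeps.ambient {p : Params} {M d : ℕ} {s s' : State} (h : Keeps d s s')
    (hs : Ambient p M s) : Ambient p M s' where
  n_eq := (h.2 0 (by omega)).trans hs.n_eq
  big_eq := (h.2 1 (by omega)).trans hs.big_eq
  cap_eq := (h.2 2 (by omega)).trans hs.cap_eq
  zero_eq := (h.2 3 (by omega)).trans hs.zero_eq
  bounded := h.user ▸ hs.bounded

theorem State.Bounded.setReg {M x v : ℕ} {s : State} (h : s.Bounded M) (hv : v ≤ M) :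
    (s.setReg x v).Bounded M :=
  ⟨fun y => by
    simp only [State.setReg, Function.update_apply]
    split_ifs
    exacts [hv, h.1 y], h.2⟩

theorem State.Bounded.setMem {M a v : ℕ} {s : State} (h : s.Bounded M) (hv : v ≤ M) :
    (s.setMem a v).Bounded M :=
  ⟨h.1, fun y => by
    simp only [State.setMem, Function.update_apply]
    split_ifs
    exacts [hv, h.2 y]⟩

theorem State.user_setReg (s : State) (x v : ℕ) :
    (s.setReg (2 * x + 4) v).user = s.user.setReg x v := by
  simp only [State.user, State.setReg, State.mk.injEq, and_true]
  funext y
  simp [Function.update_apply]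

@[simp] theorem State.reg_setReg (s : State) (x v y : ℕ) :
    (s.setReg x v).reg y = if y = x then v else s.reg y := by
  simp [State.setReg, Function.update_apply]

@[simp] theorem State.mem_setReg (s : State) (x v : ℕ) : (s.setReg x v).mem = s.mem := rfl

@[simp] theorem State.mem_setMem (s : State) (a v b : ℕ) :
    (s.setMem a v).mem b = if b = a then v else s.mem b := by
  simp [State.setMem, Function.update_apply]

theorem pow_mul_lt_of_le {n M w i j : ℕ} (h : (n + 2) ^ j * M < 2 ^ w) (hij : i ≤ j) :
    (n + 2) ^ i * M < 2 ^ w :=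
  (Nat.mul_le_mul_right _ (Nat.pow_le_pow_right (by omega) hij)).trans_lt h

theorem lt_of_pow_mul_lt {n M w j : ℕ} (h : (n + 2) ^ j * M < 2 ^ w) : M < 2 ^ w := by
  simpa using pow_mul_lt_of_le h (Nat.zero_le j)

/-- An addition at most doubles and a sum over `range p.n` multiplies by at most n, so each costs
one factor n + 2. A read from memory falls back to M. A constant c is paid for by c factors, as c ≤
2^c. -/
theorem Expr.val_le {p : Params} {M : ℕ} (hp : p.Bounded M) :
    ∀ (E : Expr) {s : State}, s.Bounded M → E.val p s ≤ (p.n + 2) ^ E.weight * M := by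
  have mono : ∀ {i j : ℕ}, i ≤ j → (p.n + 2) ^ i * M ≤ (p.n + 2) ^ j * M := fun hij =>
    Nat.mul_le_mul_right _ (Nat.pow_le_pow_right (by omega) hij)
  have ge : ∀ j, M ≤ (p.n + 2) ^ j * M := fun j => by simpa using mono (Nat.zero_le j)
  intro E
  induction E with
  | const c =>
    intro s hs
    have h1 : c ≤ (p.n + 2) ^ c :=
      (Nat.lt_two_pow_self (n := c)).le.trans (Nat.pow_le_pow_left (by omega) c)
    exact h1.trans (Nat.le_mul_of_pos_right _ hp.pos)
  | var x => intro s hs; exact (hs.1 x).trans (ge _)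
  | size => intro s hs; exact hp.n_le.trans (ge _)
  | big => intro s hs; exact hp.big_le.trans (ge _)
  | cap => intro s hs; exact hp.cap_le.trans (ge _)
  | add a b iha ihb =>
    intro s hs
    have h1 := (iha hs).trans (mono (Nat.le_add_right a.weight b.weight))
    have h2 := (ihb hs).trans (mono (Nat.le_add_left b.weight a.weight))
    have h3 : (p.n + 2) ^ (a.weight + b.weight + 1) * M
        = (p.n + 2) * ((p.n + 2) ^ (a.weight + b.weight) * M) := by ring
    simp only [Expr.val, Expr.weight]
    rw [h3]
    nlinarith
  | sub a b iha ihb =>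
    intro s hs
    have h1 := (iha hs).trans (mono (show a.weight ≤ a.weight + b.weight + 1 by omega))
    simp only [Expr.val, Expr.weight]
    omega
  | ite c a b ihc iha ihb =>
    intro s hs
    simp only [Expr.val, Expr.weight]
    split_ifs
    · exact (ihb hs).trans (mono (by omega))
    · exact (iha hs).trans (mono (by omega))
  | mem a iha => intro s hs; exact (hs.2 _).trans (ge _)
  | arr k a iha => intro s hs; exact (hs.2 _).trans (ge _)
  | sum x a iha =>
    intro s hs
    simp only [Expr.val, Expr.weight]
    have : ∀ i ∈ range p.n, a.val p (s.setReg x i) ≤ (p.n + 2) ^ a.weight * M := fun i hi =>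
      iha (hs.setReg ((mem_range.1 hi).le.trans hp.n_le))
    have h := sum_le_card_nsmul _ _ _ this
    rw [card_range, smul_eq_mul] at h
    calc _ ≤ _ := h
      _ ≤ (p.n + 2) * ((p.n + 2) ^ a.weight * M) := Nat.mul_le_mul_right _ (by omega)
      _ = _ := by ring

/-- The machine cannot multiply, so 16 v is obtained by four doublings. The address is at most (1 +
16 + 15) X for X = (n + 2)^e M, and 32 ≤ (n + 2)^5 accounts for the exponent e + 5. -/
theorem arrayAddress_runs {p : Params} {M w d v e : ℕ} {s : State} (k : Fin 16)
    (hp : p.Bounded M) (hs : Ambient p M s) (hv : s.reg (2 * d + 5) = v)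
    (hvM : v ≤ (p.n + 2) ^ e * M) (h : (p.n + 2) ^ (e + 5) * M < 2 ^ w) :
    Runs (Expr.code.arrayAddress k d) s (7 * (2 * w + 1))
      fun s' => Keeps d s s' ∧ s'.reg (2 * d + 5) = p.cap + 16 * v + k := by
  have h1 : 32 * ((p.n + 2) ^ e * M) ≤ (p.n + 2) ^ (e + 5) * M := by
    have : 2 ^ 5 ≤ (p.n + 2) ^ 5 := Nat.pow_le_pow_left (by omega) 5
    calc 32 * ((p.n + 2) ^ e * M) ≤ (p.n + 2) ^ 5 * ((p.n + 2) ^ e * M) :=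
          Nat.mul_le_mul_right _ this
      _ = (p.n + 2) ^ (e + 5) * M := by ring
  have h2 : M ≤ (p.n + 2) ^ e * M := Nat.le_mul_of_pos_left _ (by positivity)
  have hM := hp.pos
  have hk := k.2
  have hc := hp.cap_le
  set X := (p.n + 2) ^ e * M
  have hX : 32 * X < 2 ^ w := h1.trans_lt h
  have hcap := hs.cap_eq
  have hkw : (k : ℕ) < 2 ^ w := by
    rcases Nat.lt_or_ge 15 (2 ^ w) with h | h <;> omega
  refine Runs.mono (c := (2 * w + 1) + ((2 * w + 1) + ((2 * w + 1) + ((2 * w + 1) +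
    ((2 * w + 1) + ((2 * w + 1) + (2 * w + 1)))))))
    (.seq (R := fun s' => s' = s.setReg (2 * d + 5) (2 * v)) (.add (w := w) ?_ ?_ ?_) ?_)
    (le_of_eq (by ring)) fun _ h => h
  · omega
  · omega
  · rw [hv]; congr 1; omega
  rintro _ rfl
  refine .seq (R := fun s' => s' = (s.setReg (2 * d + 5) (2 * v)).setReg (2 * d + 5) (4 * v))
    (.add ?_ ?_ ?_) ?_
  · simp; omega
  · simp; omega
  · simp only [State.reg_setReg, if_true]; congr 1; omega
  rintro _ rfl
  refine .seq (R := fun s' => s' = ((s.setReg (2 * d + 5) (2 * v)).setReg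
    (2 * d + 5) (4 * v)).setReg (2 * d + 5) (8 * v)) (.add ?_ ?_ ?_) ?_
  · simp; omega
  · simp; omega
  · simp only [State.reg_setReg, if_true]; congr 1; omega
  rintro _ rfl
  refine .seq (R := fun s' => Keeps d s s' ∧ s'.reg (2 * d + 5) = 16 * v) (.add ?_ ?_ ?_) ?_
  · simp; omega
  · simp; omega
  · refine ⟨(((((Keeps.refl d s).setReg ?_ ?_).setReg ?_ ?_).setReg ?_ ?_).setReg ?_ ?_), ?_⟩ <;>
      (try simp) <;> omega
  rintro s1 ⟨k1, e1⟩
  refine .seq (R := fun s' => Keeps d s s' ∧ s'.reg (2 * d + 5) = 16 * v ∧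
    s'.reg (2 * (d + 1) + 5) = k) (.const ?_ ?_) ?_
  · exact hkw
  · refine ⟨k1.setReg (by omega) (by omega), ?_, ?_⟩
    · simp [e1]
    · simp
  rintro s2 ⟨k2, e2, e2'⟩
  refine .seq (R := fun s' => Keeps d s s' ∧ s'.reg (2 * d + 5) = 16 * v + k) (.add ?_ ?_ ?_) ?_
  · rw [e2']; exact hkw
  · omega
  · refine ⟨k2.setReg (by omega) (by omega), ?_⟩
    simp [e2, e2', add_comm]
  rintro s3 ⟨k3, e3⟩
  have hc3 := (k3.2 2 (by omega)).trans hcap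
  refine .add ?_ ?_ ⟨k3.setReg (by omega) (by omega), ?_⟩
  · omega
  · omega
  · simp [e3, hc3]; omega

/-- Compiled expressions compute the value, with the stated cost. -/
theorem Expr.runs {p : Params} {M w : ℕ} (hp : p.Bounded M) :
    ∀ (E : Expr) (d : ℕ) (s : State), Ambient p M s → (p.n + 2) ^ E.weight * M < 2 ^ w →
      Runs (E.code d) s (E.steps p.n * (2 * w + 1))
        fun s' => Keeps d s s' ∧ s'.reg (2 * d + 5) = E.val p s.user := by
  intro E
  induction E with
  | const c =>
    intro d s hs h
    have hc := (Expr.val_le hp (.const c) hs.bounded).trans_lt h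
    simp only [Expr.steps, one_mul]
    exact .const hc ⟨(Keeps.refl d s).setReg (by omega) le_rfl, by simp [Expr.val]⟩
  | var x =>
    intro d s hs h
    have hc := (Expr.val_le hp (.var x) hs.bounded).trans_lt h
    simp only [Expr.steps, one_mul]
    refine .add hc (by simp [hs.zero_eq]) ⟨(Keeps.refl d s).setReg (by omega) le_rfl, ?_⟩
    simp [Expr.val, hs.zero_eq, State.user]
  | size =>
    intro d s hs h
    have hc := (Expr.val_le hp .size hs.bounded).trans_lt h
    simp only [Expr.steps, one_mul]
    refine .add (by rwa [hs.n_eq]) (by simp [hs.zero_eq])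
      ⟨(Keeps.refl d s).setReg (by omega) le_rfl, ?_⟩
    simp [Expr.val, hs.zero_eq, hs.n_eq]
  | big =>
    intro d s hs h
    have hc := (Expr.val_le hp .big hs.bounded).trans_lt h
    simp only [Expr.steps, one_mul]
    refine .add (by rwa [hs.big_eq]) (by simp [hs.zero_eq])
      ⟨(Keeps.refl d s).setReg (by omega) le_rfl, ?_⟩
    simp [Expr.val, hs.zero_eq, hs.big_eq]
  | cap =>
    intro d s hs h
    have hc := (Expr.val_le hp .cap hs.bounded).trans_lt h
    simp only [Expr.steps, one_mul]
    refine .add (by rwa [hs.cap_eq]) (by simp [hs.zero_eq])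
      ⟨(Keeps.refl d s).setReg (by omega) le_rfl, ?_⟩
    simp [Expr.val, hs.zero_eq, hs.cap_eq]
  | add a b iha ihb =>
    intro d s hs h
    simp only [Expr.weight] at h
    have ha := pow_mul_lt_of_le h (show a.weight ≤ _ by omega)
    have hb := pow_mul_lt_of_le h (show b.weight ≤ _ by omega)
    refine Runs.mono (.seq (iha d s hs ha) fun s1 ⟨k1, e1⟩ => .seq
      (R := fun s2 => Keeps d s s2 ∧ s2.reg (2 * d + 5) = a.val p s.user ∧
        s2.reg (2 * (d + 1) + 5) = b.val p s.user)
      ((ihb (d + 1) s1 (k1.ambient hs) hb).mono le_rfl ?_)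
      fun s2 ⟨k2, e2, e2'⟩ => .add (w := w) ?_ ?_ ?_)
      (le_of_eq (by simp only [Expr.steps]; ring)) fun _ h => h
    · rintro s2 ⟨k2, e2⟩
      refine ⟨k1.trans k2 (by omega), (k2.2 _ (by omega)).trans e1, by rw [e2, k1.user]⟩
    · rw [e2]; exact (Expr.val_le hp a hs.bounded).trans_lt ha
    · rw [e2']; exact (Expr.val_le hp b hs.bounded).trans_lt hb
    · exact ⟨k2.setReg (by omega) le_rfl, by simp only [State.reg_setReg, if_true, e2, e2', val]⟩
  | sub a b iha ihb =>
    intro d s hs h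
    simp only [Expr.weight] at h
    have ha := pow_mul_lt_of_le h (show a.weight ≤ _ by omega)
    have hb := pow_mul_lt_of_le h (show b.weight ≤ _ by omega)
    refine Runs.mono (.seq (iha d s hs ha) fun s1 ⟨k1, e1⟩ => .seq
      (R := fun s2 => Keeps d s s2 ∧ s2.reg (2 * d + 5) = a.val p s.user ∧
        s2.reg (2 * (d + 1) + 5) = b.val p s.user)
      ((ihb (d + 1) s1 (k1.ambient hs) hb).mono le_rfl ?_)
      fun s2 ⟨k2, e2, e2'⟩ => .sub (w := w) ?_ ?_ ?_)
      (le_of_eq (by simp only [Expr.steps]; ring)) fun _ h => h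
    · rintro s2 ⟨k2, e2⟩
      refine ⟨k1.trans k2 (by omega), (k2.2 _ (by omega)).trans e1, by rw [e2, k1.user]⟩
    · rw [e2]; exact (Expr.val_le hp a hs.bounded).trans_lt ha
    · rw [e2']; exact (Expr.val_le hp b hs.bounded).trans_lt hb
    · exact ⟨k2.setReg (by omega) le_rfl, by simp only [State.reg_setReg, if_true, e2, e2', val]⟩
  | ite c a b ihc iha ihb =>
    intro d s hs h
    simp only [Expr.weight] at h
    have hc := pow_mul_lt_of_le h (show c.weight ≤ _ by omega)
    have ha := pow_mul_lt_of_le h (show a.weight ≤ _ by omega)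
    have hb := pow_mul_lt_of_le h (show b.weight ≤ _ by omega)
    refine Runs.mono (.seq (ihc d s hs hc) fun s1 ⟨k1, e1⟩ => .cond (w := w) ?_
      (fun h0 => (iha d s1 (k1.ambient hs) ha).mono le_rfl ?_)
      (fun h0 => (ihb d s1 (k1.ambient hs) hb).mono le_rfl ?_))
      (le_of_eq (by simp only [Expr.steps]; ring)) fun _ h => h
    · rw [e1]; exact (Expr.val_le hp c hs.bounded).trans_lt hc
    · rintro s2 ⟨k2, e2⟩
      rw [e1] at h0
      exact ⟨k1.trans k2 le_rfl, by rw [e2, k1.user, val, if_neg h0]⟩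
    · rintro s2 ⟨k2, e2⟩
      rw [e1] at h0
      exact ⟨k1.trans k2 le_rfl, by rw [e2, k1.user, val, if_pos h0]⟩
  | mem a iha =>
    intro d s hs h
    simp only [Expr.weight] at h
    refine Runs.mono (.seq (iha d s hs h) fun s1 ⟨k1, e1⟩ => .load (w := w) ?_ ?_ ?_)
      (le_of_eq (by simp only [Expr.steps]; ring)) fun _ h => h
    · rw [e1]; exact (Expr.val_le hp a hs.bounded).trans_lt h
    · exact ((k1.ambient hs).bounded.2 _).trans_lt (lt_of_pow_mul_lt h)
    · refine ⟨k1.setReg (by omega) le_rfl, ?_⟩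
      simp only [State.reg_setReg, if_true, e1, k1.1, val]
      rfl
  | arr k a iha =>
    intro d s hs h
    simp only [Expr.weight] at h
    have ha := pow_mul_lt_of_le h (show a.weight ≤ _ by omega)
    refine Runs.mono (.seq (iha d s hs ha) fun s1 ⟨k1, e1⟩ => .seq
      (arrayAddress_runs k hp (k1.ambient hs) e1 (Expr.val_le hp a hs.bounded) h)
      fun s2 ⟨k2, e2⟩ => .load (w := w) ?_ ?_ ?_)
      (le_of_eq (by simp only [Expr.steps]; ring)) fun _ h => h
    · rw [e2]
      have h1 := Expr.val_le hp a hs.bounded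
      have h2 := hp.cap_le
      have h3 : M ≤ (p.n + 2) ^ a.weight * M := Nat.le_mul_of_pos_left _ (by positivity)
      have h4 : 2 ^ 5 ≤ (p.n + 2) ^ 5 := Nat.pow_le_pow_left (by omega) 5
      have h5 : (p.n + 2) ^ (a.weight + 5) * M
        = (p.n + 2) ^ 5 * ((p.n + 2) ^ a.weight * M) := by ring
      have h6 := Nat.mul_le_mul_right ((p.n + 2) ^ a.weight * M) h4
      have := hp.pos
      have := k.2
      omega
    · exact ((k2.ambient (k1.ambient hs)).bounded.2 _).trans_lt (lt_of_pow_mul_lt h)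
    · refine ⟨(k1.trans k2 le_rfl).setReg (by omega) le_rfl, ?_⟩
      simp only [State.reg_setReg, if_true, e2, k2.1, k1.1, val]
      rfl
  | sum x a iha =>
    intro d s hs h
    have hsum := Expr.val_le hp (.sum x a) hs.bounded
    simp only [Expr.weight] at h hsum
    simp only [Expr.val] at hsum ⊢
    have ha := pow_mul_lt_of_le h (show a.weight ≤ _ by omega)
    have hM := lt_of_pow_mul_lt h
    have hw : 1 < 2 ^ w := hp.pos.trans_lt hM
    -- the loop invariant
    let I : ℕ → State → Prop := fun k s' => k ≤ p.n ∧ s'.mem = s.mem ∧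
      (∀ y, y ≠ 2 * x + 4 → (y % 2 = 0 ∨ y < 2 * d + 5) → s'.reg y = s.reg y) ∧
      s'.reg (2 * x + 4) = p.n - k ∧
      s'.reg (2 * d + 5) = ∑ i ∈ range (p.n - k), a.val p (s.user.setReg x i) ∧
      s'.reg (2 * (d + 1) + 5) = s.reg (2 * x + 4) ∧ s'.reg (2 * (d + 2) + 5) = k
    have hsub : ∀ j, j ≤ p.n → ∑ i ∈ range j, a.val p (s.user.setReg x i) < 2 ^ w := fun j hj =>
      ((sum_le_sum_of_subset (range_subset_range.2 hj)).trans hsum).trans_lt h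
    refine Runs.mono (c := (2 * w + 1) + ((2 * w + 1) + ((2 * w + 1) + ((2 * w + 1) +
      ((p.n * (2 * w + 1 + (a.steps p.n * (2 * w + 1) + ((2 * w + 1) + ((2 * w + 1) + ((2 * w + 1)
        + (2 * w + 1)))))) + (2 * w + 1)) + (2 * w + 1))))))
      (.seq (R := fun s1 => Keeps d s s1 ∧ s1.reg (2 * d + 5) = 0) (.const (w := w) ?_ ?_) ?_)
      (le_of_eq (by simp only [Expr.steps]; ring)) fun _ h => h
    · positivity
    · exact ⟨(Keeps.refl d s).setReg (by omega) le_rfl, by simp⟩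
    rintro s1 ⟨k1, e1⟩
    refine .seq (R := fun s2 => Keeps d s s2 ∧ s2.reg (2 * d + 5) = 0 ∧
      s2.reg (2 * (d + 1) + 5) = s.reg (2 * x + 4)) (.add (w := w) ?_ ?_ ?_) ?_
    · rw [k1.2 _ (by omega)]; exact (hs.bounded.1 x).trans_lt hM
    · rw [(k1.ambient hs).zero_eq]; positivity
    · refine ⟨k1.setReg (by omega) (by omega), ?_, ?_⟩
      · simp [e1]
      · simp [(k1.ambient hs).zero_eq, k1.2 (2 * x + 4) (by omega)]
    rintro s2 ⟨k2, e2, f2⟩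
    refine .seq (R := fun s2 => Keeps d s s2 ∧ s2.reg (2 * d + 5) = 0 ∧
      s2.reg (2 * (d + 1) + 5) = s.reg (2 * x + 4) ∧ s2.reg (2 * (d + 2) + 5) = p.n)
      (.add (w := w) ?_ ?_ ?_) ?_
    · rw [(k2.ambient hs).n_eq]; exact hp.n_le.trans_lt hM
    · rw [(k2.ambient hs).zero_eq]; positivity
    · refine ⟨k2.setReg (by omega) (by omega), ?_, ?_, ?_⟩
      · simp [e2]
      · simpa using f2
      · simp [(k2.ambient hs).zero_eq, (k2.ambient hs).n_eq]
    rintro s3 ⟨k3, e3, f3, g3⟩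
    refine .seq (R := I p.n) (.const (w := w) ?_ ?_) ?_
    · positivity
    · refine ⟨le_rfl, k3.1, ?_, ?_, ?_, ?_, ?_⟩
      · intro y hy hy'
        simp [hy, k3.2 y hy']
      · simp
      · simp only [State.reg_setReg, show 2 * d + 5 ≠ 2 * x + 4 by omega]
        simpa using e3
      · simp only [State.reg_setReg, show 2 * (d + 1) + 5 ≠ 2 * x + 4 by omega]
        simpa using f3
      · simp only [State.reg_setReg, show 2 * (d + 2) + 5 ≠ 2 * x + 4 by omega]
        simpa using g3
    intro s4 h4
    refine .seq (R := I 0) (.loop I ?_ _ _ (hp.n_le.trans_lt hM) h4 ?_) ?_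
    · exact fun k s' h => h.2.2.2.2.2.2
    · rintro j t hj ⟨hjn, m1, m2, m3, m4, m5, m6⟩
      have hv : p.n - (j + 1) ≤ M := by have := hp.n_le; omega
      have hu : t.user = s.user.setReg x (p.n - (j + 1)) := by
        simp only [State.user, State.setReg, m1, State.mk.injEq, and_true]
        funext y
        simp only [Function.update_apply]
        split_ifs with hy
        · rw [hy, m3]
        · exact m2 _ (by omega) (by omega)
      have hamb : Ambient p M t := by
        refine ⟨?_, ?_, ?_, ?_, ?_⟩
        · rw [m2 0 (by omega) (by omega), hs.n_eq]
        · rw [m2 1 (by omega) (by omega), hs.big_eq]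
        · rw [m2 2 (by omega) (by omega), hs.cap_eq]
        · rw [m2 3 (by omega) (by omega), hs.zero_eq]
        · rw [hu]; exact hs.bounded.setReg hv
      refine .seq (iha (d + 3) t hamb ha) fun t1 ⟨k1, e1⟩ => ?_
      rw [hu] at e1
      have c1 := k1.2 (2 * d + 5) (by omega)
      refine .seq (R := fun t2 => t2.mem = t.mem ∧
          (∀ y, y ≠ 2 * d + 5 → (y % 2 = 0 ∨ y < 2 * d + 11) → t2.reg y = t.reg y) ∧
          t2.reg (2 * d + 5) = ∑ i ∈ range (p.n - j), a.val p (s.user.setReg x i))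
        (.add (w := w) ?_ ?_ ?_) ?_
      · rw [c1, m4]; exact hsub _ (by omega)
      · rw [e1]
        have := Expr.val_le hp a (s := s.user.setReg x (p.n - (j + 1)))
          (hs.bounded.setReg hv)
        exact this.trans_lt ha
      · refine ⟨k1.1, fun y hy hy' => ?_, ?_⟩
        · simp [hy, k1.2 y (by omega)]
        · simp only [State.reg_setReg, if_true, e1, c1, m4]
          rw [show p.n - j = p.n - (j + 1) + 1 by omega, sum_range_succ]
      rintro t2 ⟨q1, q2, q3⟩
      refine .seq (R := fun t3 => t3.mem = t.mem ∧
          (∀ y, y ≠ 2 * d + 5 → (y % 2 = 0 ∨ y < 2 * d + 11) → t3.reg y = t.reg y) ∧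
          t3.reg (2 * d + 5) = ∑ i ∈ range (p.n - j), a.val p (s.user.setReg x i) ∧
          t3.reg (2 * (d + 3) + 5) = 1) (.const (w := w) hw ?_) ?_
      · refine ⟨q1, fun y hy hy' => ?_, ?_, ?_⟩
        · simp [show y ≠ 2 * (d + 3) + 5 by omega, q2 y hy hy']
        · simp [q3]
        · simp
      rintro t3 ⟨q1, q2, q3, q4⟩
      refine .seq (R := fun t4 => t4.mem = t.mem ∧
          (∀ y, y ≠ 2 * d + 5 → y ≠ 2 * x + 4 → (y % 2 = 0 ∨ y < 2 * d + 11) →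
            t4.reg y = t.reg y) ∧
          t4.reg (2 * d + 5) = ∑ i ∈ range (p.n - j), a.val p (s.user.setReg x i) ∧
          t4.reg (2 * (d + 3) + 5) = 1 ∧ t4.reg (2 * x + 4) = p.n - j)
        (.add (w := w) ?_ ?_ ?_) ?_
      · rw [q2 _ (by omega) (by omega), m3]; omega
      · rw [q4]; exact hw
      · refine ⟨q1, fun y hy hy' hy'' => ?_, ?_, ?_, ?_⟩
        · simp [hy', q2 y hy hy'']
        · simp only [State.reg_setReg, show 2 * d + 5 ≠ 2 * x + 4 by omega]
          simpa using q3
        · simp only [State.reg_setReg, show 2 * (d + 3) + 5 ≠ 2 * x + 4 by omega]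
          simpa using q4
        · simp only [State.reg_setReg, if_true, q4, q2 (2 * x + 4) (by omega) (by omega), m3]
          omega
      rintro t4 ⟨q1, q2, q3, q4, q5⟩
      have q6 := q2 (2 * (d + 2) + 5) (by omega) (by omega) (by omega)
      refine .sub (w := w) ?_ ?_ ⟨by omega, q1.trans m1, fun y hy hy' => ?_, ?_, ?_, ?_, ?_⟩
      · rw [q6, m6]; have := hp.n_le; omega
      · rw [q4]; exact hw
      · simp only [State.reg_setReg, show y ≠ 2 * (d + 2) + 5 by omega, if_false]
        rcases eq_or_ne y (2 * d + 5) with rfl | h5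
        · omega
        · rw [q2 y h5 hy (by omega), m2 y hy hy']
      · rw [State.reg_setReg, if_neg (by omega), q5]
      · simpa using q3
      · rw [State.reg_setReg, if_neg (by omega), ← m5]
        exact q2 _ (by omega) (by omega) (by omega)
      · simp [q4, q6, m6]
    · rintro t ⟨-, m1, m2, m3, m4, m5, m6⟩
      refine .add (w := w) ?_ ?_ ⟨⟨m1, fun y hy => ?_⟩, ?_⟩
      · rw [m5]; exact (hs.bounded.1 x).trans_lt hM
      · rw [m2 3 (by omega) (by omega), hs.zero_eq]; positivity
      · simp only [State.reg_setReg]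
        split_ifs with h5
        · rw [h5, m5, m2 3 (by omega) (by omega), hs.zero_eq, add_zero]
        · exact m2 y h5 hy
      · simp only [State.reg_setReg, show 2 * d + 5 ≠ 2 * x + 4 by omega, if_false, m4,
          Nat.sub_zero]

end RAM
namespace RAM

/-! ### Correctness and cost of compiled commands -/

/-- An exponent for a bound of all numbers that occur in a run of a command. -/
def Cmd.weight : Cmd → ℕ
  | .set _ a => a.weight
  | .put _ i a => i.weight + a.weight + 5
  | .poke i a => i.weight + a.weight
  | .seq P Q => P.weight + Q.weight
  | .ite c P Q => c.weight + P.weight + Q.weight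
  | .loop _ P | .longLoop _ P => P.weight

/-- A bound of the number of instructions of a run of a command. -/
def Cmd.steps (n big : ℕ) : Cmd → ℕ
  | .set _ a => a.steps n + 3
  | .put _ i a => i.steps n + a.steps n + 10
  | .poke i a => i.steps n + a.steps n + 3
  | .seq P Q => P.steps n big + Q.steps n big
  | .ite c P Q => c.steps n + P.steps n big + Q.steps n big + 1
  | .loop _ P => n * (P.steps n big + 5) + 3
  | .longLoop _ P => big * (P.steps n big + 5) + 3

/-- The temporaries below `d` have not changed. -/
def KeepsTemps (d : ℕ) (s s' : State) : Prop :=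
  ∀ y, y % 2 = 1 → y < 2 * d + 5 → s'.reg y = s.reg y

theorem Keeps.keepsTemps {d : ℕ} {s s' : State} (h : Keeps d s s') : KeepsTemps d s s' :=
  fun y _ hy => h.2 y (Or.inr hy)

theorem Ambient.setReg {p : Params} {M x v : ℕ} {s : State} (hs : Ambient p M s) (hv : v ≤ M) :
    Ambient p M (s.setReg (2 * x + 4) v) where
  n_eq := by simp [hs.n_eq]
  big_eq := by simp [hs.big_eq]
  cap_eq := by simp [hs.cap_eq]
  zero_eq := by simp [hs.zero_eq]
  bounded := by rw [State.user_setReg]; exact hs.bounded.setReg hv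

theorem Ambient.setMem {p : Params} {M a v : ℕ} {s : State} (hs : Ambient p M s) (hv : v ≤ M) :
    Ambient p M (s.setMem a v) where
  n_eq := hs.n_eq
  big_eq := hs.big_eq
  cap_eq := hs.cap_eq
  zero_eq := hs.zero_eq
  bounded := hs.bounded.setMem (s := s.user) hv

/-- With truncated subtraction, min(v, c) = v - (v - c). -/
theorem capCode_runs {p : Params} {M w d v : ℕ} {s : State} (hp : p.Bounded M)
    (hs : Ambient p M s) (hM : M < 2 ^ w) (hv : s.reg (2 * d + 5) = v) (hvw : v < 2 ^ w) :
    Runs (capCode d) s (2 * (2 * w + 1))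
      fun s' => Keeps d s s' ∧ s'.reg (2 * d + 5) = min v p.cap := by
  have hcap := hp.cap_le
  refine Runs.mono (c := (2 * w + 1) + (2 * w + 1))
    (.seq (R := fun s1 => s1 = s.setReg (2 * (d + 1) + 5) (v - p.cap)) (.sub (w := w) ?_ ?_ ?_) ?_)
    (le_of_eq (by ring)) fun _ h => h
  · rwa [hv]
  · rw [hs.cap_eq]; omega
  · rw [hv, hs.cap_eq]
  rintro _ rfl
  refine .sub (w := w) ?_ ?_ ⟨((Keeps.refl d s).setReg ?_ ?_).setReg ?_ ?_, ?_⟩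
  · simpa [hv]
  · simp; omega
  any_goals omega
  · simp [hv]; omega

/-- Index and countdown live in two temporaries below those of the body, and the variable x is only
a copy made at the start of each round. Hence the body may overwrite x, as in `iter`. The invariant
is indexed by the number of rounds that remain. -/
theorem loopCode_runs {p : Params} {M w d g x r c : ℕ} {P : Program} {f : State → State}
    {s : State} (hg : g = 0 ∨ g = 1) (hs : Ambient p M s) (hr : s.reg g = r) (hrM : r ≤ M)
    (hM : M < 2 ^ w) (hM1 : 1 ≤ M)
    (hP : ∀ s, Ambient p M s → Runs P s (c * (2 * w + 1)) fun s' => Ambient p M s' ∧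
      s'.user = f s.user ∧ KeepsTemps (d + 2) s s') :
    Runs (loopCode g x d P) s ((r * (c + 5) + 3) * (2 * w + 1)) fun s' => Ambient p M s' ∧
      s'.user = iter f x r s.user ∧ KeepsTemps d s s' := by
  let I : ℕ → State → Prop := fun k s' => k ≤ r ∧ Ambient p M s' ∧
    s'.user = iter f x (r - k) s.user ∧ KeepsTemps d s s' ∧ s'.reg (2 * d + 5) = r - k ∧
    s'.reg (2 * (d + 1) + 5) = k
  refine Runs.mono (c := (2 * w + 1) + ((2 * w + 1) + (r * (2 * w + 1 + ((2 * w + 1) +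
    (c * (2 * w + 1) + ((2 * w + 1) + ((2 * w + 1) + (2 * w + 1)))))) + (2 * w + 1))))
    (.seq (R := fun s1 => Keeps d s s1 ∧ s1.reg (2 * d + 5) = 0) (.const (w := w) ?_ ?_) ?_)
    (le_of_eq (by ring)) fun _ h => h
  · positivity
  · exact ⟨(Keeps.refl d s).setReg (by omega) le_rfl, by simp⟩
  rintro s1 ⟨k1, e1⟩
  have hr1 := k1.2 g (by omega)
  refine .seq (R := I r) (.add (w := w) ?_ ?_ ?_) ?_
  · rw [hr1]; omega
  · rw [(k1.ambient hs).zero_eq]; positivity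
  · have k2 : Keeps d s (s1.setReg (2 * (d + 1) + 5) (s1.reg g + s1.reg 3)) :=
      k1.setReg (by omega) (by omega)
    refine ⟨le_rfl, k2.ambient hs, ?_, k2.keepsTemps, ?_, ?_⟩
    · rw [k2.user]; simp [iter]
    · simp [e1]
    · simp [hr1, hr, (k1.ambient hs).zero_eq]
  intro s2 h2
  refine Runs.mono (.loop I (fun k s h => h.2.2.2.2.2) r s2 (by omega) h2 ?_) le_rfl ?_
  · rintro j t hj ⟨hjr, m1, m2, m3, m4, m5⟩
    refine .seq (R := fun t1 => t1 = t.setReg (2 * x + 4) (r - (j + 1))) (.add (w := w) ?_ ?_ ?_) ?_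
    · rw [m4]; omega
    · rw [m1.zero_eq]; positivity
    · rw [m4, m1.zero_eq, add_zero]
    rintro _ rfl
    refine .seq (hP _ (m1.setReg (by omega))) fun t2 ⟨a2, u2, k2⟩ => ?_
    have hu : t2.user = iter f x (r - j) s.user := by
      rw [u2, State.user_setReg, m2, show r - j = r - (j + 1) + 1 by omega, iter]
    have hk2 : KeepsTemps (d + 2) t t2 := fun y hy hy' => by
      rw [k2 y hy hy']; rw [State.reg_setReg, if_neg (by omega)]
    refine .seq (R := fun t3 => Keeps (d + 2) t2 t3 ∧ t3.reg (2 * (d + 2) + 5) = 1)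
      (.const (w := w) (by omega) ?_) ?_
    · exact ⟨(Keeps.refl _ _).setReg (by omega) le_rfl, by simp⟩
    rintro t3 ⟨k3, e3⟩
    have q1 : t3.reg (2 * d + 5) = r - (j + 1) := by
      rw [k3.2 _ (by omega), hk2 _ (by omega) (by omega), m4]
    have q2 : t3.reg (2 * (d + 1) + 5) = j + 1 := by
      rw [k3.2 _ (by omega), hk2 _ (by omega) (by omega), m5]
    refine .seq (R := fun t4 => Keeps d t2 t4 ∧ t4.reg (2 * (d + 2) + 5) = 1 ∧
      t4.reg (2 * d + 5) = r - j ∧ t4.reg (2 * (d + 1) + 5) = j + 1) (.add (w := w) ?_ ?_ ?_) ?_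
    · omega
    · omega
    · refine ⟨((Keeps.refl d t2).trans k3 (by omega)).setReg (by omega) (by omega), ?_, ?_, ?_⟩
      · simp [e3]
      · simp [q1, e3]; omega
      · simp [q2]
    rintro t4 ⟨k4, e4, e4', e4''⟩
    have k5 : Keeps d t2 (t4.setReg (2 * (d + 1) + 5) j) := k4.setReg (by omega) (by omega)
    refine .sub (w := w) ?_ ?_ ?_
    · omega
    · omega
    rw [e4'', e4, Nat.add_sub_cancel]
    refine ⟨by omega, k5.ambient a2, by rw [k5.user, hu], ?_, ?_, by simp⟩
    · intro y hy hy'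
      rw [k5.2 _ (by omega), hk2 _ hy (by omega), m3 y hy hy']
    · simp [e4']
  · rintro t ⟨-, m1, m2, m3, -⟩
    exact ⟨m1, m2, m3⟩

/-- Compiled commands have the stated effect, with the stated cost. -/
theorem Cmd.runs {p : Params} {M w : ℕ} (hp : p.Bounded M) :
    ∀ (P : Cmd) (d : ℕ) (s : State), Ambient p M s → (p.n + 2) ^ P.weight * M < 2 ^ w →
      Runs (P.code d) s (P.steps p.n p.big * (2 * w + 1))
        fun s' => Ambient p M s' ∧ s'.user = P.eval p s.user ∧ KeepsTemps d s s' := by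
  intro P
  induction P with
  | set x a =>
    intro d s hs h
    simp only [Cmd.weight] at h
    have hM := lt_of_pow_mul_lt h
    refine Runs.mono (.seq (a.runs hp d s hs h) fun s1 ⟨k1, e1⟩ => .seq
      (capCode_runs hp (k1.ambient hs) hM e1 ((a.val_le hp hs.bounded).trans_lt h))
      fun s2 ⟨k2, e2⟩ => .add (w := w)
        (Q := fun s' => Ambient p M s' ∧ s'.user = (Cmd.set x a).eval p s.user ∧
          KeepsTemps d s s') ?_ ?_ ?_)
      (le_of_eq (by simp only [Cmd.steps]; ring)) fun _ h => h
    · rw [e2]; exact (min_le_right _ _).trans_lt (hp.cap_le.trans_lt hM)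
    · rw [(k2.ambient (k1.ambient hs)).zero_eq]; positivity
    · have k := k1.trans k2 le_rfl
      rw [e2, (k.ambient hs).zero_eq, add_zero]
      refine ⟨(k.ambient hs).setReg ((min_le_right _ _).trans hp.cap_le), ?_, ?_⟩
      · rw [State.user_setReg, k.user]; rfl
      · intro y hy hy'
        rw [State.reg_setReg, if_neg (by omega), k.2 y (by omega)]
  | put k i a =>
    intro d s hs h
    simp only [Cmd.weight] at h
    have hM := lt_of_pow_mul_lt h
    have hi := pow_mul_lt_of_le h (show i.weight ≤ _ by omega)
    have hi5 := pow_mul_lt_of_le h (show i.weight + 5 ≤ _ by omega)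
    have ha := pow_mul_lt_of_le h (show a.weight ≤ _ by omega)
    refine Runs.mono (.seq (i.runs hp d s hs hi) fun s1 ⟨k1, e1⟩ => .seq
      (arrayAddress_runs k hp (k1.ambient hs) e1 (i.val_le hp hs.bounded) hi5)
      fun s2 ⟨k2, e2⟩ => .seq
      (a.runs hp (d + 1) s2 (k2.ambient (k1.ambient hs)) ha)
      fun s3 ⟨k3, e3⟩ => .seq
      (capCode_runs hp (k3.ambient (k2.ambient (k1.ambient hs))) hM e3
        ((a.val_le hp (k2.ambient (k1.ambient hs)).bounded).trans_lt ha))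
      fun s4 ⟨k4, e4⟩ => .store (w := w)
        (Q := fun s' => Ambient p M s' ∧ s'.user = (Cmd.put k i a).eval p s.user ∧
          KeepsTemps d s s') ?_ ?_ ?_)
      (le_of_eq (by simp only [Cmd.steps]; ring)) fun _ h => h
    · have h1 := i.val_le hp hs.bounded
      have h2 := hp.cap_le
      have h3 : M ≤ (p.n + 2) ^ i.weight * M := Nat.le_mul_of_pos_left _ (by positivity)
      have h4 : 2 ^ 5 ≤ (p.n + 2) ^ 5 := Nat.pow_le_pow_left (by omega) 5
      have h5 : (p.n + 2) ^ (i.weight + 5) * M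
        = (p.n + 2) ^ 5 * ((p.n + 2) ^ i.weight * M) := by ring
      have h6 := Nat.mul_le_mul_right ((p.n + 2) ^ i.weight * M) h4
      have := hp.pos
      have := k.2
      rw [k4.2 _ (by omega), k3.2 _ (by omega), e2]
      omega
    · rw [e4]; exact (min_le_right _ _).trans_lt (hp.cap_le.trans_lt hM)
    · have k12 := k1.trans k2 le_rfl
      have k' := (k12.trans k3 (by omega)).trans k4 (by omega)
      rw [k4.2 _ (by omega), k3.2 _ (by omega), e2, e4]
      refine ⟨(k'.ambient hs).setMem ((min_le_right _ _).trans hp.cap_le), ?_, ?_⟩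
      · have : ∀ a v, (s4.setMem a v).user = s4.user.setMem a v := fun _ _ => rfl
        rw [this, k'.user, k12.user]; rfl
      · exact fun y hy hy' => k'.2 y (by omega)
  | poke i a =>
    intro d s hs h
    simp only [Cmd.weight] at h
    have hM := lt_of_pow_mul_lt h
    have hi := pow_mul_lt_of_le h (show i.weight ≤ _ by omega)
    have ha := pow_mul_lt_of_le h (show a.weight ≤ _ by omega)
    refine Runs.mono (.seq (i.runs hp d s hs hi) fun s1 ⟨k1, e1⟩ => .seq
      (a.runs hp (d + 1) s1 (k1.ambient hs) ha)
      fun s3 ⟨k3, e3⟩ => .seq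
      (capCode_runs hp (k3.ambient (k1.ambient hs)) hM e3
        ((a.val_le hp (k1.ambient hs).bounded).trans_lt ha))
      fun s4 ⟨k4, e4⟩ => .store (w := w)
        (Q := fun s' => Ambient p M s' ∧ s'.user = (Cmd.poke i a).eval p s.user ∧
          KeepsTemps d s s') ?_ ?_ ?_)
      (le_of_eq (by simp only [Cmd.steps]; ring)) fun _ h => h
    · rw [k4.2 _ (by omega), k3.2 _ (by omega), e1]
      exact (i.val_le hp hs.bounded).trans_lt hi
    · rw [e4]; exact (min_le_right _ _).trans_lt (hp.cap_le.trans_lt hM)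
    · have k' := (k1.trans k3 (by omega)).trans k4 (by omega)
      rw [k4.2 _ (by omega), k3.2 _ (by omega), e1, e4]
      refine ⟨(k'.ambient hs).setMem ((min_le_right _ _).trans hp.cap_le), ?_, ?_⟩
      · have : ∀ a v, (s4.setMem a v).user = s4.user.setMem a v := fun _ _ => rfl
        rw [this, k'.user, k1.user]; rfl
      · exact fun y hy hy' => k'.2 y (by omega)
  | seq P Q ihP ihQ =>
    intro d s hs h
    simp only [Cmd.weight] at h
    refine Runs.mono (.seq (ihP d s hs (pow_mul_lt_of_le h (by omega))) fun s1 ⟨a1, u1, k1⟩ =>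
      (ihQ d s1 a1 (pow_mul_lt_of_le h (by omega))).mono le_rfl ?_)
      (le_of_eq (by simp only [Cmd.steps]; ring)) fun _ h => h
    rintro s2 ⟨a2, u2, k2⟩
    exact ⟨a2, by rw [u2, u1]; rfl, fun y hy hy' => (k2 y hy hy').trans (k1 y hy hy')⟩
  | ite c P Q ihP ihQ =>
    intro d s hs h
    simp only [Cmd.weight] at h
    have hc := pow_mul_lt_of_le h (show c.weight ≤ _ by omega)
    refine Runs.mono (.seq (c.runs hp d s hs hc) fun s1 ⟨k1, e1⟩ => .cond (w := w) ?_
      (fun h0 => (ihP d s1 (k1.ambient hs) (pow_mul_lt_of_le h (by omega))).mono le_rfl ?_)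
      (fun h0 => (ihQ d s1 (k1.ambient hs) (pow_mul_lt_of_le h (by omega))).mono le_rfl ?_))
      (le_of_eq (by simp only [Cmd.steps]; ring)) fun _ h => h
    · rw [e1]; exact (c.val_le hp hs.bounded).trans_lt hc
    · rintro s2 ⟨a2, u2, k2⟩
      rw [e1] at h0
      exact ⟨a2, by rw [u2, k1.user, eval, if_neg h0],
        fun y hy hy' => (k2 y hy hy').trans (k1.2 y (by omega))⟩
    · rintro s2 ⟨a2, u2, k2⟩
      rw [e1] at h0
      exact ⟨a2, by rw [u2, k1.user, eval, if_pos h0],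
        fun y hy hy' => (k2 y hy hy').trans (k1.2 y (by omega))⟩
  | loop x P ih =>
    intro d s hs h
    exact loopCode_runs (Or.inl rfl) hs hs.n_eq hp.n_le (lt_of_pow_mul_lt h) hp.pos
      fun s' hs' => ih (d + 2) s' hs' h
  | longLoop x P ih =>
    intro d s hs h
    exact loopCode_runs (Or.inr rfl) hs hs.big_eq hp.big_le (lt_of_pow_mul_lt h) hp.pos
      fun s' hs' => ih (d + 2) s' hs' h

/-! ### Polynomial bounds -/

/-- The nesting depth of long loops. -/
def Cmd.longDepth : Cmd → ℕ
  | .set _ _ | .put _ _ _ | .poke _ _ => 0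
  | .seq P Q | .ite _ P Q => max P.longDepth Q.longDepth
  | .loop _ P => P.longDepth
  | .longLoop _ P => P.longDepth + 1

/-- A polynomial in `n` bounds `f`. -/
def PolyBound (f : ℕ → ℕ) : Prop := ∃ c d, ∀ n, f n ≤ c * (n + 1) ^ d

theorem polyBound_const (c : ℕ) : PolyBound fun _ => c := ⟨c, 0, fun n => by simp⟩

theorem polyBound_id : PolyBound fun n => n := ⟨1, 1, fun n => by simp⟩

theorem PolyBound.add {f g : ℕ → ℕ} (hf : PolyBound f) (hg : PolyBound g) :
    PolyBound fun n => f n + g n := by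
  obtain ⟨c, d, hf⟩ := hf
  obtain ⟨c', d', hg⟩ := hg
  refine ⟨c + c', d + d', fun n => ?_⟩
  have h1 : (n + 1) ^ d ≤ (n + 1) ^ (d + d') := Nat.pow_le_pow_right (by omega) (by omega)
  have h2 : (n + 1) ^ d' ≤ (n + 1) ^ (d + d') := Nat.pow_le_pow_right (by omega) (by omega)
  calc f n + g n ≤ c * (n + 1) ^ d + c' * (n + 1) ^ d' := add_le_add (hf n) (hg n)
    _ ≤ c * (n + 1) ^ (d + d') + c' * (n + 1) ^ (d + d') := by gcongr
    _ = _ := by ring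

theorem PolyBound.mul {f g : ℕ → ℕ} (hf : PolyBound f) (hg : PolyBound g) :
    PolyBound fun n => f n * g n := by
  obtain ⟨c, d, hf⟩ := hf
  obtain ⟨c', d', hg⟩ := hg
  refine ⟨c * c', d + d', fun n => ?_⟩
  calc f n * g n ≤ (c * (n + 1) ^ d) * (c' * (n + 1) ^ d') := Nat.mul_le_mul (hf n) (hg n)
    _ = _ := by ring

theorem Expr.polyBound_steps (E : Expr) : PolyBound fun n => E.steps n := by
  induction E with
  | const | var | size | big | cap => exact polyBound_const 1
  | add a b iha ihb | sub a b iha ihb => exact (iha.add ihb).add (polyBound_const 1)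
  | ite c a b ihc iha ihb => exact ((ihc.add iha).add ihb).add (polyBound_const 1)
  | mem a iha => exact iha.add (polyBound_const 1)
  | arr k a iha => exact iha.add (polyBound_const 8)
  | sum x a iha => exact (polyBound_id.mul (iha.add (polyBound_const 5))).add (polyBound_const 6)

/-- Ordinary loops contribute a factor n to the polynomial, and only nested long loops raise the
power of `big`. Sequences and branches take the maximum of the depths, which is harmless as `big` is
at least 1. -/
theorem Cmd.steps_le (P : Cmd) : ∃ f : ℕ → ℕ, PolyBound f ∧
    ∀ n big, 1 ≤ big → P.steps n big ≤ f n * big ^ P.longDepth := by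
  have mono : ∀ {a i j big : ℕ}, 1 ≤ big → i ≤ j → a * big ^ i ≤ a * big ^ j := fun h1 h =>
    Nat.mul_le_mul_left _ (Nat.pow_le_pow_right h1 h)
  induction P with
  | set x a =>
    exact ⟨_, a.polyBound_steps.add (polyBound_const 3), fun n big _ => by simp [steps, longDepth]⟩
  | put k i a =>
    exact ⟨_, (i.polyBound_steps.add a.polyBound_steps).add (polyBound_const 10),
      fun n big _ => by simp [steps, longDepth]⟩
  | poke i a =>
    exact ⟨_, (i.polyBound_steps.add a.polyBound_steps).add (polyBound_const 3),
      fun n big _ => by simp [steps, longDepth]⟩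
  | seq P Q ihP ihQ =>
    obtain ⟨f, hf, hP⟩ := ihP
    obtain ⟨g, hg, hQ⟩ := ihQ
    refine ⟨_, hf.add hg, fun n big h1 => ?_⟩
    simp only [steps, longDepth]
    have h2 := (hP n big h1).trans (mono h1 (le_max_left P.longDepth Q.longDepth))
    have h3 := (hQ n big h1).trans (mono h1 (le_max_right P.longDepth Q.longDepth))
    rw [add_mul]
    exact add_le_add h2 h3
  | ite c P Q ihP ihQ =>
    obtain ⟨f, hf, hP⟩ := ihP
    obtain ⟨g, hg, hQ⟩ := ihQ
    refine ⟨_, (c.polyBound_steps.add (polyBound_const 1)).add (hf.add hg), fun n big h1 => ?_⟩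
    simp only [steps, longDepth]
    have h2 := (hP n big h1).trans (mono h1 (le_max_left P.longDepth Q.longDepth))
    have h3 := (hQ n big h1).trans (mono h1 (le_max_right P.longDepth Q.longDepth))
    have h4 : c.steps n + 1 ≤ (c.steps n + 1) * big ^ max P.longDepth Q.longDepth :=
      Nat.le_mul_of_pos_right _ (Nat.pow_pos h1)
    rw [add_mul, add_mul (f n)]
    omega
  | loop x P ih =>
    obtain ⟨f, hf, hP⟩ := ih
    refine ⟨_, (polyBound_id.mul (hf.add (polyBound_const 5))).add (polyBound_const 3),
      fun n big h1 => ?_⟩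
    simp only [steps, longDepth]
    have h2 := hP n big h1
    have h3 : 1 ≤ big ^ P.longDepth := Nat.pow_pos h1
    calc n * (steps n big P + 5) + 3
        ≤ n * (f n * big ^ P.longDepth + 5 * big ^ P.longDepth) + 3 * big ^ P.longDepth := by
          gcongr <;> omega
      _ = _ := by ring
  | longLoop x P ih =>
    obtain ⟨f, hf, hP⟩ := ih
    refine ⟨_, (hf.add (polyBound_const 5)).add (polyBound_const 3), fun n big h1 => ?_⟩
    simp only [steps, longDepth]
    have h2 := hP n big h1
    have h3 : 1 ≤ big ^ P.longDepth := Nat.pow_pos h1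
    have h4 : 1 ≤ big ^ (P.longDepth + 1) := Nat.pow_pos h1
    calc big * (steps n big P + 5) + 3
        ≤ big * (f n * big ^ P.longDepth + 5 * big ^ P.longDepth) + 3 * big ^ (P.longDepth + 1) := by
          gcongr <;> omega
      _ = _ := by ring

end RAM
namespace RAM

/-! ### Reasoning about commands -/

@[simp] theorem State.arr_setReg (p : Params) (s : State) (x v : ℕ) (k : Fin 16) (i : ℕ) :
    (s.setReg x v).arr p k i = s.arr p k i := rfl

@[simp] theorem State.reg_setArr (p : Params) (s : State) (k : Fin 16) (i v : ℕ) :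
    (s.setArr p k i v).reg = s.reg := rfl

-- The sixteen arrays are interleaved above the cap: k is the address offset modulo 16, so different
-- pairs (k, i) never collide and no array needs a length.
@[simp] theorem State.arr_setArr (p : Params) (s : State) (k l : Fin 16) (i v j : ℕ) :
    (s.setArr p k i v).arr p l j = if l = k ∧ j = i then v else s.arr p l j := by
  simp only [State.arr, State.setArr, State.mem_setMem, Fin.ext_iff]
  have := k.2
  have := l.2
  congr 1
  simp only [eq_iff_iff]
  omega

theorem State.mem_setArr (p : Params) (s : State) (k : Fin 16) (i v a : ℕ) (ha : a < p.cap) :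
    (s.setArr p k i v).mem a = s.mem a := by
  simp only [State.setArr, State.mem_setMem]
  rw [if_neg (by omega)]

/-! ### What commands leave unchanged, and induction along loops -/

/-- The variables that a command may change. -/
def Cmd.vars : Cmd → List ℕ
  | .set x _ => [x]
  | .put _ _ _ | .poke _ _ => []
  | .seq P Q | .ite _ P Q => P.vars ++ Q.vars
  | .loop x P | .longLoop x P => x :: P.vars

/-- The arrays that a command may change. -/
def Cmd.arrays : Cmd → List (Fin 16)
  | .set _ _ | .poke _ _ => []
  | .put k _ _ => [k]
  | .seq P Q | .ite _ P Q => P.arrays ++ Q.arrays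
  | .loop _ P | .longLoop _ P => P.arrays

/-- The command stores to arrays only. -/
def Cmd.pure : Cmd → Bool
  | .set _ _ | .put _ _ _ => true
  | .poke _ _ => false
  | .seq P Q | .ite _ P Q => P.pure && Q.pure
  | .loop _ P | .longLoop _ P => P.pure

/-- `s` and `t` agree up to changes of the variables `X` and the arrays `K`. -/
structure Frame (p : Params) (X : List ℕ) (K : List (Fin 16)) (s t : State) : Prop where
  reg : ∀ x, x ∉ X → t.reg x = s.reg x
  arr : ∀ k, k ∉ K → t.arr p k = s.arr p k
  mem : ∀ a, a < p.cap → t.mem a = s.mem a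
  bounded : s.Bounded p.cap → t.Bounded p.cap

theorem Frame.refl (p : Params) (X : List ℕ) (K : List (Fin 16)) (s : State) : Frame p X K s s :=
  ⟨fun _ _ => rfl, fun _ _ => rfl, fun _ _ => rfl, id⟩

theorem Frame.trans {p : Params} {X X' : List ℕ} {K K' : List (Fin 16)} {s t u : State}
    (h : Frame p X K s t) (h' : Frame p X' K' t u) (hX : X' ⊆ X) (hK : K' ⊆ K) :
    Frame p X K s u where
  reg x hx := (h'.reg x fun h => hx (hX h)).trans (h.reg x hx)
  arr k hk := (h'.arr k fun h => hk (hK h)).trans (h.arr k hk)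
  mem a ha := (h'.mem a ha).trans (h.mem a ha)
  bounded hs := h'.bounded (h.bounded hs)

theorem Frame.mono {p : Params} {X X' : List ℕ} {K K' : List (Fin 16)} {s t : State}
    (h : Frame p X K s t) (hX : X ⊆ X') (hK : K ⊆ K') : Frame p X' K' s t :=
  (Frame.refl p X' K' s).trans h hX hK

theorem Frame.setReg {p : Params} {X : List ℕ} {K : List (Fin 16)} {s : State} {x v : ℕ}
    (hx : x ∈ X) (hv : v ≤ p.cap) : Frame p X K s (s.setReg x v) where
  reg y hy := by rw [State.reg_setReg, if_neg]; rintro rfl; exact hy hx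
  arr _ _ := rfl
  mem _ _ := rfl
  bounded hs := hs.setReg hv

theorem iter_frame {p : Params} {X : List ℕ} {K : List (Fin 16)} {f : State → State} {x k : ℕ}
    (hx : x ∈ X) (hk : k ≤ p.cap) (hf : ∀ s, Frame p X K s (f s)) (s : State) :
    Frame p X K s (iter f x k s) := by
  induction k with
  | zero => exact .refl ..
  | succ k ih =>
    exact ((ih (by omega)).trans (.setReg hx (by omega)) (List.Subset.refl _)
      (List.Subset.refl _)).trans (hf _) (List.Subset.refl _) (List.Subset.refl _)

/-- The parameters do not exceed the cap. -/
structure Params.Sound (p : Params) : Prop where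
  n_le : p.n ≤ p.cap
  big_le : p.big ≤ p.cap

/-- The lists are read off the syntax, so for a concrete program independence of a variable or array
is settled by `decide`. Soundness of the parameters keeps the loop variables below the cap. -/
theorem Cmd.frame {p : Params} (hp : p.Sound) : ∀ (P : Cmd), P.pure = true → ∀ s,
    Frame p P.vars P.arrays s (P.eval p s) := by
  intro P
  induction P with
  | set x a => intro _ s; exact .setReg (by simp [vars]) (min_le_right _ _)
  | put k i a =>
    intro _ s
    refine ⟨fun _ _ => rfl, fun l hl => ?_, fun a ha => State.mem_setArr _ _ _ _ _ _ ha,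
      fun hs => hs.setMem (min_le_right _ _)⟩
    funext j
    simp only [arrays, List.mem_singleton] at hl
    simp [eval, hl]
  | poke i a => intro h; simp [Cmd.pure] at h
  | seq P Q ihP ihQ =>
    intro h s
    simp only [Cmd.pure, Bool.and_eq_true] at h
    exact ((ihP h.1 s).mono (List.subset_append_left _ _) (List.subset_append_left _ _)).trans
      (ihQ h.2 _) (List.subset_append_right _ _) (List.subset_append_right _ _)
  | ite c P Q ihP ihQ =>
    intro h s
    simp only [Cmd.pure, Bool.and_eq_true] at h
    simp only [eval]
    split_ifs
    · exact (ihQ h.2 s).mono (List.subset_append_right _ _) (List.subset_append_right _ _)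
    · exact (ihP h.1 s).mono (List.subset_append_left _ _) (List.subset_append_left _ _)
  | loop x P ih =>
    intro h s
    exact iter_frame (by simp) hp.n_le
      (fun s => (ih h s).mono (List.subset_cons_self _ _) (List.Subset.refl _)) s
  | longLoop x P ih =>
    intro h s
    exact iter_frame (by simp) hp.big_le
      (fun s => (ih h s).mono (List.subset_cons_self _ _) (List.Subset.refl _)) s

theorem iter_induct {f : State → State} {x k : ℕ} {s : State} (I : ℕ → State → Prop)
    (h0 : I 0 s) (hs : ∀ i < k, ∀ t, I i t → I (i + 1) (f (t.setReg x i))) :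
    I k (iter f x k s) := by
  induction k with
  | zero => exact h0
  | succ k ih =>
    exact hs k k.lt_succ_self _ (ih fun i hi => hs i (by omega))

/-- Induction along a loop. The states at the start of the iterations agree with the initial state
up to the variables and arrays that the loop may change. -/
theorem Cmd.loop_induct {p : Params} (hp : p.Sound) {x : ℕ} {P : Cmd} {s : State}
    (I : ℕ → State → Prop) (hP : P.pure = true) (h0 : I 0 s)
    (hs : ∀ i < p.n, ∀ t, Frame p (x :: P.vars) P.arrays s (t.setReg x i) → I i t →
      I (i + 1) (P.eval p (t.setReg x i))) : I p.n ((Cmd.loop x P).eval p s) := by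
  refine (iter_induct (fun i t => Frame p (x :: P.vars) P.arrays s t ∧ I i t) ⟨.refl .., h0⟩
    fun i hi t ht => ?_).2
  have h1 := hp.n_le
  have h2 := ht.1.trans (.setReg (x := x) (v := i) (by simp) (by omega)) (List.Subset.refl _)
    (List.Subset.refl P.arrays)
  exact ⟨h2.trans (P.frame hp hP _) (List.subset_cons_self _ _) (List.Subset.refl _),
    hs i hi t h2 ht.2⟩

theorem Cmd.longLoop_induct {p : Params} (hp : p.Sound) {x : ℕ} {P : Cmd} {s : State}
    (I : ℕ → State → Prop) (hP : P.pure = true) (h0 : I 0 s)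
    (hs : ∀ i < p.big, ∀ t, Frame p (x :: P.vars) P.arrays s (t.setReg x i) → I i t →
      I (i + 1) (P.eval p (t.setReg x i))) : I p.big ((Cmd.longLoop x P).eval p s) := by
  refine (iter_induct (fun i t => Frame p (x :: P.vars) P.arrays s t ∧ I i t) ⟨.refl .., h0⟩
    fun i hi t ht => ?_).2
  have h1 := hp.big_le
  have h2 := ht.1.trans (.setReg (x := x) (v := i) (by simp) (by omega)) (List.Subset.refl _)
    (List.Subset.refl P.arrays)
  exact ⟨h2.trans (P.frame hp hP _) (List.subset_cons_self _ _) (List.Subset.refl _),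
    hs i hi t h2 ht.2⟩

/-- A command repeated `n ^ k` times. -/
def Cmd.nest (x : ℕ) (P : Cmd) : ℕ → Cmd
  | 0 => P
  | k + 1 => .loop x (Cmd.nest x P k)

/-- All levels share the loop variable x, which is possible because every level resets it. So I only
has to survive assignments to x, and its index counts the runs of P. -/
theorem Cmd.nest_induct {p : Params} {x : ℕ} {P : Cmd} (I : ℕ → State → Prop)
    (hx : ∀ i < p.n, ∀ j t, I j t → I j (t.setReg x i))
    (hs : ∀ j t, I j t → I (j + 1) (P.eval p t)) (k : ℕ) :
    ∀ (j : ℕ) (s : State), I j s → I (j + p.n ^ k) ((Cmd.nest x P k).eval p s) := by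
  induction k with
  | zero => intro j s h; exact hs j s h
  | succ k ih =>
    intro j s h
    have := iter_induct (f := (Cmd.nest x P k).eval p) (x := x) (k := p.n)
      (fun i t => I (j + i * p.n ^ k) t) (by simpa using h) fun i hi t ht => by
        have := ih _ _ (hx i hi _ _ ht)
        rwa [add_assoc, ← Nat.succ_mul] at this
    rwa [← pow_succ'] at this

/-! ### Notation for expressions -/

instance : Add Expr := ⟨.add⟩
instance : Sub Expr := ⟨.sub⟩
instance (c : ℕ) : OfNat Expr c := ⟨.const c⟩

namespace Expr

/-- Nonzero if `a < b`. -/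
def lt (a b : Expr) : Expr := b - a
/-- Nonzero if `a` is zero. -/
def not (a : Expr) : Expr := 1 - a
/-- Nonzero if `a = b`. -/
def eq (a b : Expr) : Expr := 1 - ((a - b) + (b - a))
/-- Nonzero if `a` and `b` are nonzero. -/
def and (a b : Expr) : Expr := .ite a b 0
/-- The minimum. -/
def min (a b : Expr) : Expr := a - (a - b)
/-- The maximum. -/
def max (a b : Expr) : Expr := a + (b - a)

variable (p : Params) (s : State)

@[simp] theorem val_const (c : ℕ) : (const c).val p s = c := rfl
@[simp] theorem val_zero : (0 : Expr).val p s = 0 := rfl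
@[simp] theorem val_one : (1 : Expr).val p s = 1 := rfl
@[simp] theorem val_two : (2 : Expr).val p s = 2 := rfl
@[simp] theorem val_var (x : ℕ) : (var x).val p s = s.reg x := rfl
@[simp] theorem val_size : size.val p s = p.n := rfl
@[simp] theorem val_big : big.val p s = p.big := rfl
@[simp] theorem val_cap : cap.val p s = p.cap := rfl
@[simp] theorem val_add (a b : Expr) : (a + b).val p s = a.val p s + b.val p s := rfl
@[simp] theorem val_sub (a b : Expr) : (a - b).val p s = a.val p s - b.val p s := rfl
@[simp] theorem val_ite (c a b : Expr) :
    (ite c a b).val p s = if c.val p s = 0 then b.val p s else a.val p s := rfl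
@[simp] theorem val_mem (a : Expr) : (mem a).val p s = s.mem (a.val p s) := rfl
@[simp] theorem val_arr (k : Fin 16) (a : Expr) : (arr k a).val p s = s.arr p k (a.val p s) := rfl
@[simp] theorem val_sum (x : ℕ) (a : Expr) :
    (sum x a).val p s = ∑ i ∈ range p.n, a.val p (s.setReg x i) := rfl

@[simp] theorem val_lt_eq_zero (a b : Expr) :
    (lt a b).val p s = 0 ↔ b.val p s ≤ a.val p s := by
  simp [lt, Nat.sub_eq_zero_iff_le]
@[simp] theorem val_not_eq_zero (a : Expr) : (not a).val p s = 0 ↔ a.val p s ≠ 0 := by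
  simp [not]; omega
@[simp] theorem val_eq_eq_zero (a b : Expr) :
    (eq a b).val p s = 0 ↔ a.val p s ≠ b.val p s := by
  simp [eq]; omega
@[simp] theorem val_and_eq_zero (a b : Expr) :
    (and a b).val p s = 0 ↔ a.val p s = 0 ∨ b.val p s = 0 := by
  simp only [and, val_ite, val_zero]
  split_ifs with h <;> simp [h]
@[simp] theorem val_min (a b : Expr) :
    (min a b).val p s = Min.min (a.val p s) (b.val p s) := by
  simp [min]; omega
@[simp] theorem val_max (a b : Expr) :
    (max a b).val p s = Max.max (a.val p s) (b.val p s) := by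
  simp [max]; omega

end Expr

namespace Cmd

variable (p : Params) (s : State)

@[simp] theorem eval_set (x : ℕ) (a : Expr) :
    (set x a).eval p s = s.setReg x (min (a.val p s) p.cap) := rfl
@[simp] theorem eval_put (k : Fin 16) (i a : Expr) :
    (put k i a).eval p s = s.setArr p k (i.val p s) (min (a.val p s) p.cap) := rfl
@[simp] theorem eval_poke (i a : Expr) :
    (poke i a).eval p s = s.setMem (i.val p s) (min (a.val p s) p.cap) := rfl
@[simp] theorem eval_seq (P Q : Cmd) : (seq P Q).eval p s = Q.eval p (P.eval p s) := rfl
@[simp] theorem eval_ite (c : Expr) (P Q : Cmd) :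
    (ite c P Q).eval p s = if c.val p s = 0 then Q.eval p s else P.eval p s := rfl

end Cmd

end RAM

/-! ### Cuts of vertex sets -/

section Cuts

variable {n : ℕ}

/-- The weight of the pairs that enter the vertex set `S`. -/
def setCut (w : Fin n → Fin n → ℕ) (S : Finset (Fin n)) : ℕ := ∑ v ∈ S, ∑ u ∈ Sᶜ, w u v

theorem setCut_eq_sum_ite (w : Fin n → Fin n → ℕ) (S : Finset (Fin n)) :
    setCut w S = ∑ u, ∑ v, if u ∉ S ∧ v ∈ S then w u v else 0 := by
  rw [setCut, sum_comm, ← sum_filter_add_sum_filter_not univ (fun u => u ∉ S)]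
  have h : (univ.filter fun u => u ∉ S) = Sᶜ := by ext; simp
  rw [h, sum_eq_zero (s := univ.filter fun u => ¬ u ∉ S), add_zero]
  · refine sum_congr rfl fun u hu => ?_
    rw [← sum_filter]
    refine sum_congr ?_ fun _ _ => rfl
    ext v
    simp [mem_compl.1 hu]
  · intro u hu
    exact sum_eq_zero fun v _ => if_neg fun h => (mem_filter.1 hu).2 h.1

/-- A union bound, pair by pair. It yields the factor 2 of the approximation through the
intersection and union bounds below. -/
theorem setCut_le_add (w : Fin n → Fin n → ℕ) {S P Q : Finset (Fin n)}
    (h : ∀ u v, u ∉ Q → v ∈ Q → (u ∉ S ∧ v ∈ S) ∨ (u ∉ P ∧ v ∈ P)) :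
    setCut w Q ≤ setCut w S + setCut w P := by
  simp only [setCut_eq_sum_ite, ← sum_add_distrib]
  refine sum_le_sum fun u _ => sum_le_sum fun v _ => ?_
  by_cases hq : u ∉ Q ∧ v ∈ Q
  · rcases h u v hq.1 hq.2 with h | h
    · simp only [if_pos hq, if_pos h]; omega
    · simp only [if_pos hq, if_pos h]; omega
  · rw [if_neg hq]; exact Nat.zero_le _

theorem setCut_inter_le (w : Fin n → Fin n → ℕ) (S P : Finset (Fin n)) :
    setCut w (S ∩ P) ≤ setCut w S + setCut w P :=
  setCut_le_add w fun u v hu hv => by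
    simp only [mem_inter] at hu hv
    tauto

theorem setCut_union_le (w : Fin n → Fin n → ℕ) (S P : Finset (Fin n)) :
    setCut w (S ∪ P) ≤ setCut w S + setCut w P :=
  setCut_le_add w fun u v hu hv => by
    simp only [mem_union] at hu hv
    tauto

theorem setCut_le_total (w : Fin n → Fin n → ℕ) (S : Finset (Fin n)) :
    setCut w S ≤ ∑ u, ∑ v, w u v := by
  rw [setCut_eq_sum_ite]
  exact sum_le_sum fun u _ => sum_le_sum fun v _ => by split_ifs <;> omega

/-- The vertices before position `i`. -/
def prefixSet (π : VertexOrdering n) (i : ℕ) : Finset (Fin n) := univ.filter fun v => (π v : ℕ) < i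

@[simp] theorem mem_prefixSet {π : VertexOrdering n} {i : ℕ} {v : Fin n} :
    v ∈ prefixSet π i ↔ (π v : ℕ) < i := by simp [prefixSet]

namespace WeightedDigraph

variable (G : WeightedDigraph n)

/-- The weight of a pair of vertices, zero if it is not an arc. -/
noncomputable def arcWeight (u v : Fin n) : ℕ := RAM.arcCode G u v - 1

theorem cutWeight_eq (π : VertexOrdering n) (i : ℕ) :
    G.cutWeight π i = setCut G.arcWeight (prefixSet π i) := by
  classical
  rw [cutWeight, cut, arcs, filter_filter, sum_filter, Fintype.sum_prod_type, setCut_eq_sum_ite]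
  refine sum_congr rfl fun u _ => sum_congr rfl fun v _ => ?_
  simp only [mem_prefixSet, not_lt, arcWeight, RAM.arcCode]
  by_cases h : G.Adj u v <;> simp [h]

/-- Outside the range 1, …, n - 1 the prefix is empty or everything and has cut 0, so no condition
on i is needed. -/
theorem setCut_prefixSet_le (π : VertexOrdering n) (i : ℕ) :
    setCut G.arcWeight (prefixSet π i) ≤ G.orderingWidth π := by
  by_cases h : i ∈ Ico 1 n
  · rw [← cutWeight_eq]
    exact le_sup (f := fun i => G.cutWeight π i) h
  · rw [mem_Ico] at h
    have h0 : setCut G.arcWeight (prefixSet π i) = 0 := by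
      rcases Nat.eq_zero_or_pos i with rfl | hi
      · simp [setCut, prefixSet]
      · have : prefixSet π i = univ := by
          ext v
          have := (π v).2
          simp only [mem_prefixSet, mem_univ, iff_true]
          omega
        simp [setCut, this]
    rw [h0]
    exact Nat.zero_le _

theorem orderingWidth_le {π : VertexOrdering n} {W : ℕ}
    (h : ∀ i, 1 ≤ i → i < n → setCut G.arcWeight (prefixSet π i) ≤ W) : G.orderingWidth π ≤ W :=
  Finset.sup_le fun i hi => by
    rw [mem_Ico] at hi
    rw [cutWeight_eq]
    exact h i hi.1 hi.2

theorem exists_orderingWidth_eq_cutwidth : ∃ π, G.orderingWidth π = G.cutwidth :=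
  Nat.sInf_mem (Set.range_nonempty fun π => G.orderingWidth π)

/-- Some set with at most the cutwidth as its cut splits a given vertex set in given
proportion. -/
theorem exists_setCut_le_cutwidth (V : Finset (Fin n)) {m : ℕ} (hm : m ≤ V.card) :
    ∃ S, setCut G.arcWeight S ≤ G.cutwidth ∧ (S ∩ V).card = m := by
  obtain ⟨π, hπ⟩ := G.exists_orderingWidth_eq_cutwidth
  -- A discrete intermediate value argument: the number of vertices of V in a prefix grows by at
  -- most one per position.
  have key : ∀ k, k ≤ n → m ≤ (prefixSet π k ∩ V).card →
      ∃ i, (prefixSet π i ∩ V).card = m := by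
    intro k
    induction k with
    | zero =>
      intro _ h
      refine ⟨0, le_antisymm ?_ h⟩
      have : prefixSet π 0 = ∅ := by ext; simp
      simp [this]
    | succ k ih =>
      intro hk h
      by_cases h' : m ≤ (prefixSet π k ∩ V).card
      · exact ih (by omega) h'
      · refine ⟨k + 1, le_antisymm ?_ h⟩
        have hsub : prefixSet π (k + 1) ∩ V ⊆ insert (π.symm ⟨k, hk⟩) (prefixSet π k ∩ V) := by
          intro v hv
          simp only [mem_inter, mem_prefixSet, mem_insert] at hv ⊢
          rcases Nat.lt_succ_iff_lt_or_eq.1 hv.1 with h1 | h1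
          · exact Or.inr ⟨h1, hv.2⟩
          · left
            rw [Equiv.eq_symm_apply]
            exact Fin.ext h1
        have := (card_le_card hsub).trans (card_insert_le _ _)
        omega
  obtain ⟨i, hi⟩ := key n le_rfl (by
    have : prefixSet π n = univ := by ext v; simp
    simpa [this] using hm)
  exact ⟨_, hπ ▸ G.setCut_prefixSet_le π i, hi⟩

end WeightedDigraph

end Cuts

/-! ### Minimum cuts by pushing and relabelling -/

/-- Residual capacities, excesses and labels. -/
@[ext] structure Preflow (n : ℕ) where
  r : Fin n → Fin n → ℕ
  e : Fin n → ℕ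
  d : Fin n → ℕ

namespace Preflow

variable {n : ℕ}

/-- The admissible amount that can be pushed from `u` to `v`. -/
def amount (s : Preflow n) (u v : Fin n) : ℕ :=
  if s.d u = s.d v + 1 ∧ s.d u < n + 1 then min (s.e u) (s.r u v) else 0

/-- Pushes as much as possible from `u` to `v`. -/
def push (s : Preflow n) (u v : Fin n) : Preflow n where
  r a b := if a = v ∧ b = u then s.r a b + s.amount u v
    else if a = u ∧ b = v then s.r a b - s.amount u v else s.r a b
  e a := if a = v then s.e a + s.amount u v else if a = u then s.e a - s.amount u v else s.e a
  d := s.d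

/-- Increases the label of `u`. -/
def relabel (s : Preflow n) (u : Fin n) : Preflow n where
  r := s.r
  e := s.e
  d a := if a = u then s.d a + 1 else s.d a

/-- A valid preflow for the capacities `w`, the sources `A` and the sinks `B`. -/
structure Valid (w : Fin n → Fin n → ℕ) (A B : Finset (Fin n)) (s : Preflow n) : Prop where
  symm : ∀ u v, s.r u v + s.r v u = w u v + w v u
  cons : ∀ v, v ∉ A → s.e v + ∑ u, s.r u v = ∑ u, w u v
  label : ∀ u v, 0 < s.r u v → s.d u ≤ s.d v + 1
  le : ∀ u, s.d u ≤ n + 1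
  source : ∀ u ∈ A, s.d u = n + 1
  sink : ∀ u ∈ B, s.d u = 0

/-- A vertex with excess that has to be relabelled or relieved. -/
def Active (B : Finset (Fin n)) (s : Preflow n) (u : Fin n) : Prop :=
  u ∉ B ∧ 0 < s.e u ∧ s.d u < n + 1

/-- The residual arcs that admit a push. -/
def admissible (s : Preflow n) : Finset (Fin n × Fin n) :=
  univ.filter fun a => 0 < s.r a.1 a.2 ∧ s.d a.1 = s.d a.2 + 1

theorem mem_admissible {s : Preflow n} {a b : Fin n} :
    (a, b) ∈ s.admissible ↔ 0 < s.r a b ∧ s.d a = s.d b + 1 := by simp [admissible]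

/-- A potential that decreases with every push and every relabelling. -/
def potential (s : Preflow n) : ℕ :=
  ((n + 2) * n + 2) * ∑ u, (n + 1 - s.d u) +
    (n + 2) * s.admissible.card +
    ∑ u, if 0 < s.e u ∧ s.d u < n + 1 then s.d u else 0

theorem potential_le (s : Preflow n) : s.potential ≤ 5 * (n + 2) ^ 4 := by
  have h1 : ∑ u, (n + 1 - s.d u) ≤ n * (n + 1) := by
    calc _ ≤ ∑ _u : Fin n, (n + 1) := sum_le_sum fun u _ => Nat.sub_le _ _
      _ = _ := by simp
  have h2 : s.admissible.card ≤ n * n := by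
    calc _ ≤ (univ : Finset (Fin n × Fin n)).card := card_le_card (filter_subset _ _)
      _ = _ := by simp
  have h3 : (∑ u, if 0 < s.e u ∧ s.d u < n + 1 then s.d u else 0) ≤ n * (n + 1) := by
    calc _ ≤ ∑ _u : Fin n, (n + 1) := sum_le_sum fun u _ => by split_ifs <;> omega
      _ = _ := by simp
  calc s.potential ≤ ((n + 2) * n + 2) * (n * (n + 1)) + (n + 2) * (n * n) + n * (n + 1) := by
        unfold potential; gcongr
    _ ≤ _ := by nlinarith [sq_nonneg n, sq_nonneg (n * n)]

theorem push_eq_self {s : Preflow n} {u v : Fin n} (h : s.amount u v = 0) : s.push u v = s := by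
  ext a b
  · simp only [push, h]; split_ifs <;> omega
  · simp only [push, h]; split_ifs <;> omega
  · rfl

variable {w : Fin n → Fin n → ℕ} {A B : Finset (Fin n)} {s s₀ : Preflow n}

theorem amount_pos {u v : Fin n} (h : s.amount u v ≠ 0) :
    s.d u = s.d v + 1 ∧ s.d u < n + 1 ∧ 0 < s.amount u v ∧ s.amount u v ≤ s.e u ∧
      s.amount u v ≤ s.r u v ∧ (s.amount u v = s.e u ∨ s.amount u v = s.r u v) := by
  unfold amount at h ⊢
  split_ifs at h ⊢ with h1
  · omega
  · exact absurd rfl h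

/-- Only the inflow capacities of u and v change. Each correction is added to the side where it is
positive, to avoid subtraction in ℕ. -/
theorem sum_push_r {u v : Fin n} (h : s.amount u v ≤ s.r u v) (huv : u ≠ v) (b : Fin n) :
    ∑ a, (s.push u v).r a b + (if b = v then s.amount u v else 0) =
      ∑ a, s.r a b + (if b = u then s.amount u v else 0) := by
  have h1 : ∀ a, (s.push u v).r a b + (if a = u ∧ b = v then s.amount u v else 0) =
      s.r a b + (if a = v ∧ b = u then s.amount u v else 0) := by
    intro a
    simp only [push]
    by_cases h1 : a = v ∧ b = u
    · simp [h1, huv.symm]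
    · simp only [h1, if_false]
      split_ifs with h2
      · obtain ⟨rfl, rfl⟩ := h2; omega
      · omega
  have h2 := sum_congr (s₁ := univ) rfl fun a _ => h1 a
  rw [sum_add_distrib, sum_add_distrib] at h2
  have e : ∀ x y : Fin n, (∑ a, if a = x ∧ b = y then s.amount u v else 0) =
      if b = y then s.amount u v else 0 := by
    intro x y
    by_cases hb : b = y <;> simp [hb]
  rwa [e, e] at h2

/-- The only residual arc that a push can create is the reverse one, which goes up by one label and
so respects the label condition. -/
theorem Valid.push (hs : s.Valid w A B) (u v : Fin n) : (s.push u v).Valid w A B := by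
  by_cases h : s.amount u v = 0
  · rwa [push_eq_self h]
  obtain ⟨h1, h2, h3, h4, h5, -⟩ := amount_pos h
  have huv : u ≠ v := by rintro rfl; omega
  refine ⟨fun a b => ?_, fun b hb => ?_, fun a b hab => ?_, hs.le, hs.source, hs.sink⟩
  · have := hs.symm a b
    simp only [Preflow.push]
    by_cases c1 : a = v ∧ b = u
    · obtain ⟨rfl, rfl⟩ := c1
      simp [huv]; omega
    · by_cases c2 : a = u ∧ b = v
      · obtain ⟨rfl, rfl⟩ := c2
        simp [huv]; omega
      · simp only [c1, c2, if_false, and_comm (a := b = v), and_comm (a := b = u)]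
        exact this
  · have e1 := hs.cons b hb
    have e2 := sum_push_r h5 huv b
    have e3 : (s.push u v).e b = if b = v then s.e b + s.amount u v
      else if b = u then s.e b - s.amount u v else s.e b := rfl
    rw [e3]
    by_cases c1 : b = v
    · simp only [c1, huv.symm, if_true, if_false] at e1 e2 ⊢
      omega
    · by_cases c2 : b = u
      · simp only [c2, huv, if_true, if_false] at e1 e2 ⊢
        omega
      · simp only [c1, c2, if_false] at e1 e2 ⊢
        omega
  · change s.d a ≤ s.d b + 1
    by_cases c1 : a = v ∧ b = u
    · rw [c1.1, c1.2]; omega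
    · refine hs.label a b ?_
      simp only [Preflow.push, c1, if_false] at hab
      split_ifs at hab <;> omega

/-- A push creates no admissible arc, as the reverse arc goes upward. If it exhausts the excess of
u, then in the last sum the term d u disappears and at most d v = d u - 1 appears. Otherwise it
saturates the arc, and the loss of n + 2 in the middle term outweighs the at most d v ≤ n that v can
add. -/
theorem potential_push_lt {u v : Fin n} (h : s.amount u v ≠ 0) :
    (s.push u v).potential < s.potential := by
  obtain ⟨h1, h2, h3, h4, h5, h6⟩ := amount_pos h
  have huv : u ≠ v := by rintro rfl; omega
  have hsub : (s.push u v).admissible ⊆ s.admissible := by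
    rintro ⟨a, b⟩ hab
    rw [mem_admissible] at hab ⊢
    simp only [Preflow.push] at hab
    refine ⟨?_, hab.2⟩
    by_cases c1 : a = v ∧ b = u
    · rw [c1.1, c1.2] at hab; omega
    · simp only [c1, if_false] at hab
      split_ifs at hab <;> omega
  have huvF : (u, v) ∈ s.admissible := mem_admissible.2 (by omega)
  have hact : ∀ a, (if 0 < (s.push u v).e a ∧ (s.push u v).d a < n + 1
      then (s.push u v).d a else 0) + (if a = u ∧ s.amount u v = s.e u then s.d u else 0) ≤
      (if 0 < s.e a ∧ s.d a < n + 1 then s.d a else 0) + (if a = v then s.d v else 0) := by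
    intro a
    have hd : (s.push u v).d a = s.d a := rfl
    have he : (s.push u v).e a = if a = v then s.e a + s.amount u v
      else if a = u then s.e a - s.amount u v else s.e a := rfl
    rw [hd, he]
    by_cases c1 : a = v
    · have c2 : a ≠ u := fun h => huv (h.symm.trans c1)
      subst c1
      simp only [c2, false_and, if_true, if_false]
      split_ifs <;> omega
    · by_cases c2 : a = u
      · subst c2
        simp only [c1, true_and, if_true, if_false]
        split_ifs <;> omega
      · simp only [c1, c2, false_and, if_false]
        omega
  have hsum := sum_le_sum fun a (_ : a ∈ univ) => hact a
  rw [sum_add_distrib, sum_add_distrib, sum_ite_eq' univ v] at hsum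
  simp only [mem_univ, if_true] at hsum
  have hu : (∑ a, if a = u ∧ s.amount u v = s.e u then s.d u else 0) =
      if s.amount u v = s.e u then s.d u else 0 := by
    by_cases hb : s.amount u v = s.e u <;> simp [hb]
  rw [hu] at hsum
  unfold potential
  have hdd : ∑ a, (n + 1 - (s.push u v).d a) = ∑ a, (n + 1 - s.d a) := rfl
  rw [hdd]
  rcases h6 with h6 | h6
  · have := Nat.mul_le_mul_left (n + 2) (card_le_card hsub)
    rw [if_pos h6] at hsum
    omega
  · have hlt : (s.push u v).admissible.card < s.admissible.card := by
      refine card_lt_card (Finset.ssubset_iff_subset_ne.2 ⟨hsub, fun h => ?_⟩)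
      rw [← h, mem_admissible] at huvF
      have := huvF.1
      simp [Preflow.push, huv, h6] at this
    have := Nat.mul_le_mul_left (n + 2) (Nat.succ_le_of_lt hlt)
    rw [Nat.mul_succ] at this
    omega

/-- Without an admissible arc out of u, all its residual arcs lead to labels at least d u, so there
is room for one more. Sources and sinks keep their labels because an active vertex is neither. -/
theorem Valid.relabel (hs : s.Valid w A B) {u : Fin n} (hu : s.Active B u)
    (h : ∀ v, 0 < s.r u v → s.d u ≠ s.d v + 1) : (s.relabel u).Valid w A B := by
  obtain ⟨hB, he, hd⟩ := hu
  refine ⟨hs.symm, hs.cons, fun a b hab => ?_, fun a => ?_, fun a ha => ?_, fun a ha => ?_⟩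
  · have h1 := hs.label a b hab
    simp only [Preflow.relabel]
    split_ifs with c1 c2 c2
    · rw [c1, c2]; omega
    · subst c1
      have := h b hab
      omega
    · omega
    · exact h1
  · have := hs.le a
    simp only [Preflow.relabel]
    split_ifs with c
    · subst c; omega
    · exact this
  · have := hs.source a ha
    simp only [Preflow.relabel]
    rw [if_neg]
    · exact this
    · rintro rfl; omega
  · simp only [Preflow.relabel]
    rw [if_neg]
    · exact hs.sink a ha
    · rintro rfl; exact hB ha

/-- New admissible arcs all leave u: an arc into u would need a label that exceeds the old d u by 2.
So the middle term grows by at most (n + 2) n and the last one by at most 1, against a loss of (n +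
2) n + 2 in the first. -/
theorem potential_relabel_lt (hs : s.Valid w A B) {u : Fin n} (hu : s.Active B u) :
    (s.relabel u).potential < s.potential := by
  obtain ⟨hB, he, hd⟩ := hu
  have h1 : ∑ a, (n + 1 - (s.relabel u).d a) + 1 = ∑ a, (n + 1 - s.d a) := by
    rw [← add_sum_erase univ (fun a => n + 1 - s.d a) (mem_univ u),
      ← add_sum_erase univ (fun a => n + 1 - (s.relabel u).d a) (mem_univ u)]
    have : ∑ a ∈ univ.erase u, (n + 1 - (s.relabel u).d a) =
        ∑ a ∈ univ.erase u, (n + 1 - s.d a) := sum_congr rfl fun a ha => by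
      simp [relabel, (mem_erase.1 ha).1]
    rw [this]
    simp only [relabel, if_true]
    omega
  have h2 : (s.relabel u).admissible.card ≤ s.admissible.card + n := by
    have hsub : (s.relabel u).admissible ⊆ s.admissible ∪ univ.image fun v => (u, v) := by
      rintro ⟨a, b⟩ hab
      simp only [mem_union, mem_admissible, mem_univ, true_and, mem_image, Prod.mk.injEq,
        relabel] at hab ⊢
      by_cases c : a = u
      · exact Or.inr ⟨b, c.symm, rfl⟩
      · left
        simp only [c, if_false] at hab
        have := hs.label a b hab.1
        split_ifs at hab with c'
        · subst c'; omega
        · exact hab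
    refine (card_le_card hsub).trans ((card_union_le _ _).trans ?_)
    have := card_image_le (s := (univ : Finset (Fin n))) (f := fun v => (u, v))
    rw [card_univ, Fintype.card_fin] at this
    omega
  have h3 : (∑ a, if 0 < (s.relabel u).e a ∧ (s.relabel u).d a < n + 1
      then (s.relabel u).d a else 0) ≤
      (∑ a, if 0 < s.e a ∧ s.d a < n + 1 then s.d a else 0) + 1 := by
    have : ∀ a, (if 0 < (s.relabel u).e a ∧ (s.relabel u).d a < n + 1
      then (s.relabel u).d a else 0) ≤ (if 0 < s.e a ∧ s.d a < n + 1 then s.d a else 0) +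
        if a = u then 1 else 0 := by
      intro a
      simp only [relabel]
      by_cases c : a = u
      · subst c; simp only [if_true]; split_ifs <;> omega
      · simp only [c, if_false]; omega
    have := sum_le_sum fun a (_ : a ∈ univ) => this a
    rw [sum_add_distrib, sum_ite_eq' univ u] at this
    simpa using this
  have h4 := Nat.mul_le_mul_left (n + 2) h2
  rw [mul_add] at h4
  unfold potential
  rw [← h1, mul_add ((n + 2) * n + 2)]
  omega

/-! #### Sweeps -/

/-- `s` is a later state than `s₀`, or the same. -/
def Progress (B : Finset (Fin n)) (s₀ s : Preflow n) : Prop :=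
  (s.potential < s₀.potential ∧ ∃ u, s₀.Active B u) ∨ s = s₀

theorem Progress.of_lt {s' : Preflow n} (h : Progress B s₀ s) (hlt : s'.potential < s.potential)
    (ha : ∃ u, s.Active B u) : Progress B s₀ s' := by
  rcases h with ⟨h1, h2⟩ | rfl
  · exact Or.inl ⟨hlt.trans h1, h2⟩
  · exact Or.inl ⟨hlt, ha⟩

/-- Invariant of the row `u` of a sweep, after the pushes to the vertices before `j`. -/
def RowInv (w : Fin n → Fin n → ℕ) (A B : Finset (Fin n)) (s₀ : Preflow n) (u : Fin n) (j : ℕ)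
    (s : Preflow n) : Prop :=
  s.Valid w A B ∧ (0 < s.e u → s.d u < n + 1 → ∀ v : Fin n, (v : ℕ) < j → 0 < s.r u v →
    s.d u ≠ s.d v + 1) ∧ Progress B s₀ s

/-- If u still has excess after the push, the arc to v is saturated. The arcs to earlier vertices
and all labels are untouched, so one pass over the row leaves no admissible arc out of an active u.
-/
theorem RowInv.push {u v : Fin n} (h : RowInv w A B s₀ u v s) :
    RowInv w A B s₀ u (v + 1) (s.push u v) := by
  obtain ⟨hs, h1, h2⟩ := h
  by_cases h0 : s.amount u v = 0
  · rw [push_eq_self h0]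
    refine ⟨hs, fun he hd v' hv' hr => ?_, h2⟩
    rcases Nat.lt_succ_iff_lt_or_eq.1 hv' with hv | hv
    · exact h1 he hd v' hv hr
    · obtain rfl := Fin.ext hv
      intro hd'
      rw [amount, if_pos ⟨hd', hd⟩] at h0
      omega
  · obtain ⟨d1, d2, d3, d4, d5, d6⟩ := amount_pos h0
    have huv : u ≠ v := by rintro rfl; omega
    have hact : s.Active B u := ⟨fun hu => by have := hs.sink u hu; omega, by omega, d2⟩
    refine ⟨hs.push u v, fun he hd v' hv' hr => ?_,
      h2.of_lt (potential_push_lt h0) ⟨u, hact⟩⟩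
    change s.d u ≠ s.d v' + 1
    simp only [Preflow.push, huv, if_false, if_true] at he
    simp only [Preflow.push, huv, false_and, if_false, true_and] at hr
    rcases Nat.lt_succ_iff_lt_or_eq.1 hv' with hv | hv
    · have : v' ≠ v := fun h => by rw [h] at hv; exact lt_irrefl _ hv
      rw [if_neg this] at hr
      exact h1 (by omega) d2 v' hv hr
    · obtain rfl := Fin.ext hv
      rw [if_pos rfl] at hr
      omega

/-- Invariant of a sweep, after the rows before `i`. -/
def SweepInv (w : Fin n → Fin n → ℕ) (A B : Finset (Fin n)) (s₀ : Preflow n) (i : ℕ)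
    (s : Preflow n) : Prop :=
  s.Valid w A B ∧ ((s.potential < s₀.potential ∧ ∃ u, s₀.Active B u) ∨
    (s = s₀ ∧ ∀ u : Fin n, (u : ℕ) < i → ¬ s₀.Active B u))

theorem SweepInv.rowInv {u : Fin n} (h : SweepInv w A B s₀ u s) : RowInv w A B s u 0 s :=
  ⟨h.1, fun _ _ v hv => absurd hv (by omega), Or.inr rfl⟩

-- At the end of the row an active u satisfies the hypothesis of `Valid.relabel`, and the
-- relabelling is itself progress. If nothing at all has changed so far, then u was not active at
-- the start of the sweep either.
open Classical in
theorem SweepInv.row {s₁ : Preflow n} {u : Fin n} (h : SweepInv w A B s₀ u s)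
    (h' : RowInv w A B s u n s₁) :
    SweepInv w A B s₀ (u + 1) (if s₁.Active B u then s₁.relabel u else s₁) := by
  obtain ⟨-, h2⟩ := h
  obtain ⟨k1, k2, k3⟩ := h'
  have h2' : Progress B s₀ s := h2.imp_right And.left
  split_ifs with ha
  · have hlt := potential_relabel_lt k1 ha
    refine ⟨k1.relabel ha fun v hv => k2 ha.2.1 ha.2.2 v v.2 hv, Or.inl ?_⟩
    rcases k3 with ⟨k3, k4⟩ | rfl
    · rcases h2' with ⟨h3, h4⟩ | rfl
      · exact ⟨(hlt.trans k3).trans h3, h4⟩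
      · exact ⟨hlt.trans k3, k4⟩
    · rcases h2' with ⟨h3, h4⟩ | rfl
      · exact ⟨hlt.trans h3, h4⟩
      · exact ⟨hlt, u, ha⟩
  · refine ⟨k1, ?_⟩
    rcases k3 with ⟨k3, k4⟩ | rfl
    · rcases h2' with ⟨h3, h4⟩ | rfl
      · exact Or.inl ⟨k3.trans h3, h4⟩
      · exact Or.inl ⟨k3, k4⟩
    · rcases h2 with h2 | ⟨rfl, h3⟩
      · exact Or.inl h2
      · refine Or.inr ⟨rfl, fun u' hu' => ?_⟩
        rcases Nat.lt_succ_iff_lt_or_eq.1 hu' with hv | hv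
        · exact h3 u' hv
        · obtain rfl := Fin.ext hv
          exact ha

/-- Invariant of `j` sweeps that start with the potential `Φ`. -/
def SweepsInv (w : Fin n → Fin n → ℕ) (A B : Finset (Fin n)) (Φ j : ℕ) (s : Preflow n) : Prop :=
  s.Valid w A B ∧ ((∀ u, ¬ s.Active B u) ∨ s.potential + j ≤ Φ)

/-- A sweep lowers the potential unless there was nothing active; so more than Φ sweeps must end in
a state without active vertices. -/
theorem SweepsInv.sweep {Φ j : ℕ} (h : SweepsInv w A B Φ j s₀) (h' : SweepInv w A B s₀ n s) :
    SweepsInv w A B Φ (j + 1) s := by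
  refine ⟨h'.1, ?_⟩
  rcases h'.2 with ⟨h1, u, hu⟩ | ⟨rfl, h1⟩
  · rcases h.2 with h2 | h2
    · exact absurd hu (h2 u)
    · exact Or.inr (by omega)
  · exact Or.inl fun u => h1 u u.2

/-! #### Optimality -/

/-- Sum the conservation law over S. The pairs inside S cancel, because r and w have the same
symmetrization. So a set that avoids the sources has cut at least its excess, with equality when no
residual arc enters it. -/
theorem Valid.sum_excess (hs : s.Valid w A B) {S : Finset (Fin n)} (hS : Disjoint A S) :
    ∑ v ∈ S, s.e v + setCut s.r S = setCut w S := by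
  have h1 : ∑ v ∈ S, (s.e v + ∑ u, s.r u v) = ∑ v ∈ S, ∑ u, w u v :=
    sum_congr rfl fun v hv => hs.cons v fun hA => disjoint_left.1 hS hA hv
  have h2 : ∀ f : Fin n → Fin n → ℕ,
      ∑ v ∈ S, ∑ u, f u v = ∑ v ∈ S, ∑ u ∈ S, f u v + setCut f S := fun f => by
    rw [setCut, ← sum_add_distrib]
    exact sum_congr rfl fun v _ => (sum_add_sum_compl S fun u => f u v).symm
  have h3 : ∀ f : Fin n → Fin n → ℕ,
      ∑ v ∈ S, ∑ u ∈ S, (f u v + f v u) = 2 * ∑ v ∈ S, ∑ u ∈ S, f u v := fun f => by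
    simp only [sum_add_distrib]
    rw [sum_comm (f := fun v u => f v u)]
    ring
  have h4 : ∑ v ∈ S, ∑ u ∈ S, (s.r u v + s.r v u) = ∑ v ∈ S, ∑ u ∈ S, (w u v + w v u) :=
    sum_congr rfl fun v _ => sum_congr rfl fun u _ => hs.symm u v
  rw [h3, h3] at h4
  rw [sum_add_distrib, h2, h2] at h1
  omega

/-- At the end, some level set of the labels is a minimum cut. -/
theorem Valid.exists_min_cut (hs : s.Valid w A B) (hact : ∀ u, ¬ s.Active B u)
    (hne : (A ∪ B).Nonempty) :
    ∃ k < n, ∀ S : Finset (Fin n), Disjoint A S → B ⊆ S →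
      setCut w (univ.filter fun v => s.d v ≤ k) ≤ setCut w S := by
  -- Pigeonhole: fewer than n vertices lie outside A ∪ B, so they leave a gap among the labels 1, …,
  -- n. Sources have label n + 1 and sinks 0, hence no vertex at all has label l.
  obtain ⟨l, hl, hd⟩ : ∃ l ∈ Icc 1 n, l ∉ (A ∪ B)ᶜ.image s.d := by
    by_contra! h
    have h1 : Icc 1 n ⊆ (A ∪ B)ᶜ.image s.d := h
    have h2 := (card_le_card h1).trans card_image_le
    have h3 := card_compl_add_card (A ∪ B)
    have h4 := hne.card_pos
    rw [Nat.card_Icc, Nat.add_sub_cancel] at h2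
    rw [Fintype.card_fin] at h3
    omega
  rw [mem_Icc] at hl
  have hlev : ∀ v, s.d v ≠ l := by
    intro v hv
    by_cases hA : v ∈ A
    · have := hs.source v hA; omega
    · by_cases hB : v ∈ B
      · have := hs.sink v hB; omega
      · exact hd (mem_image.2 ⟨v, by simp [hA, hB], hv⟩)
  refine ⟨l - 1, by omega, fun S hA hB => ?_⟩
  set T := univ.filter fun v => s.d v ≤ l - 1 with hT
  have hmem : ∀ v, v ∈ T ↔ s.d v ≤ l - 1 := fun v => by simp [hT]
  have hAT : Disjoint A T := disjoint_left.2 fun v hv hv' => by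
    have := hs.source v hv
    have := (hmem v).1 hv'
    omega
  have e1 := hs.sum_excess hAT
  have e2 := hs.sum_excess hA
  -- A residual arc into T would descend across the gap, by at least two labels.
  have e3 : setCut s.r T = 0 := by
    refine sum_eq_zero fun v hv => sum_eq_zero fun u hu => ?_
    rw [mem_compl, hmem] at hu
    rw [hmem] at hv
    by_contra h
    have := hs.label u v (Nat.pos_of_ne_zero h)
    have := hlev u
    omega
  -- A vertex of T outside S is not a sink and has label below n + 1; since it is not active, it has
  -- no excess.
  have e4 : ∑ v ∈ T, s.e v ≤ ∑ v ∈ S, s.e v := by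
    have : ∑ v ∈ T, s.e v = ∑ v ∈ T ∩ S, s.e v := by
      refine (sum_subset inter_subset_left fun v hv hv' => ?_).symm
      have h1 : v ∉ S := fun h => hv' (mem_inter.2 ⟨hv, h⟩)
      rw [hmem] at hv
      by_contra h
      exact hact v ⟨fun h => h1 (hB h), Nat.pos_of_ne_zero h, by omega⟩
    rw [this]
    exact sum_le_sum_of_subset inter_subset_right
  omega

/-- The preflow in which all arcs that leave the sources are saturated. -/
def start (w : Fin n → Fin n → ℕ) (A : Finset (Fin n)) : Preflow n where
  r u v := if u ∈ A then (if v ∈ A then w u v else 0) else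
    if v ∈ A then w u v + w v u else w u v
  e v := ∑ u, if u ∈ A then w u v else 0
  d v := if v ∈ A then n + 1 else 0

theorem start_valid (w : Fin n → Fin n → ℕ) (h : Disjoint A B) : (start w A).Valid w A B where
  symm u v := by
    simp only [start]
    split_ifs <;> omega
  cons v hv := by
    simp only [start, hv, if_false]
    rw [← sum_add_distrib]
    exact sum_congr rfl fun u _ => by split_ifs <;> omega
  label u v huv := by
    simp only [start] at huv ⊢
    split_ifs at huv ⊢ <;> omega
  le u := by
    simp only [start]
    split_ifs <;> omega
  source u hu := by simp [start, hu]
  sink u hu := by simp [start, disjoint_right.1 h hu]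

end Preflow
namespace RAM

/-! ### The program -/

/-- The parameters fit the instance. -/
structure Params.Fits (p : Params) (G : WeightedDigraph p.n) : Prop where
  big_eq : p.big = 2 ^ ((2 * p.n + 2) / 3)
  big_le : p.big ≤ p.cap
  n_add_two_le : p.n + 2 ≤ p.cap
  sq_add_two_le : p.n * p.n + 2 ≤ p.cap
  total_lt : 2 * ∑ u, ∑ v, G.arcWeight u v < p.cap

theorem Params.Fits.sound {p : Params} {G : WeightedDigraph p.n} (hp : p.Fits G) : p.Sound :=
  ⟨by have := hp.n_add_two_le; omega, hp.big_le⟩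

/-- The state holds the input, and its cells do not exceed the cap. -/
structure State.Good (p : Params) (G : WeightedDigraph p.n) (s : State) : Prop where
  bounded : s.Bounded p.cap
  input : ∀ u v : Fin p.n, s.mem (2 + (p.n * u + v)) = arcCode G u v

theorem index_lt {n : ℕ} (u v : Fin n) : n * u + v < n * n := by
  have h1 := u.2
  have h2 := v.2
  calc n * u + v < n * u + n := by omega
    _ = n * (u + 1) := by ring
    _ ≤ n * n := Nat.mul_le_mul_left _ h1

theorem index_inj {n : ℕ} {u v a b : Fin n} :
    n * (u : ℕ) + v = n * a + b ↔ u = a ∧ v = b := by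
  refine ⟨fun h => ?_, by rintro ⟨rfl, rfl⟩; rfl⟩
  have hn : 0 < n := u.pos
  have h1 : (n * (u : ℕ) + v) / n = u := by
    rw [Nat.mul_add_div hn, Nat.div_eq_of_lt v.2, add_zero]
  have h2 : (n * (a : ℕ) + b) / n = a := by
    rw [Nat.mul_add_div hn, Nat.div_eq_of_lt b.2, add_zero]
  have h3 : (u : ℕ) = a := by rw [← h1, ← h2, h]
  rw [h3] at h
  exact ⟨Fin.ext h3, Fin.ext (by omega)⟩

variable {p : Params} {G : WeightedDigraph p.n} {s t : State}

theorem State.Good.frame {X : List ℕ} {K : List (Fin 16)} (hs : s.Good p G) (hp : p.Fits G)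
    (h : Frame p X K s t) : t.Good p G where
  bounded := h.bounded hs.bounded
  input u v := by
    have := index_lt u v
    have := hp.sq_add_two_le
    rw [h.mem _ (by omega), hs.input]

theorem State.Good.weight (hs : s.Good p G) (u v : Fin p.n) :
    s.mem (2 + (p.n * u + v)) - 1 = G.arcWeight u v := by rw [hs.input]; rfl

theorem State.Good.arr_le (hs : s.Good p G) (k : Fin 16) (i : ℕ) : s.arr p k i ≤ p.cap :=
  hs.bounded.2 _

/-- The index of the pair of the variables `x` and `y` in a matrix. -/
def Expr.index (x y : ℕ) : Expr := .sum 2 (.var x) + .var y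

-- The language has no product; n · x is the sum of n copies of x. The summation variable 2 is
-- reserved for this.
@[simp] theorem Expr.val_index {x y : ℕ} (h : x ≠ 2) :
    (Expr.index x y).val p s = p.n * s.reg x + s.reg y := by
  simp [Expr.index, h]

/-- The weight of the pair of the variables `x` and `y`. -/
def Expr.wt (x y : ℕ) : Expr := .mem (2 + .index x y) - 1

@[simp] theorem Expr.val_wt {x y : ℕ} (h : x ≠ 2) :
    (Expr.wt x y).val p s = s.mem (2 + (p.n * s.reg x + s.reg y)) - 1 := by
  simp [Expr.wt, h]

/-- Fills the array `k` with the values of an expression in the variable `x`. -/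
def fill (k : Fin 16) (x : ℕ) (a : Expr) : Cmd := .loop x (.put k (.var x) a)

theorem fill_spec (hp : p.Sound) {k : Fin 16} {x : ℕ} {a : Expr} (f : Fin p.n → ℕ)
    (hf : ∀ j : Fin p.n, ∀ t, Frame p [x] [k] s t → t.reg x = j → a.val p t = f j)
    (hle : ∀ j, f j ≤ p.cap) (j : Fin p.n) : ((fill k x a).eval p s).arr p k j = f j := by
  refine Cmd.loop_induct hp (fun i t => ∀ j : Fin p.n, (j : ℕ) < i → t.arr p k j = f j) rfl
    (fun _ h => absurd h (by omega)) ?_ j j.2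
  intro i hi t ht h j hj
  have h1 := hf ⟨i, hi⟩ _ ht (by simp)
  rw [Cmd.eval_put, h1, min_eq_left (hle _)]
  rcases Nat.lt_succ_iff_lt_or_eq.1 hj with h2 | h2
  · simp [h2.ne, h j h2]
  · simp only [Expr.val_var, State.reg_setReg, if_true, State.arr_setArr, h2, and_self]
    congr 1
    exact Fin.ext h2.symm

/-! #### Powers of two and the sizes of the parts -/

/-- Writes the powers of two to the array 10. -/
def powers : Cmd :=
  .seq (.set 5 1) (.loop 6 (.seq (.put 10 (.var 6) (.var 5)) (.set 5 (.var 5 + .var 5))))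

/-- Capping before and after a doubling has the same effect as capping once at the end. Capped
powers suffice, as all codes are below `big` and hence below the cap. -/
theorem powers_spec (hp : p.Fits G) (j : ℕ) (hj : j < p.n) :
    (powers.eval p s).arr p 10 j = min (2 ^ j) p.cap := by
  have h1 : 1 ≤ p.cap := by have := hp.n_add_two_le; omega
  refine (Cmd.loop_induct hp.sound (fun i t => t.reg 5 = min (2 ^ i) p.cap ∧
    ∀ j < i, t.arr p 10 j = min (2 ^ j) p.cap) rfl ⟨by simp, by simp⟩ ?_).2 j hj
  rintro i hi t ht ⟨h5, h⟩
  refine ⟨?_, fun j hj => ?_⟩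
  · simp [h5, pow_succ]; omega
  · rcases Nat.lt_succ_iff_lt_or_eq.1 hj with h2 | rfl
    · simp [h2.ne, h j h2]
    · simp [h5]

/-- Computes the size of the first part and its complement. -/
def sizes : Cmd :=
  .seq (.set 11 (.sum 20 (.ite (.lt (.arr 10 (.var 20)) .big) 1 0)))
    (.set 12 (.size - .var 11))

/-- The size of the first part. -/
def part (n : ℕ) : ℕ := (2 * n + 2) / 3

theorem part_le (n : ℕ) : part n ≤ n := by unfold part; omega

/-- The size of the first part is the logarithm of `big`, found by counting the powers of two below
`big`. -/
theorem sizes_spec (hp : p.Fits G) (h : ∀ j < p.n, s.arr p 10 j = min (2 ^ j) p.cap) :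
    (sizes.eval p s).reg 11 = part p.n ∧ (sizes.eval p s).reg 12 = p.n - part p.n := by
  have hle := part_le p.n
  have hn := hp.n_add_two_le
  have h1 : (∑ i ∈ range p.n, if p.big ≤ s.arr p 10 i then 0 else 1) = part p.n := by
    have : ∀ i ∈ range p.n, (if p.big ≤ s.arr p 10 i then 0 else 1) =
        if i ∈ range (part p.n) then 1 else 0 := by
      intro i hi
      have h2 : p.big ≤ s.arr p 10 i ↔ part p.n ≤ i := by
        rw [h i (mem_range.1 hi), le_min_iff, hp.big_eq, and_iff_left (hp.big_eq ▸ hp.big_le),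
          Nat.pow_le_pow_iff_right (by norm_num), part]
      simp only [h2, mem_range]
      split_ifs <;> omega
    rw [sum_congr rfl this, sum_ite_mem, inter_eq_right.2 (range_subset_range.2 hle)]
    simp
  simp [sizes, h1]
  omega

/-! #### Bits -/

/-- The index `n - 1 - i` for the variable `i`. -/
def Expr.rev (x : ℕ) : Expr := .size - (1 + .var x)

/-- Writes the bits of the variable 4 to the array 3. -/
def decode : Cmd :=
  .seq (.set 5 (.var 4)) (.loop 6 (.ite (.lt (.var 5) (.arr 10 (.rev 6)))
    (.put 3 (.rev 6) 0) (.seq (.put 3 (.rev 6) 1) (.set 5 (.var 5 - .arr 10 (.rev 6))))))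

theorem two_pow_le_mod_iff (x j : ℕ) : 2 ^ j ≤ x % 2 ^ (j + 1) ↔ x / 2 ^ j % 2 = 1 := by
  have h1 := Nat.mod_pow_succ (b := 2) (k := j) (x := x)
  have h2 := Nat.mod_lt x (Nat.two_pow_pos j)
  rcases Nat.mod_two_eq_zero_or_one (x / 2 ^ j) with h | h <;> rw [h1, h] <;> simp
  exact h2

theorem decode_spec (hp : p.Fits G) (hpw : ∀ j < p.n, s.arr p 10 j = min (2 ^ j) p.cap)
    (h4 : s.reg 4 < p.big) (j : ℕ) (hj : j < p.n) :
    (decode.eval p s).arr p 3 j = s.reg 4 / 2 ^ j % 2 := by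
  have hcap := hp.big_le
  have hn2 := hp.n_add_two_le
  set m := s.reg 4 with hm
  have hmn : m < 2 ^ p.n := h4.trans_le (hp.big_eq ▸ Nat.pow_le_pow_right (by omega)
    (part_le p.n))
  -- Greedy binary expansion from the top bit down: after i rounds variable 5 holds the lowest n - i
  -- bits of the code. A capped power of two compares with it like the true power, since the code is
  -- below the cap.
  have key := Cmd.loop_induct hp.sound (x := 6) (s := s.setReg 5 (min m p.cap))
    (P := .ite (.lt (.var 5) (.arr 10 (.rev 6)))
    (.put 3 (.rev 6) 0) (.seq (.put 3 (.rev 6) 1) (.set 5 (.var 5 - .arr 10 (.rev 6)))))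
    (fun i t => t.reg 5 = m % 2 ^ (p.n - i) ∧
      ∀ j, p.n - i ≤ j → j < p.n → t.arr p 3 j = m / 2 ^ j % 2) rfl
    ⟨by simp [Nat.mod_eq_of_lt hmn]; omega, fun j h1 h2 => by omega⟩ ?_
  · exact key.2 j (by omega) hj
  rintro i hi t ht ⟨h5, hB⟩
  have hpwt : t.arr p 10 (p.n - (1 + i)) = min (2 ^ (p.n - (1 + i))) p.cap := by
    have := ht.arr 10 (by decide)
    simp only [State.arr_setReg, funext_iff] at this
    rw [this, hpw _ (by omega)]
  obtain ⟨J, hJ⟩ : ∃ J, p.n - (1 + i) = J := ⟨_, rfl⟩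
  have hJ1 : p.n - i = J + 1 := by omega
  have hJ2 : p.n - (i + 1) = J := by omega
  rw [hJ1] at h5 hB
  rw [hJ] at hpwt
  rw [hJ2]
  have hbit := two_pow_le_mod_iff m J
  have hmod := Nat.mod_le m (2 ^ (J + 1))
  have hsucc := Nat.mod_pow_succ (b := 2) (k := J) (x := m)
  have hrev : (Expr.rev 6).val p (t.setReg 6 i) = J := by simp [Expr.rev, hJ]
  rw [Cmd.eval_ite]
  split_ifs with hc
  · simp only [Expr.val_lt_eq_zero, Expr.val_arr, hrev, State.arr_setReg, hpwt, Expr.val_var,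
      State.reg_setReg, h5] at hc
    norm_num at hc
    have hc' : 2 ^ J ≤ m % 2 ^ (J + 1) := by omega
    have hb := hbit.1 hc'
    rw [hb] at hsucc
    have hrev' : ∀ v, (Expr.rev 6).val p ((t.setReg 6 i).setArr p 3 J v) = J := fun v => by
      simp [Expr.rev, hJ]
    constructor
    · simp [hrev, hrev', hpwt, h5]
      omega
    · intro j' h1 h2
      rcases eq_or_ne j' J with rfl | hne
      · simp [hrev, hb]; omega
      · simp [hrev, hne]
        exact hB j' (by omega) h2
  · simp only [Expr.val_lt_eq_zero, Expr.val_arr, hrev, State.arr_setReg, hpwt, Expr.val_var,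
      State.reg_setReg, h5] at hc
    norm_num at hc
    have hc' : ¬ 2 ^ J ≤ m % 2 ^ (J + 1) := by omega
    have hb : m / 2 ^ J % 2 = 0 := by have := mt hbit.2 hc'; omega
    rw [hb] at hsucc
    constructor
    · simp [h5, hsucc]
    · intro j' h1 h2
      rcases eq_or_ne j' J with rfl | hne
      · simp [hrev, hb]
      · simp [hrev, hne]
        exact hB j' (by omega) h2

end RAM
namespace RAM

variable {p : Params} {G : WeightedDigraph p.n} {s t : State}

/-! #### Minimum cuts -/

/-- The preflow in the arrays 0, 1 and 2. -/
def State.preflow (p : Params) (s : State) : Preflow p.n where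
  r u v := s.arr p 0 (p.n * u + v)
  e u := s.arr p 1 u
  d u := s.arr p 2 u

@[simp] theorem State.preflow_r (u v : Fin p.n) : (s.preflow p).r u v = s.arr p 0 (p.n * u + v) :=
  rfl
@[simp] theorem State.preflow_e (u : Fin p.n) : (s.preflow p).e u = s.arr p 1 u := rfl
@[simp] theorem State.preflow_d (u : Fin p.n) : (s.preflow p).d u = s.arr p 2 u := rfl

/-- The vertices of the first part whose bit is zero. -/
def State.sources (p : Params) (s : State) : Finset (Fin p.n) :=
  univ.filter fun v => (v : ℕ) < part p.n ∧ s.arr p 3 v = 0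

/-- The vertices of the first part whose bit is one. -/
def State.sinks (p : Params) (s : State) : Finset (Fin p.n) :=
  univ.filter fun v => (v : ℕ) < part p.n ∧ s.arr p 3 v ≠ 0

/-- Nonzero if the variable `x` is a source. -/
def Expr.source (x : ℕ) : Expr := .and (.lt (.var x) (.var 11)) (.not (.arr 3 (.var x)))

/-- Initializes the excesses. -/
def initExcess : Cmd := fill 1 0 (.sum 20 (.ite (.source 20) (.wt 20 0) 0))

/-- Initializes the labels. -/
def initLabel : Cmd := fill 2 0 (.ite (.source 0) (.size + 1) 0)

/-- Initializes a row of the residual capacities. -/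
def initRow : Cmd := .loop 1 (.put 0 (.index 0 1) (.ite (.source 0)
  (.ite (.source 1) (.wt 0 1) 0) (.ite (.source 1) (.wt 0 1 + .wt 1 0) (.wt 0 1))))

/-- Initializes the preflow. -/
def initFlow : Cmd := .seq initExcess (.seq initLabel (.loop 0 initRow))

theorem arcWeight_add_le (hp : p.Fits G) (u v : Fin p.n) :
    G.arcWeight u v + G.arcWeight v u ≤ p.cap := by
  have h : ∀ u v, G.arcWeight u v ≤ ∑ u, ∑ v, G.arcWeight u v := fun u v =>
    (single_le_sum (f := fun v => G.arcWeight u v) (fun _ _ => Nat.zero_le _) (mem_univ v)).trans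
      (single_le_sum (f := fun u => ∑ v, G.arcWeight u v) (fun _ _ => Nat.zero_le _) (mem_univ u))
  have := h u v
  have := h v u
  have := hp.total_lt
  omega

theorem sum_arcWeight_le (hp : p.Fits G) (v : Fin p.n) : ∑ u, G.arcWeight u v ≤ p.cap := by
  have h : ∑ u, G.arcWeight u v ≤ ∑ u, ∑ v, G.arcWeight u v := sum_le_sum fun u _ =>
    single_le_sum (f := fun v => G.arcWeight u v) (fun _ _ => Nat.zero_le _) (mem_univ v)
  have := hp.total_lt
  omega

/-- The source test reads only variable 11 and array 3, so it stays meaningful throughout the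
initialization, which changes neither. -/
theorem source_eq_zero {A : Finset (Fin p.n)} (hA : s.sources p = A) (h11 : s.reg 11 = part p.n)
    {X : List ℕ} {K : List (Fin 16)} (ht : Frame p X K s t) (hX : 11 ∉ X) (hK : 3 ∉ K) {x : ℕ}
    {v : Fin p.n} (hx : t.reg x = v) : (Expr.source x).val p t = 0 ↔ v ∉ A := by
  subst hA
  simp only [Expr.source, Expr.val_and_eq_zero, Expr.val_lt_eq_zero, Expr.val_not_eq_zero,
    Expr.val_var, Expr.val_arr, hx, ht.reg 11 hX, ht.arr 3 hK, h11, State.sources, mem_filter,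
    mem_univ, true_and]
  omega

theorem initFlow_spec (hp : p.Fits G) (hs : s.Good p G) (h11 : s.reg 11 = part p.n) :
    (initFlow.eval p s).preflow p = Preflow.start G.arcWeight (s.sources p) := by
  obtain ⟨A, hA⟩ : ∃ A, s.sources p = A := ⟨_, rfl⟩
  rw [hA]
  simp only [initFlow, Cmd.eval_seq]
  set s1 := initExcess.eval p s with hs1
  have f1 : Frame p [0] [1] s s1 := Cmd.frame hp.sound initExcess rfl s
  set s2 := initLabel.eval p s1 with hs2
  have f2' : Frame p [0] [2] s1 s2 := Cmd.frame hp.sound initLabel rfl s1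
  have f2 : Frame p [0] [1, 2] s s2 := (f1.mono (by decide) (by decide)).trans f2'
    (by decide) (by decide)
  set s3 := (Cmd.loop 0 initRow).eval p s2 with hs3
  have f3 : Frame p [0, 1] [0] s2 s3 := Cmd.frame hp.sound (Cmd.loop 0 initRow) rfl s2
  have e1 : ∀ v : Fin p.n, s1.arr p 1 v = ∑ u, if u ∈ A then G.arcWeight u v else 0 := by
    refine fill_spec hp.sound _ (fun v t ht hv => ?_) fun v => ?_
    · simp only [Expr.val_sum, sum_range, Expr.val_ite]
      refine sum_congr rfl fun u _ => ?_
      have ft : Frame p [0, 20] [1] s (t.setReg 20 u) := (ht.mono (by decide) (by decide)).trans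
        (Frame.setReg (X := [20]) (K := []) (by decide) (by have := hp.n_add_two_le; omega))
        (by decide) (by decide)
      simp only [source_eq_zero hA h11 ft (by decide) (by decide) (x := 20) (v := u) (by simp),
        ite_not]
      rw [Expr.val_wt (by decide), ← (hs.frame hp ft).weight u v]
      simp [hv]
    · refine le_trans (sum_le_sum fun u _ => ?_) (sum_arcWeight_le hp v)
      split_ifs <;> omega
  have e2 : ∀ v : Fin p.n, s2.arr p 2 v = if v ∈ A then p.n + 1 else 0 := by
    refine fill_spec hp.sound _ (fun v t ht hv => ?_) fun v => ?_
    · have ft : Frame p [0] [1, 2] s t := (f1.mono (by decide) (by decide)).trans ht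
        (by decide) (by decide)
      simp [source_eq_zero hA h11 ft (by decide) (by decide) hv]
    · have := hp.n_add_two_le
      split_ifs <;> omega
  have e3 : ∀ u v : Fin p.n, s3.arr p 0 (p.n * u + v) = (Preflow.start G.arcWeight A).r u v := by
    intro u v
    refine Cmd.loop_induct hp.sound (fun i t => ∀ u v : Fin p.n, (u : ℕ) < i →
      t.arr p 0 (p.n * u + v) = (Preflow.start G.arcWeight A).r u v) rfl
      (fun _ _ h => absurd h (by omega)) ?_ u v u.2
    intro i hi t ht h u v hu
    have key : ∀ u v : Fin p.n,
        (initRow.eval p (t.setReg 0 i)).arr p 0 (p.n * u + v) =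
        if (u : ℕ) = i ∧ (v : ℕ) < p.n then (Preflow.start G.arcWeight A).r u v
          else t.arr p 0 (p.n * u + v) := by
      refine Cmd.loop_induct hp.sound (fun j t' => ∀ u v : Fin p.n, t'.arr p 0 (p.n * u + v) =
        if (u : ℕ) = i ∧ (v : ℕ) < j then (Preflow.start G.arcWeight A).r u v
          else t.arr p 0 (p.n * u + v)) rfl (fun u v => by simp) ?_
      intro j hj t' ht' h' u v
      obtain ⟨I, rfl⟩ : ∃ I : Fin p.n, (I : ℕ) = i := ⟨⟨i, hi⟩, rfl⟩
      obtain ⟨J, rfl⟩ : ∃ J : Fin p.n, (J : ℕ) = j := ⟨⟨j, hj⟩, rfl⟩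
      have h0 : (t'.setReg 1 J).reg 0 = I := by
        have := ht'.reg 0 (by decide)
        simpa using this
      have ft : Frame p [0, 1] [0, 1, 2] s (t'.setReg 1 J) :=
        ((f2.mono (by decide) (by decide)).trans ht (by decide) (by decide)).trans ht'
          (by decide) (by decide)
      have hg := hs.frame hp ft
      set T := t'.setReg 1 J with hT
      have h1 : T.reg 1 = J := by simp [hT]
      have hval : (Expr.ite (.source 0) (.ite (.source 1) (.wt 0 1) 0)
          (.ite (.source 1) (.wt 0 1 + .wt 1 0) (.wt 0 1))).val p T =
          (Preflow.start G.arcWeight A).r I J := by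
        simp only [Expr.val_ite, source_eq_zero hA h11 ft (by decide) (by decide) h0,
          source_eq_zero hA h11 ft (by decide) (by decide) h1, Expr.val_add, Preflow.start]
        rw [Expr.val_wt (by decide), Expr.val_wt (by decide), h0, h1, hg.weight, hg.weight]
        simp only [ite_not, Expr.val_zero]
      have hle : (Preflow.start G.arcWeight A).r I J ≤ p.cap := by
        have := arcWeight_add_le hp I J
        simp only [Preflow.start]
        split_ifs <;> omega
      rw [Cmd.eval_put, hval, min_eq_left hle, Expr.val_index (by decide), h0, h1,
        State.arr_setArr]
      simp only [true_and, index_inj]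
      have hTt : T.arr p 0 (p.n * u + v) = t'.arr p 0 (p.n * u + v) := rfl
      rw [hTt, h']
      by_cases c1 : u = I
      · by_cases c2 : v = J
        · simp [c1, c2]
        · have : (v : ℕ) < J + 1 ↔ (v : ℕ) < J := by
            have := fun h => c2 (Fin.ext h); omega
          simp [c1, c2, this]
      · have : (u : ℕ) ≠ I := fun h => c1 (Fin.ext h)
        simp [c1, this]
    rw [key u v]
    by_cases hui : (u : ℕ) = i
    · simp [hui]
    · simp [hui, h u v (by omega)]
  have a1 : s3.arr p 1 = s1.arr p 1 := (f3.arr 1 (by decide)).trans (f2'.arr 1 (by decide))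
  have a2 : s3.arr p 2 = s2.arr p 2 := f3.arr 2 (by decide)
  ext u v
  · exact e3 u v
  · simp only [State.preflow, a1, e1]; rfl
  · simp only [State.preflow, a2, e2]; rfl

/-- Pushes from the variable 0 to the variable 1. -/
def pushCmd : Cmd :=
  .seq (.set 7 (.ite (.and (.eq (.arr 2 (.var 0)) (.arr 2 (.var 1) + 1))
      (.lt (.arr 2 (.var 0)) (.size + 1)))
    (.min (.arr 1 (.var 0)) (.arr 0 (.index 0 1))) 0))
  (.seq (.put 0 (.index 0 1) (.arr 0 (.index 0 1) - .var 7))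
  (.seq (.put 0 (.index 1 0) (.arr 0 (.index 1 0) + .var 7))
  (.seq (.put 1 (.var 0) (.arr 1 (.var 0) - .var 7))
    (.put 1 (.var 1) (.arr 1 (.var 1) + .var 7)))))

/-- The point is that the cap never truncates a residual capacity or an excess. The subtractions
precede the additions; when u = v the amount is 0, so the coinciding cells do no harm. -/
theorem pushCmd_spec (hp : p.Fits G) (hs : s.Good p G) {A B : Finset (Fin p.n)}
    (hv : (s.preflow p).Valid G.arcWeight A B) {u v : Fin p.n} (h0 : s.reg 0 = u)
    (h1 : s.reg 1 = v) : (pushCmd.eval p s).preflow p = (s.preflow p).push u v := by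
  obtain ⟨δ, hδ⟩ : ∃ δ, (s.preflow p).amount u v = δ := ⟨_, rfl⟩
  have hv' := hv.push u v
  have hr : ∀ a b, ((s.preflow p).push u v).r a b ≤ p.cap := fun a b => by
    have := hv'.symm a b
    have := arcWeight_add_le hp a b
    omega
  -- Outside A the conservation law bounds the excess by the total inflow capacity. A source has
  -- label n + 1, so it neither sends nor receives a nonzero push and its excess is unchanged.
  have he : ∀ a, ((s.preflow p).push u v).e a ≤ p.cap := fun a => by
    by_cases h : (s.preflow p).amount u v = 0
    · rw [Preflow.push_eq_self h]; exact hs.arr_le _ _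
    · obtain ⟨d1, d2, d3, d4, d5, d6⟩ := Preflow.amount_pos h
      by_cases ha : a ∈ A
      · have hd := hv.source a ha
        have c1 : a ≠ u := by rintro rfl; omega
        have c2 : a ≠ v := by rintro rfl; omega
        simp only [Preflow.push, c1, c2, if_false]
        exact hs.arr_le _ _
      · have := hv'.cons a ha
        have := sum_arcWeight_le hp a
        omega
  have hval : (Expr.ite (.and (.eq (.arr 2 (.var 0)) (.arr 2 (.var 1) + 1))
      (.lt (.arr 2 (.var 0)) (.size + 1)))
      (.min (.arr 1 (.var 0)) (.arr 0 (.index 0 1))) 0).val p s = δ := by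
    have hc : (Expr.and (.eq (.arr 2 (.var 0)) (.arr 2 (.var 1) + 1))
        (.lt (.arr 2 (.var 0)) (.size + 1))).val p s = 0 ↔
        ¬((s.preflow p).d u = (s.preflow p).d v + 1 ∧ (s.preflow p).d u < p.n + 1) := by
      simp only [Expr.val_and_eq_zero, Expr.val_eq_eq_zero, Expr.val_lt_eq_zero,
        Expr.val_arr, Expr.val_var, Expr.val_add, Expr.val_one, Expr.val_size, h0, h1,
        State.preflow_d]
      omega
    rw [← hδ, Preflow.amount, Expr.val_ite]
    split_ifs with c1 c2 c2
    · exact absurd c2 (hc.1 c1)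
    · rfl
    · rw [Expr.val_min, Expr.val_arr, Expr.val_arr, Expr.val_index (by decide), Expr.val_var,
        h0, h1]
      rfl
    · exact absurd (hc.2 c2) c1
  have hδle : δ ≤ p.cap := by
    rw [← hδ, Preflow.amount]
    split_ifs
    · exact (min_le_left _ _).trans (hs.arr_le _ _)
    · exact Nat.zero_le _
  have huv : δ ≠ 0 → u ≠ v := fun h => by
    have := Preflow.amount_pos (hδ ▸ h)
    rintro rfl; omega
  have hr' := hr
  have he' := he
  simp only [Preflow.push, hδ, State.preflow_r, State.preflow_e] at hr' he'
  simp only [pushCmd, Cmd.eval_seq, Cmd.eval_set, hval, min_eq_left hδle]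
  have i01 : ∀ t : State, (Expr.index 0 1).val p t = p.n * t.reg 0 + t.reg 1 := fun t =>
    Expr.val_index (by decide)
  have i10 : ∀ t : State, (Expr.index 1 0).val p t = p.n * t.reg 1 + t.reg 0 := fun t =>
    Expr.val_index (by decide)
  ext a b
  · have q1 := hr' v u
    have q2 := hs.arr_le 0 (p.n * u + v)
    have q3 := hr' a b
    simp only [Cmd.eval_put, i01, i10, Expr.val_add, Expr.val_sub, Expr.val_arr, Expr.val_var,
      State.reg_setArr, State.reg_setReg, State.preflow_r, State.preflow_e, Preflow.push, State.arr_setArr,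
      State.arr_setReg, h0, h1, hδ]
    simp only [if_true, if_false, true_and, false_and, index_inj,
      show (0 : ℕ) ≠ 7 by decide, show (1 : ℕ) ≠ 7 by decide, show (0 : Fin 16) ≠ 1 by decide]
    simp only [and_self, if_true] at q1
    by_cases c1 : a = v ∧ b = u
    · obtain ⟨rfl, rfl⟩ := c1
      by_cases c2 : a = b
      · subst c2
        have : δ = 0 := by by_contra h; exact huv h rfl
        simp [this]; omega
      · simp [c2]; omega
    · by_cases c2 : a = u ∧ b = v
      · obtain ⟨rfl, rfl⟩ := c2
        simp [c1]; omega
      · simp [c1, c2]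
  · have q1 := he' v
    have q2 := hs.arr_le 1 u
    simp only [Cmd.eval_put, i01, i10, Expr.val_add, Expr.val_sub, Expr.val_arr, Expr.val_var,
      State.reg_setArr, State.reg_setReg, State.preflow_r, State.preflow_e, Preflow.push, State.arr_setArr,
      State.arr_setReg, h0, h1, hδ]
    simp only [if_true, if_false, true_and, false_and, Fin.val_inj,
      show (0 : ℕ) ≠ 7 by decide, show (1 : ℕ) ≠ 7 by decide, show (1 : Fin 16) ≠ 0 by decide]
    simp only [if_true] at q1
    by_cases c1 : a = v
    · subst c1
      by_cases c2 : a = u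
      · subst c2
        have : δ = 0 := by by_contra h; exact huv h rfl
        simp [this]; omega
      · simp [c2]; omega
    · by_cases c2 : a = u
      · subst c2
        simp [c1]; omega
      · simp [c1, c2]
  · simp [State.preflow, Preflow.push]

/-- One sweep. -/
def sweep : Cmd :=
  .loop 0 (.seq (.loop 1 pushCmd) (.put 2 (.var 0) (.arr 2 (.var 0) +
    .ite (.and (.not (.lt (.var 0) (.var 11))) (.and (.arr 1 (.var 0))
      (.lt (.arr 2 (.var 0)) (.size + 1)))) 1 0)))

theorem sweep_spec (hp : p.Fits G) (hs : s.Good p G) (h11 : s.reg 11 = part p.n)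
    (hv : (s.preflow p).Valid G.arcWeight (s.sources p) (s.sinks p)) :
    Preflow.SweepInv G.arcWeight (s.sources p) (s.sinks p) (s.preflow p) p.n
      ((sweep.eval p s).preflow p) := by
  obtain ⟨A, hA⟩ : ∃ A, s.sources p = A := ⟨_, rfl⟩
  obtain ⟨B, hB⟩ : ∃ B, s.sinks p = B := ⟨_, rfl⟩
  rw [hA, hB] at hv ⊢
  refine Cmd.loop_induct hp.sound (fun i t => Preflow.SweepInv G.arcWeight A B (s.preflow p) i
    (t.preflow p)) rfl ⟨hv, Or.inr ⟨rfl, fun _ h => absurd h (by omega)⟩⟩ ?_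
  intro i hi t ht h
  obtain ⟨u, rfl⟩ : ∃ u : Fin p.n, (u : ℕ) = i := ⟨⟨i, hi⟩, rfl⟩
  have hrow : Preflow.RowInv G.arcWeight A B (t.preflow p) u p.n
      (((Cmd.loop 1 pushCmd).eval p (t.setReg 0 u)).preflow p) := by
    refine Cmd.loop_induct hp.sound (fun j t' => Preflow.RowInv G.arcWeight A B (t.preflow p) u j
      (t'.preflow p)) rfl h.rowInv ?_
    intro j hj t' ht' h'
    obtain ⟨v, rfl⟩ : ∃ v : Fin p.n, (v : ℕ) = j := ⟨⟨j, hj⟩, rfl⟩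
    have hu : (t'.setReg 1 v).reg 0 = u := by
      have := ht'.reg 0 (by decide)
      simpa using this
    rw [pushCmd_spec hp ((hs.frame hp ht).frame hp ht') h'.1 (u := u) (v := v) hu (by simp)]
    exact h'.push
  have ft := (Cmd.frame hp.sound (Cmd.loop 1 pushCmd) rfl (t.setReg 0 u))
  rw [Cmd.eval_seq]
  set t1 := (Cmd.loop 1 pushCmd).eval p (t.setReg 0 u) with ht1
  have h0 : t1.reg 0 = u := by
    have := ft.reg 0 (by decide)
    simpa using this
  have h11' : t1.reg 11 = part p.n := by
    rw [ft.reg 11 (by decide), ht.reg 11 (by decide), h11]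
  have hAB : ∀ v : Fin p.n, (v ∈ A ∪ B ↔ (v : ℕ) < part p.n) := fun v => by
    subst hA hB
    simp only [State.sources, State.sinks, mem_union, mem_filter, mem_univ, true_and]
    omega
  classical
  have hrow' := h.row hrow
  have heq : ((Cmd.put 2 (.var 0) (.arr 2 (.var 0) +
      .ite (.and (.not (.lt (.var 0) (.var 11))) (.and (.arr 1 (.var 0))
        (.lt (.arr 2 (.var 0)) (.size + 1)))) 1 0)).eval p t1).preflow p =
      if (t1.preflow p).Active B u then (t1.preflow p).relabel u else t1.preflow p := by
    -- The program tests whether u is outside the first part instead of u ∉ B. This is equivalent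
    -- here, as sources already fail the label test.
    have hact : (t1.preflow p).Active B u ↔
        part p.n ≤ u ∧ t1.arr p 1 u ≠ 0 ∧ t1.arr p 2 u < p.n + 1 := by
      simp only [Preflow.Active, State.preflow]
      refine ⟨fun ⟨a1, a2, a3⟩ => ⟨?_, by omega, a3⟩, fun ⟨a1, a2, a3⟩ => ⟨fun hu => ?_, by omega,
        a3⟩⟩
      · by_contra hlt
        rcases mem_union.1 ((hAB u).2 (by omega)) with hu | hu
        · have : t1.arr p 2 u = p.n + 1 := hrow.1.source u hu
          omega
        · exact a1 hu
      · have := (hAB u).1 (mem_union_right _ hu)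
        omega
    have hc := hp.n_add_two_le
    simp only [hact, Cmd.eval_put, Expr.val_var, Expr.val_add, Expr.val_arr, Expr.val_ite,
      Expr.val_and_eq_zero, Expr.val_not_eq_zero, Expr.val_lt_eq_zero, Expr.val_size, Expr.val_one,
      Expr.val_zero, ne_eq, h0, h11']
    have hle : t1.arr p 2 u ≤ p.n + 1 := hrow.1.le u
    split_ifs with c1 c2 c2
    · omega
    · rw [add_zero, min_eq_left (by omega)]
      ext a b
      · simp [State.preflow]
      · simp [State.preflow]
      · simp only [State.preflow, State.arr_setArr, true_and]
        split_ifs with c3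
        · rw [c3]
        · rfl
    · rw [min_eq_left (by omega)]
      ext a b
      · simp [State.preflow, Preflow.relabel]
      · simp [State.preflow, Preflow.relabel]
      · simp only [State.preflow, Preflow.relabel, State.arr_setArr, true_and, Fin.val_inj]
        split_ifs with c3
        · rw [c3]
        · rfl
    · omega
  rw [heq]
  exact hrow'

/-- Enough sweeps to reach a final state. -/
def sweeps : Cmd := .nest 3 sweep 8

/-- The n^8 sweeps exceed the initial potential, at most 5 (n + 2)^4, as soon as n ≥ 3. For n < 3
the first part contains every vertex, so each one is a source or a sink and none is active. -/
theorem sweeps_spec (hp : p.Fits G) (hs : s.Good p G) (h11 : s.reg 11 = part p.n)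
    (hv : (s.preflow p).Valid G.arcWeight (s.sources p) (s.sinks p)) :
    ((sweeps.eval p s).preflow p).Valid G.arcWeight (s.sources p) (s.sinks p) ∧
      ∀ u, ¬ ((sweeps.eval p s).preflow p).Active (s.sinks p) u := by
  obtain ⟨A, hA⟩ : ∃ A, s.sources p = A := ⟨_, rfl⟩
  obtain ⟨B, hB⟩ : ∃ B, s.sinks p = B := ⟨_, rfl⟩
  rw [hA, hB] at hv ⊢
  have hlen := hp.n_add_two_le
  have key := Cmd.nest_induct (p := p) (x := 3) (P := sweep) (fun j t =>
    Frame p [0, 1, 3, 7] [0, 1, 2] s t ∧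
    Preflow.SweepsInv G.arcWeight A B (s.preflow p).potential j (t.preflow p))
    (fun i hi j t ht => ⟨ht.1.trans (.setReg (X := [3]) (K := []) (by decide) (by omega))
      (by decide) (by decide), ht.2⟩) ?_ 8 0 s ⟨.refl .., hv, Or.inr le_rfl⟩
  · obtain ⟨-, k1, k2⟩ := key
    change ((sweeps.eval p s).preflow p).Valid _ _ _ at k1
    change _ ∨ ((sweeps.eval p s).preflow p).potential + _ ≤ _ at k2
    refine ⟨k1, ?_⟩
    rcases k2 with k2 | k2
    · exact k2
    · intro u hu
      have hpart : p.n < 3 → (u : ℕ) < part p.n := by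
        have := u.2
        intro h
        unfold part
        omega
      by_cases hn : p.n < 3
      · have h3 : u ∈ A ∨ u ∈ B := by
          subst hA hB
          simp only [State.sources, State.sinks, mem_filter, mem_univ, true_and]
          have := hpart hn
          omega
        rcases h3 with h3 | h3
        · have := k1.source u h3
          have := hu.2.2
          have h4 : ((sweeps.eval p s).preflow p).d u < p.n + 1 := hu.2.2
          omega
        · exact hu.1 h3
      · have h1 := (s.preflow p).potential_le
        obtain ⟨m, hm⟩ : ∃ m, p.n = m + 3 := ⟨p.n - 3, by omega⟩
        have h2 : 5 * (p.n + 2) ^ 4 < p.n ^ 8 := by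
          rw [hm]
          calc 5 * (m + 3 + 2) ^ 4 < 81 * (m + 3) ^ 4 := by
                ring_nf; nlinarith [Nat.zero_le m, Nat.zero_le (m ^ 2), Nat.zero_le (m ^ 3),
                  Nat.zero_le (m ^ 4)]
            _ ≤ (m + 3) ^ 4 * (m + 3) ^ 4 := by
                refine Nat.mul_le_mul_right _ ?_
                calc 81 = 3 ^ 4 := by norm_num
                  _ ≤ _ := Nat.pow_le_pow_left (by omega) 4
            _ = _ := by ring
        omega
  · rintro j t ⟨ht, h⟩
    have hs' := sweep_spec hp (hs.frame hp ht) ((ht.reg 11 (by decide)).trans h11)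
    have e1 : t.sources p = A := by rw [← hA]; simp only [State.sources, ht.arr 3 (by decide)]
    have e2 : t.sinks p = B := by rw [← hB]; simp only [State.sinks, ht.arr 3 (by decide)]
    rw [e1, e2] at hs'
    exact ⟨ht.trans (Cmd.frame hp.sound sweep rfl t) (by decide) (by decide),
      h.sweep (hs' h.1)⟩

end RAM
namespace RAM

variable {p : Params} {G : WeightedDigraph p.n} {s t : State}

/-! #### Enumeration of the parts -/

/-- Distinct powers of two add up without carries. -/
theorem sum_two_pow_div_mod (T : Finset ℕ) (i : ℕ) :
    (∑ j ∈ T, 2 ^ j) / 2 ^ i % 2 = if i ∈ T then 1 else 0 := by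
  have h : i ∈ T ↔ (∑ j ∈ T, 2 ^ j) / 2 ^ i % 2 = 1 := by
    conv_lhs => rw [← toFinset_bitIndices_sum_two_pow T]
    rw [List.mem_toFinset, Nat.mem_bitIndices, Nat.testBit_eq_decide_div_mod_eq]
    simp
  split_ifs with hi
  · exact h.1 hi
  · have := mt h.2 hi
    omega

/-- The cut of the set of the vertices for which `a` is nonzero. -/
def Expr.cut (a : ℕ → Expr) : Expr :=
  .sum 20 (.sum 21 (.ite (.and (.not (a 20)) (a 21)) (.wt 20 21) 0))

theorem Expr.val_cut (hp : p.Fits G) (hs : s.Good p G) {a : ℕ → Expr} {S : Finset (Fin p.n)}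
    (ha : ∀ t x (v : Fin p.n), Frame p [20, 21] [] s t → t.reg x = v →
      ((a x).val p t = 0 ↔ v ∉ S)) : (Expr.cut a).val p s = setCut G.arcWeight S := by
  rw [setCut_eq_sum_ite]
  have hn := hp.n_add_two_le
  simp only [Expr.cut, Expr.val_sum, sum_range]
  refine sum_congr rfl fun u _ => sum_congr rfl fun v _ => ?_
  have ft : Frame p [20, 21] [] s ((s.setReg 20 u).setReg 21 v) :=
    (Frame.setReg (X := [20, 21]) (K := []) (by decide) (by omega)).trans
      (Frame.setReg (X := [21]) (K := []) (by decide) (by omega)) (by decide) (by decide)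
  simp only [Expr.val_ite, Expr.val_and_eq_zero, Expr.val_not_eq_zero, ne_eq,
    ha _ 20 u ft (by simp), ha _ 21 v ft (by simp), Expr.val_zero]
  rw [Expr.val_wt (by decide), ← hs.weight u v]
  by_cases h1 : u ∈ S <;> by_cases h2 : v ∈ S <;> simp [h1, h2]

/-- Nonzero if the label of the variable `x` is at most the variable 8. -/
def Expr.atMost (x : ℕ) : Expr := .not (.lt (.var 8) (.arr 2 (.var x)))

/-- Compares the level sets of the labels with the best set, which is in the array 4. -/
def thresholds : Cmd :=
  .loop 8 (.seq (.set 9 (.cut .atMost)) (.ite (.lt (.var 9) (.var 10))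
    (.seq (.set 10 (.var 9)) (fill 4 1 (.ite (.atMost 1) 1 0))) (.set 9 0)))

/-- The set in the array 4. -/
def State.best (p : Params) (s : State) : Finset (Fin p.n) := univ.filter fun v => s.arr p 4 v ≠ 0

/-- The set and its complement are not larger than the first part. -/
def Balanced {n : ℕ} (S : Finset (Fin n)) : Prop := n - part n ≤ S.card ∧ S.card ≤ part n

/-- The variable 10 is the cut of the best set. -/
def State.BestInv (p : Params) (G : WeightedDigraph p.n) (s : State) : Prop :=
  s.reg 10 < p.cap → s.reg 10 = setCut G.arcWeight (s.best p) ∧ Balanced (s.best p)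

theorem setCut_lt_cap (hp : p.Fits G) (S : Finset (Fin p.n)) :
    setCut G.arcWeight S < p.cap := by
  have := setCut_le_total G.arcWeight S
  have := hp.total_lt
  omega

/-- The gap in the labels is never located: all level sets are tried, one of which is a minimum cut
by `Valid.exists_min_cut`. This is safe because all of them are balanced. -/
theorem thresholds_spec (hp : p.Fits G) (hs : s.Good p G) (hb : s.BestInv p G)
    (hl : ∀ k < p.n, Balanced (univ.filter fun v : Fin p.n => s.arr p 2 v ≤ k)) :
    (thresholds.eval p s).BestInv p G ∧ (thresholds.eval p s).reg 10 ≤ s.reg 10 ∧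
      ∀ k < p.n, (thresholds.eval p s).reg 10 ≤
        setCut G.arcWeight (univ.filter fun v : Fin p.n => s.arr p 2 v ≤ k) := by
  refine Cmd.loop_induct hp.sound (fun i t => t.BestInv p G ∧ t.reg 10 ≤ s.reg 10 ∧
      ∀ k < i, t.reg 10 ≤ setCut G.arcWeight (univ.filter fun v : Fin p.n => s.arr p 2 v ≤ k))
    rfl ⟨hb, le_rfl, by simp⟩ ?_
  rintro i hi t ht ⟨h1, h2, h3⟩
  set S := univ.filter fun v : Fin p.n => s.arr p 2 v ≤ i with hS
  have hbelow : ∀ t' x (v : Fin p.n) X K, Frame p X K (t.setReg 8 i) t' → 8 ∉ X → 2 ∉ K →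
      t'.reg x = v → ((Expr.atMost x).val p t' = 0 ↔ v ∉ S) := by
    intro t' x v X K h' hX hK hx
    simp only [Expr.atMost, Expr.val_not_eq_zero, ne_eq, Expr.val_lt_eq_zero, Expr.val_var,
      Expr.val_arr, hx, h'.reg 8 hX, h'.arr 2 hK, ht.arr 2 (by decide), State.reg_setReg,
      if_true, hS, mem_filter, mem_univ, true_and]
  have hcut : (Expr.cut .atMost).val p (t.setReg 8 i) = setCut G.arcWeight S :=
    Expr.val_cut hp (hs.frame hp ht) fun t' x v h' hx =>
      hbelow t' x v _ _ h' (by decide) (by decide) hx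
  have hlt := setCut_lt_cap hp S
  simp only [Cmd.eval_seq, Cmd.eval_set, hcut, min_eq_left hlt.le]
  set t1 := (t.setReg 8 i).setReg 9 (setCut G.arcWeight S) with ht1
  have r9 : t1.reg 9 = setCut G.arcWeight S := by simp [ht1]
  have r10 : t1.reg 10 = t.reg 10 := by simp [ht1]
  rw [Cmd.eval_ite]
  split_ifs with hc
  · simp only [Expr.val_lt_eq_zero, Expr.val_var, r9, r10] at hc
    have hb' : ((Cmd.set 9 0).eval p t1).best p = t.best p := rfl
    have h10 : ((Cmd.set 9 0).eval p t1).reg 10 = t.reg 10 := by simp [r10]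
    refine ⟨?_, by omega, fun k hk => ?_⟩
    · unfold State.BestInv
      rw [hb', h10]
      exact h1
    · rw [h10]
      rcases Nat.lt_succ_iff_lt_or_eq.1 hk with hk | rfl
      · exact h3 k hk
      · exact hc
  · simp only [Expr.val_lt_eq_zero, Expr.val_var, r9, r10, not_le] at hc
    rw [Cmd.eval_seq]
    have e1 : (Cmd.set 10 (.var 9)).eval p t1 = t1.setReg 10 (setCut G.arcWeight S) := by
      rw [Cmd.eval_set, Expr.val_var, r9, min_eq_left hlt.le]
    rw [e1]
    set t2 := t1.setReg 10 (setCut G.arcWeight S) with ht2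
    have f2 : Frame p [9, 10] [] (t.setReg 8 i) t2 :=
      (Frame.setReg (X := [9, 10]) (K := []) (by decide) hlt.le).trans
        (Frame.setReg (X := [10]) (K := []) (by decide) hlt.le) (by decide) (by decide)
    have hf : Frame p [1] [4] t2 ((fill 4 1 (.ite (.atMost 1) 1 0)).eval p t2) :=
      Cmd.frame hp.sound (fill 4 1 (.ite (.atMost 1) 1 0)) rfl t2
    have h10 : ((fill 4 1 (.ite (.atMost 1) 1 0)).eval p t2).reg 10 = setCut G.arcWeight S := by
      rw [hf.reg 10 (by decide)]; simp [ht2]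
    have hbest : ((fill 4 1 (.ite (.atMost 1) 1 0)).eval p t2).best p = S := by
      have := fill_spec hp.sound (s := t2) (k := 4) (x := 1) (a := .ite (.atMost 1) 1 0)
        (fun v => if v ∈ S then 1 else 0) (fun v t' h' hx => by
          have ft : Frame p [1, 9, 10] [4] (t.setReg 8 i) t' :=
            (f2.mono (by decide) (by decide)).trans h' (by decide) (by decide)
          simp [hbelow t' 1 v _ _ ft (by decide) (by decide) hx]) fun v => by
          have := hp.n_add_two_le
          split_ifs <;> omega
      ext v
      simp only [State.best, mem_filter, mem_univ, true_and, this]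
      simp
    refine ⟨fun _ => ?_, by omega, fun k hk => ?_⟩
    · rw [h10, hbest]
      exact ⟨rfl, hl i hi⟩
    · rw [h10]
      rcases Nat.lt_succ_iff_lt_or_eq.1 hk with hk | rfl
      · exact hc.le.trans (h3 k hk)
      · exact le_rfl

/-- Improves the best set by the minimum cuts for the part that the variable 4 encodes. -/
def tryPart : Cmd :=
  .seq decode (.ite (.eq (.sum 20 (.arr 3 (.var 20))) (.var 12))
    (.seq initFlow (.seq sweeps thresholds)) (.set 9 0))

/-- The vertices of the first part. -/
def firstPart (n : ℕ) : Finset (Fin n) := univ.filter fun v => (v : ℕ) < part n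

theorem card_firstPart (n : ℕ) : (firstPart n).card = part n := by
  have := Fin.card_filter_val_lt (n := n) (m := part n)
  rw [firstPart, this, min_eq_right (part_le n)]

/-- Powers of two and sizes are in place. -/
structure State.Ready (p : Params) (G : WeightedDigraph p.n) (s : State) : Prop where
  good : s.Good p G
  pow : ∀ j < p.n, s.arr p 10 j = min (2 ^ j) p.cap
  part_eq : s.reg 11 = part p.n
  rest_eq : s.reg 12 = p.n - part p.n

theorem State.Ready.frame {X : List ℕ} {K : List (Fin 16)} (hs : s.Ready p G) (hp : p.Fits G)
    (h : Frame p X K s t) (h11 : 11 ∉ X) (h12 : 12 ∉ X) (h10 : 10 ∉ K) : t.Ready p G where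
  good := hs.good.frame hp h
  pow j hj := by rw [h.arr 10 h10, hs.pow j hj]
  part_eq := (h.reg 11 h11).trans hs.part_eq
  rest_eq := (h.reg 12 h12).trans hs.rest_eq

/-- The sets with the encoded trace on the first part are those that contain the sinks and avoid the
sources, so the best cut afterwards is at most the minimum over all of them. -/
theorem tryPart_spec (hp : p.Fits G) (hn : 0 < p.n) (hs : s.Ready p G) (h4 : s.reg 4 < p.big)
    (hb : s.BestInv p G) :
    (tryPart.eval p s).BestInv p G ∧ (tryPart.eval p s).reg 10 ≤ s.reg 10 ∧
      ∀ S : Finset (Fin p.n), (S ∩ firstPart p.n).card = p.n - part p.n →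
        (∀ v ∈ firstPart p.n, v ∈ S ↔ s.reg 4 / 2 ^ (v : ℕ) % 2 = 1) →
        (tryPart.eval p s).reg 10 ≤ setCut G.arcWeight S := by
  have hbits := decode_spec hp hs.pow h4
  have f1 : Frame p [5, 6] [3] s (decode.eval p s) :=
    (Cmd.frame hp.sound decode rfl s).mono (by decide) (by decide)
  simp only [tryPart, Cmd.eval_seq, Cmd.eval_ite]
  set s1 := decode.eval p s with hs1
  have r1 : s1.Ready p G := hs.frame hp f1 (by decide) (by decide) (by decide)
  have r10 : s1.reg 10 = s.reg 10 := f1.reg 10 (by decide)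
  have hb1 : s1.best p = s.best p := by simp only [State.best, f1.arr 4 (by decide)]
  have hpart : 2 * p.n ≤ 3 * part p.n := by unfold part; omega
  have hple := part_le p.n
  have hsum : (Expr.sum 20 (.arr 3 (.var 20))).val p s1 = (s1.sinks p).card := by
    simp only [Expr.val_sum, Expr.val_arr, Expr.val_var, State.reg_setReg, if_true,
      State.arr_setReg, sum_range, State.sinks, card_filter]
    refine sum_congr rfl fun v _ => ?_
    rw [hbits v v.2]
    by_cases hv : (v : ℕ) < part p.n
    · rcases Nat.mod_two_eq_zero_or_one (s.reg 4 / 2 ^ (v : ℕ)) with h | h <;> simp [h, hv]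
    -- The code is below 2^`part`, so bits beyond the first part vanish and the sum of all bits
    -- counts the sinks only.
    · have : s.reg 4 / 2 ^ (v : ℕ) = 0 := by
        refine Nat.div_eq_of_lt (h4.trans_le ?_)
        rw [hp.big_eq]
        exact Nat.pow_le_pow_right (by omega) (by unfold part at hv; omega)
      simp [this, hv]
  have hsets : ∀ S : Finset (Fin p.n),
      (∀ v ∈ firstPart p.n, v ∈ S ↔ s.reg 4 / 2 ^ (v : ℕ) % 2 = 1) →
      S ∩ firstPart p.n = s1.sinks p := fun S hS => by
    ext v
    simp only [mem_inter, State.sinks, mem_filter, mem_univ, true_and, hbits v v.2]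
    constructor
    · rintro ⟨h1, h2⟩
      have := (hS v h2).1 h1
      simp only [firstPart, mem_filter, mem_univ, true_and] at h2
      omega
    · rintro ⟨h1, h2⟩
      have h3 : v ∈ firstPart p.n := by simpa [firstPart] using h1
      exact ⟨(hS v h3).2 (by omega), h3⟩
  split_ifs with hc
  · simp only [Expr.val_eq_eq_zero, hsum, Expr.val_var, r1.rest_eq] at hc
    have e1 : ((Cmd.set 9 0).eval p s1).best p = s.best p := hb1
    have e2 : ((Cmd.set 9 0).eval p s1).reg 10 = s.reg 10 := by simp [r10]
    refine ⟨?_, e2.le, fun S hS hS' => ?_⟩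
    · unfold State.BestInv
      rw [e1, e2]
      exact hb
    · rw [hsets S hS'] at hS
      exact absurd hS hc
  · simp only [Expr.val_eq_eq_zero, hsum, Expr.val_var, r1.rest_eq, ne_eq, not_not] at hc
    -- the preflow
    have f2 : Frame p [0, 1] [0, 1, 2] s1 (initFlow.eval p s1) :=
      (Cmd.frame hp.sound initFlow rfl s1).mono (by decide) (by decide)
    have h2 := initFlow_spec hp r1.good r1.part_eq
    set s2 := initFlow.eval p s1 with hs2
    have r2 := r1.frame hp f2 (by decide) (by decide) (by decide)
    have eA : s2.sources p = s1.sources p := by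
      simp only [State.sources, f2.arr 3 (by decide)]
    have eB : s2.sinks p = s1.sinks p := by
      simp only [State.sinks, f2.arr 3 (by decide)]
    have hdisj : Disjoint (s1.sources p) (s1.sinks p) := by
      rw [disjoint_left]
      intro v hv hv'
      simp only [State.sources, State.sinks, mem_filter, mem_univ, true_and] at hv hv'
      omega
    have hunion : s1.sources p ∪ s1.sinks p = firstPart p.n := by
      ext v
      simp only [State.sources, State.sinks, firstPart, mem_union, mem_filter, mem_univ, true_and]
      omega
    have hv2 : (s2.preflow p).Valid G.arcWeight (s2.sources p) (s2.sinks p) := by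
      rw [h2, eA, eB]
      exact Preflow.start_valid _ hdisj
    have f3 : Frame p [0, 1, 3, 7] [0, 1, 2] s2 (sweeps.eval p s2) :=
      (Cmd.frame hp.sound sweeps rfl s2).mono (by decide) (by decide)
    obtain ⟨hv3, hact⟩ := sweeps_spec hp r2.good r2.part_eq hv2
    set s3 := sweeps.eval p s2 with hs3
    rw [eA, eB] at hv3
    rw [eB] at hact
    have r3 := r2.frame hp f3 (by decide) (by decide) (by decide)
    have e10 : s3.reg 10 = s.reg 10 := by
      rw [f3.reg 10 (by decide), f2.reg 10 (by decide), r10]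
    have ebest : s3.best p = s.best p := by
      rw [← hb1]
      simp only [State.best, f3.arr 4 (by decide), f2.arr 4 (by decide)]
    have hb3 : s3.BestInv p G := by
      unfold State.BestInv
      rw [e10, ebest]
      exact hb
    have hcard := card_union_of_disjoint hdisj
    rw [hunion, card_firstPart] at hcard
    -- A level set contains the n - m sinks and misses the 2m - n sources, so it has at most 2n - 2m
    -- ≤ m elements, where m = `part p.n`.
    have hl : ∀ k < p.n, Balanced (univ.filter fun v : Fin p.n => s3.arr p 2 v ≤ k) := by
      intro k hk
      constructor
      · rw [← hc]
        refine card_le_card fun v hv => ?_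
        have := hv3.sink v hv
        simp only [State.preflow_d] at this
        simp [this]
      · have hd : Disjoint (s1.sources p) (univ.filter fun v : Fin p.n => s3.arr p 2 v ≤ k) := by
          rw [disjoint_left]
          intro v hv hv'
          have := hv3.source v hv
          simp only [State.preflow_d] at this
          simp only [mem_filter, mem_univ, true_and] at hv'
          omega
        have h := (card_union_of_disjoint hd).symm.le.trans (card_le_univ _)
        rw [Fintype.card_fin] at h
        omega
    obtain ⟨t1, t2, t3⟩ := thresholds_spec hp r3.good hb3 hl
    refine ⟨t1, t2.trans e10.le, fun S _ hS => ?_⟩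
    have hne : (s1.sources p ∪ s1.sinks p).Nonempty := by
      rw [hunion, ← card_pos, card_firstPart]
      omega
    obtain ⟨k, hk, hmin⟩ := hv3.exists_min_cut hact hne
    refine (t3 k hk).trans (hmin S ?_ ?_)
    · rw [disjoint_left]
      intro v hv hv'
      have h1 : v ∈ S ∩ firstPart p.n :=
        mem_inter.2 ⟨hv', hunion ▸ mem_union_left _ hv⟩
      rw [hsets S hS] at h1
      exact disjoint_left.1 hdisj hv h1
    · rw [← hsets S hS]
      exact inter_subset_left

/-- Finds a balanced set with a small cut. -/
def findSet : Cmd := .seq (.set 10 .cap) (.longLoop 4 tryPart)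

/-- The cap plays the role of infinity: it exceeds every cut, so a best value below it comes from a
set that was really found, and a prefix of an optimal ordering forces this to happen. -/
theorem findSet_spec (hp : p.Fits G) (hn : 0 < p.n) (hs : s.Ready p G) :
    Balanced ((findSet.eval p s).best p) ∧
      setCut G.arcWeight ((findSet.eval p s).best p) ≤ G.cutwidth := by
  have hcap : p.n ≤ p.cap := hp.sound.n_le
  have e1 : (Cmd.set 10 .cap).eval p s = s.setReg 10 p.cap := by simp
  rw [findSet, Cmd.eval_seq, e1]
  set s1 := s.setReg 10 p.cap with hs1
  have r1 : s1.Ready p G := hs.frame hp (Frame.setReg (X := [10]) (K := []) (by decide) le_rfl)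
    (by decide) (by decide) (by decide)
  have key := Cmd.longLoop_induct hp.sound (x := 4) (P := tryPart) (s := s1)
    (fun i t => t.BestInv p G ∧ ∀ S : Finset (Fin p.n),
      (S ∩ firstPart p.n).card = p.n - part p.n → ∀ m < i,
        (∀ v ∈ firstPart p.n, v ∈ S ↔ m / 2 ^ (v : ℕ) % 2 = 1) →
        t.reg 10 ≤ setCut G.arcWeight S) rfl
    ⟨fun h => absurd h (by simp [hs1]), by simp⟩ ?_
  · set s2 := (Cmd.longLoop 4 tryPart).eval p s1 with hs2
    obtain ⟨h1, h2⟩ := key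
    have hpart : 2 * p.n ≤ 3 * part p.n := by unfold part; omega
    obtain ⟨S, hS, hcard⟩ := G.exists_setCut_le_cutwidth (firstPart p.n)
      (m := p.n - part p.n) (by rw [card_firstPart]; omega)
    have h3 : s2.reg 10 ≤ setCut G.arcWeight S := by
      -- The iteration that matters is the one whose code is the trace of S.
      refine h2 S hcard (∑ j ∈ (S ∩ firstPart p.n).image Fin.val, 2 ^ j) ?_ ?_
      · rw [hp.big_eq]
        refine Nat.geomSum_lt le_rfl fun k hk => ?_
        obtain ⟨v, hv, rfl⟩ := mem_image.1 hk
        exact (mem_filter.1 (mem_inter.1 hv).2).2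
      · intro v hv
        rw [sum_two_pow_div_mod]
        simp only [mem_image, mem_inter, Fin.val_inj, exists_eq_right, hv, and_true]
        simp
    obtain ⟨h4, h5⟩ := h1 (h3.trans_lt (setCut_lt_cap hp S))
    exact ⟨h5, h4 ▸ h3.trans hS⟩
  · rintro i hi t ht ⟨h1, h2⟩
    have hr := r1.frame hp ht (by decide) (by decide) (by decide)
    obtain ⟨t1, t2, t3⟩ := tryPart_spec hp hn hr (by simpa using hi) h1
    refine ⟨t1, fun S hS m hm hv => ?_⟩
    rcases Nat.lt_succ_iff_lt_or_eq.1 hm with hm | rfl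
    · exact t2.trans (h2 S hS m hm hv)
    · exact t3 S hS (by simpa using hv)

end RAM

/-! ### Encoding of subsets and dynamic programming tables -/

section Table

variable {n : ℕ}

/-- The number of elements of `F` before `v`. -/
def rankIn (F : Finset (Fin n)) (v : Fin n) : ℕ := (F.filter fun u => u < v).card

theorem rankIn_lt {F : Finset (Fin n)} {v : Fin n} (hv : v ∈ F) : rankIn F v < F.card :=
  card_lt_card (filter_ssubset.2 ⟨v, hv, lt_irrefl v⟩)

theorem rankIn_lt_rankIn {F : Finset (Fin n)} {u v : Fin n} (hu : u ∈ F) (h : u < v) :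
    rankIn F u < rankIn F v := by
  refine card_lt_card (Finset.ssubset_iff_subset_ne.2 ⟨fun x hx => ?_, fun he => ?_⟩)
  · rw [mem_filter] at hx ⊢
    exact ⟨hx.1, hx.2.trans h⟩
  · have : u ∈ F.filter fun x => x < u := he ▸ mem_filter.2 ⟨hu, h⟩
    exact lt_irrefl u (mem_filter.1 this).2

theorem rankIn_injOn (F : Finset (Fin n)) : Set.InjOn (rankIn F) F := fun u hu v hv h => by
  rcases lt_trichotomy u v with h' | h' | h'
  · exact absurd h (rankIn_lt_rankIn hu h').ne
  · exact h'
  · exact absurd h (rankIn_lt_rankIn hv h').ne'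

/-- The code of a subset `Y` of `F`. -/
def maskOf (F Y : Finset (Fin n)) : ℕ := ∑ v ∈ Y, 2 ^ rankIn F v

variable {F Y : Finset (Fin n)}

theorem maskOf_eq_sum_image (hY : Y ⊆ F) : maskOf F Y = ∑ j ∈ Y.image (rankIn F), 2 ^ j := by
  rw [sum_image ((rankIn_injOn F).mono hY)]
  rfl

theorem maskOf_bit (hY : Y ⊆ F) {v : Fin n} (hv : v ∈ F) :
    maskOf F Y / 2 ^ rankIn F v % 2 = if v ∈ Y then 1 else 0 := by
  rw [maskOf_eq_sum_image hY, RAM.sum_two_pow_div_mod]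
  congr 1
  simp only [mem_image, eq_iff_iff]
  exact ⟨fun ⟨u, hu, h⟩ => rankIn_injOn F (hY hu) hv h ▸ hu, fun h => ⟨v, h, rfl⟩⟩

theorem maskOf_lt (hY : Y ⊆ F) : maskOf F Y < 2 ^ F.card := by
  rw [maskOf_eq_sum_image hY]
  refine Nat.geomSum_lt le_rfl fun k hk => ?_
  obtain ⟨v, hv, rfl⟩ := mem_image.1 hk
  exact rankIn_lt (hY hv)

/-- Removing an element clears one bit. Predecessors therefore have smaller codes, and filling the
table by increasing code respects the recursion. -/
theorem maskOf_erase {v : Fin n} (hv : v ∈ Y) :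
    maskOf F (Y.erase v) = maskOf F Y - 2 ^ rankIn F v := by
  rw [maskOf, maskOf, ← add_sum_erase Y _ hv, Nat.add_sub_cancel_left]

theorem two_pow_le_maskOf {v : Fin n} (hv : v ∈ Y) : 2 ^ rankIn F v ≤ maskOf F Y :=
  single_le_sum (f := fun v => 2 ^ rankIn F v) (fun _ _ => Nat.zero_le _) hv

theorem maskOf_eq_zero : maskOf F Y = 0 ↔ Y = ∅ := by
  refine ⟨fun h => ?_, by rintro rfl; rfl⟩
  by_contra hne
  obtain ⟨v, hv⟩ := nonempty_iff_ne_empty.2 hne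
  have := two_pow_le_maskOf (F := F) hv
  have := Nat.two_pow_pos (rankIn F v)
  omega

/-- The entry of the table `T` at the nonempty subset `Y` of `F` is consistent with the entries at
its predecessors: it is the least possible maximum cut along a chain from `base` to `base ∪ Y`. -/
def TableEntry (w : Fin n → Fin n → ℕ) (base F : Finset (Fin n)) (T : ℕ → ℕ)
    (Y : Finset (Fin n)) : Prop :=
  setCut w (base ∪ Y) ≤ T (maskOf F Y) ∧
    (∃ v ∈ Y, T (maskOf F (Y.erase v)) ≤ T (maskOf F Y)) ∧
    ∀ v ∈ Y, T (maskOf F Y) ≤ max (setCut w (base ∪ Y)) (T (maskOf F (Y.erase v)))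

/-- The table `T` is correct below `i`. -/
def Table (w : Fin n → Fin n → ℕ) (base F : Finset (Fin n)) (T : ℕ → ℕ) (i : ℕ) : Prop :=
  (0 < i → T 0 = 0) ∧
    ∀ Y ⊆ F, Y.Nonempty → maskOf F Y < i → TableEntry w base F T Y

variable {w : Fin n → Fin n → ℕ} {base : Finset (Fin n)} {T T' : ℕ → ℕ} {i : ℕ}

theorem TableEntry.congr (h : TableEntry w base F T Y)
    (hT : ∀ m ≤ maskOf F Y, T' m = T m) : TableEntry w base F T' Y := by
  have h' : ∀ v ∈ Y, T' (maskOf F (Y.erase v)) = T (maskOf F (Y.erase v)) := fun v hv => by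
    rw [hT]
    rw [maskOf_erase hv]
    exact Nat.sub_le _ _
  obtain ⟨h1, ⟨v, hv, h2⟩, h3⟩ := h
  refine ⟨by rwa [hT _ le_rfl], ⟨v, hv, by rwa [hT _ le_rfl, h' v hv]⟩, fun v hv => ?_⟩
  rw [hT _ le_rfl, h' v hv]
  exact h3 v hv

/-- The prefixes of π cut down to F form a competing chain. A position either adds one vertex of F,
and the upper bound in `TableEntry` is a maximum of two numbers at most W, or adds none. -/
theorem Table.le_of_chain (hT : Table w base F T i) (hi : maskOf F F < i) {W : ℕ}
    (π : VertexOrdering n) (hW : ∀ j, setCut w (base ∪ (F ∩ prefixSet π j)) ≤ W) :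
    T (maskOf F F) ≤ W := by
  have hmono : ∀ Y ⊆ F, maskOf F Y ≤ maskOf F F := fun Y hY => sum_le_sum_of_subset hY
  have key : ∀ j ≤ n, T (maskOf F (F ∩ prefixSet π j)) ≤ W := by
    intro j
    induction j with
    | zero =>
      intro _
      have : F ∩ prefixSet π 0 = ∅ := by ext; simp
      rw [this, maskOf_eq_zero.2 rfl, hT.1 (by omega)]
      exact Nat.zero_le _
    | succ j ih =>
      intro hj
      have ih := ih (by omega)
      set v := π.symm ⟨j, hj⟩ with hv
      have hπv : (π v : ℕ) = j := by simp [hv]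
      have hstep : ∀ u, (π u : ℕ) < j + 1 ↔ (π u : ℕ) < j ∨ u = v := fun u => by
        rw [Nat.lt_succ_iff_lt_or_eq]
        refine or_congr_right ⟨fun h => ?_, fun h => h ▸ hπv⟩
        rw [hv, Equiv.eq_symm_apply]
        exact Fin.ext h
      by_cases hvF : v ∈ F
      · have hvY : v ∈ F ∩ prefixSet π (j + 1) := by simp [hvF, hπv]
        have he : (F ∩ prefixSet π (j + 1)).erase v = F ∩ prefixSet π j := by
          ext u
          simp only [mem_erase, mem_inter, mem_prefixSet, hstep]
          constructor
          · rintro ⟨h1, h2, h3 | h3⟩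
            · exact ⟨h2, h3⟩
            · exact absurd h3 h1
          · rintro ⟨h1, h2⟩
            exact ⟨by rintro rfl; omega, h1, Or.inl h2⟩
        have h := (hT.2 _ inter_subset_left ⟨v, hvY⟩
          ((hmono _ inter_subset_left).trans_lt hi)).2.2 v hvY
        rw [he] at h
        exact h.trans (max_le (hW _) ih)
      · have he : F ∩ prefixSet π (j + 1) = F ∩ prefixSet π j := by
          ext u
          simp only [mem_inter, mem_prefixSet, hstep]
          constructor
          · rintro ⟨h2, h3 | rfl⟩
            · exact ⟨h2, h3⟩
            · exact absurd h2 hvF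
          · rintro ⟨h1, h2⟩
            exact ⟨h1, Or.inl h2⟩
        rwa [he]
  have h := key n le_rfl
  have he : F ∩ prefixSet π n = F := by ext u; simp
  rwa [he] at h

/-! ### Orderings filled from the last position backwards -/

/-- The positions `o` of the vertices outside `Q` are the last ones, and the cuts there are at
most `W`. -/
structure Placed (w : Fin n → Fin n → ℕ) (W : ℕ) (Q : Finset (Fin n)) (o : Fin n → ℕ) : Prop where
  le : ∀ v, v ∉ Q → Q.card ≤ o v
  lt : ∀ v, v ∉ Q → o v < n
  inj : ∀ u v, u ∉ Q → v ∉ Q → o u = o v → u = v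
  cut : ∀ i, Q.card < i → i < n → setCut w (Q ∪ univ.filter fun v => v ∉ Q ∧ o v < i) ≤ W

theorem placed_univ (w : Fin n → Fin n → ℕ) (W : ℕ) (o : Fin n → ℕ) : Placed w W univ o where
  le v hv := absurd (mem_univ v) hv
  lt v hv := absurd (mem_univ v) hv
  inj u v hu := absurd (mem_univ u) hu
  cut i h h' := by rw [card_univ, Fintype.card_fin] at h; omega

/-- The vertex v gets the last free position |Q| - 1. The only new cut is the one just after v, at
position |Q|, and there the earlier vertices are exactly those of Q. -/
theorem Placed.erase {W : ℕ} {Q : Finset (Fin n)} {o o' : Fin n → ℕ} (h : Placed w W Q o)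
    {v : Fin n} (hv : v ∈ Q) (hW : setCut w Q ≤ W) (ho : ∀ u, u ≠ v → o' u = o u)
    (hov : o' v = Q.card - 1) : Placed w W (Q.erase v) o' := by
  have hcard : (Q.erase v).card = Q.card - 1 := card_erase_of_mem hv
  have hpos : 0 < Q.card := card_pos.2 ⟨v, hv⟩
  have hn : Q.card ≤ n := by simpa using card_le_univ Q
  have hmem : ∀ u, u ∉ Q.erase v ↔ u = v ∨ u ∉ Q := fun u => by
    rw [mem_erase]; tauto
  refine ⟨fun u hu => ?_, fun u hu => ?_, fun a b ha hb hab => ?_, fun i h1 h2 => ?_⟩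
  · rcases (hmem u).1 hu with rfl | hu'
    · omega
    · have := h.le u hu'
      rw [ho u (by rintro rfl; exact hu' hv)]
      omega
  · rcases (hmem u).1 hu with rfl | hu'
    · omega
    · have := h.lt u hu'
      rw [ho u (by rintro rfl; exact hu' hv)]
      omega
  · by_cases ca : a = v <;> by_cases cb : b = v
    · rw [ca, cb]
    · have hb' : b ∉ Q := ((hmem b).1 hb).resolve_left cb
      have := h.le b hb'
      rw [ca, hov, ho b cb] at hab
      omega
    · have ha' : a ∉ Q := ((hmem a).1 ha).resolve_left ca
      have := h.le a ha'
      rw [cb, hov, ho a ca] at hab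
      omega
    · rw [ho a ca, ho b cb] at hab
      exact h.inj a b (((hmem a).1 ha).resolve_left ca) (((hmem b).1 hb).resolve_left cb) hab
  · have he : Q.erase v ∪ (univ.filter fun u => u ∉ Q.erase v ∧ o' u < i) =
        Q ∪ univ.filter fun u => u ∉ Q ∧ o u < i := by
      ext u
      simp only [mem_union, mem_filter, mem_univ, true_and, hmem]
      by_cases cu : u = v
      · subst cu
        simp [hv, hov]
        omega
      · simp [cu, ho u cu]
    rw [he]
    rcases Nat.lt_or_ge Q.card i with h3 | h3
    · exact h.cut i h3 h2
    · have : (univ.filter fun u => u ∉ Q ∧ o u < i) = ∅ := by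
        refine filter_eq_empty_iff.2 fun u _ hu => ?_
        have := h.le u hu.1
        omega
      rwa [this, union_empty]

/-- With nothing left to place, the positions form an injective self-map of `Fin n`, hence a
bijection, whose prefixes are the sets in the field `cut`. -/
theorem Placed.exists_ordering {W : ℕ} {o : Fin n → ℕ} {G : WeightedDigraph n}
    (h : Placed G.arcWeight W ∅ o) :
    ∃ π : VertexOrdering n, (∀ v, (π v : ℕ) = o v) ∧ G.orderingWidth π ≤ W := by
  let f : Fin n → Fin n := fun v => ⟨o v, h.lt v (notMem_empty v)⟩
  have hf : Function.Injective f := fun u v huv =>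
    h.inj u v (notMem_empty u) (notMem_empty v) (Fin.mk.inj_iff.1 huv)
  refine ⟨Equiv.ofBijective f (Finite.injective_iff_bijective.1 hf), fun v => rfl,
    G.orderingWidth_le fun i h1 h2 => ?_⟩
  convert h.cut i (by rw [card_empty]; omega) h2 using 2
  ext v
  simp [f]

end Table

namespace RAM

variable {p : Params} {G : WeightedDigraph p.n} {s t : State}

/-! #### Optimal orderings of the parts -/

/-- Marks the free vertices in the array 5 and writes their ranks to the array 6. -/
def layout : Cmd :=
  .seq (fill 5 0 (.ite (.var 13) (.ite (.arr 4 (.var 0)) 0 1) (.ite (.arr 4 (.var 0)) 1 0)))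
    (fill 6 0 (.sum 20 (.ite (.and (.lt (.var 20) (.var 0)) (.arr 5 (.var 20))) 1 0)))

/-- The free vertices are `F`, and the variable 13 tells whether the others are in the base. -/
structure State.Layout (p : Params) (F base : Finset (Fin p.n)) (s : State) : Prop where
  free : ∀ v : Fin p.n, s.arr p 5 v = if v ∈ F then 1 else 0
  rank : ∀ v : Fin p.n, s.arr p 6 v = rankIn F v
  base_eq : base = if s.reg 13 = 0 then ∅ else Fᶜ

theorem State.Layout.frame {F base : Finset (Fin p.n)} {X : List ℕ} {K : List (Fin 16)}
    (hs : s.Layout p F base) (h : Frame p X K s t) (h13 : 13 ∉ X) (h5 : 5 ∉ K) (h6 : 6 ∉ K) :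
    t.Layout p F base where
  free v := by rw [h.arr 5 h5, hs.free]
  rank v := by rw [h.arr 6 h6, hs.rank]
  base_eq := by rw [h.reg 13 h13]; exact hs.base_eq

theorem layout_spec (hp : p.Fits G) {F base : Finset (Fin p.n)}
    (hF : F = if s.reg 13 = 0 then s.best p else (s.best p)ᶜ)
    (hbase : base = if s.reg 13 = 0 then ∅ else Fᶜ) : (layout.eval p s).Layout p F base := by
  have hn := hp.n_add_two_le
  rw [layout, Cmd.eval_seq]
  have f1 := Cmd.frame hp.sound (fill 5 0 (.ite (.var 13) (.ite (.arr 4 (.var 0)) 0 1)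
    (.ite (.arr 4 (.var 0)) 1 0))) rfl s
  have e1 : ∀ v : Fin p.n, ((fill 5 0 (.ite (.var 13) (.ite (.arr 4 (.var 0)) 0 1)
      (.ite (.arr 4 (.var 0)) 1 0))).eval p s).arr p 5 v = if v ∈ F then 1 else 0 := by
    refine fill_spec hp.sound (fun v => if v ∈ F then 1 else 0) (fun v t ht hv => ?_) fun v => ?_
    · simp only [Expr.val_ite, Expr.val_var, Expr.val_arr, ht.reg 13 (by decide),
        ht.arr 4 (by decide), hv, Expr.val_zero, Expr.val_one, hF]
      by_cases c : s.reg 13 = 0 <;> by_cases c' : s.arr p 4 v = 0 <;> simp [c, c', State.best]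
    · split_ifs <;> omega
  set s1 := (fill 5 0 (.ite (.var 13) (.ite (.arr 4 (.var 0)) 0 1)
    (.ite (.arr 4 (.var 0)) 1 0))).eval p s with hs1
  have f2 := Cmd.frame hp.sound (fill 6 0 (.sum 20 (.ite (.and (.lt (.var 20) (.var 0))
    (.arr 5 (.var 20))) 1 0))) rfl s1
  refine ⟨fun v => by rw [f2.arr 5 (by decide), e1], ?_, ?_⟩
  · refine fill_spec hp.sound _ (fun v t ht hv => ?_) fun v => ?_
    · simp only [Expr.val_sum, sum_range, Expr.val_ite, Expr.val_and_eq_zero, Expr.val_lt_eq_zero,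
        Expr.val_var, State.reg_setReg, Expr.val_arr, State.arr_setReg, ht.arr 5 (by decide),
        if_true, show (0 : ℕ) ≠ 20 by decide, if_false, e1, Expr.val_zero, Expr.val_one, rankIn, card_filter]
      rw [← sum_filter_add_sum_filter_not univ (fun u => u ∈ F), add_comm, sum_eq_zero, zero_add]
      · rw [filter_mem_eq_inter, univ_inter]
        refine sum_congr rfl fun u hu => ?_
        simp only [hu, hv, if_true]
        by_cases c : u < v
        · have : ¬ (v : ℕ) ≤ u := by have := Fin.lt_def.1 c; omega
          simp [c, this]
        · have : (v : ℕ) ≤ u := by have := mt Fin.lt_def.2 c; omega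
          simp [c, this]
      · intro u hu
        simp [(mem_filter.1 hu).2]
    · have := card_le_univ (F.filter fun u => u < v)
      rw [Fintype.card_fin] at this
      unfold rankIn
      omega
  · rw [f2.reg 13 (by decide), f1.reg 13 (by decide)]
    exact hbase

/-- Writes the set that the variable 4 encodes, together with the base, to the array 7. -/
def decodeSet : Cmd :=
  .seq decode (fill 7 0 (.ite (.arr 5 (.var 0)) (.arr 3 (.arr 6 (.var 0))) (.var 13)))

theorem maskOf_lt_big (hp : p.Fits G) {F Y : Finset (Fin p.n)} (hF : F.card ≤ part p.n)
    (hY : Y ⊆ F) : maskOf F Y < p.big := by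
  rw [hp.big_eq]
  exact (maskOf_lt hY).trans_le (Nat.pow_le_pow_right (by omega) hF)

theorem decodeSet_spec (hp : p.Fits G) (hs : s.Ready p G) {F base Y : Finset (Fin p.n)}
    (hl : s.Layout p F base) (hF : F.card ≤ part p.n) (hY : Y ⊆ F) (h4 : s.reg 4 = maskOf F Y)
    (hb : s.reg 13 ≤ 1) (v : Fin p.n) :
    (decodeSet.eval p s).arr p 7 v = if v ∈ base ∪ Y then 1 else 0 := by
  have hn := hp.n_add_two_le
  have h4' : s.reg 4 < p.big := h4 ▸ maskOf_lt_big hp hF hY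
  have hbits := decode_spec hp hs.pow h4'
  have f1 := Cmd.frame hp.sound decode rfl s
  rw [decodeSet, Cmd.eval_seq]
  refine fill_spec hp.sound (fun v => if v ∈ base ∪ Y then 1 else 0) (fun v t ht hv => ?_)
    (fun v => by split_ifs <;> omega) v
  have l1 := (hl.frame f1 (by decide) (by decide) (by decide)).frame ht (by decide) (by decide)
    (by decide)
  have r13 : t.reg 13 = s.reg 13 := by rw [ht.reg 13 (by decide), f1.reg 13 (by decide)]
  have hbase := hl.base_eq
  simp only [Expr.val_ite, Expr.val_arr, Expr.val_var, hv, l1.free, l1.rank,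
    ht.arr 3 (by decide), r13]
  by_cases hvF : v ∈ F
  · have hr : rankIn F v < p.n := (rankIn_lt hvF).trans_le (hF.trans (part_le _))
    have hnb : v ∉ base := by
      rw [hbase]; split_ifs <;> simp [hvF]
    rw [hbits _ hr, h4, maskOf_bit hY hvF]
    simp [hvF, hnb]
  · have hvY : v ∉ Y := fun h => hvF (hY h)
    by_cases c : s.reg 13 = 0
    · simp [hvF, hvY, hbase, c]
    · have : s.reg 13 = 1 := by omega
      simp [hvF, hvY, hbase, this]

/-- Computes the entry of the table in the array 8 for the variable 4. -/
def tableStep : Cmd :=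
  .seq decodeSet (.seq (.set 9 (.cut fun x => .arr 7 (.var x))) (.seq (.set 16 .cap)
    (.seq (.loop 1 (.set 16 (.ite (.and (.arr 5 (.var 1)) (.arr 7 (.var 1)))
      (.min (.var 16) (.arr 8 (.var 4 - .arr 10 (.arr 6 (.var 1))))) (.var 16))))
      (.put 8 (.var 4) (.ite (.var 4) (.max (.var 9) (.var 16)) 0)))))

/-- The address of the predecessor in the table. -/
theorem predecessor_eq (hp : p.Fits G) (hs : s.Ready p G) {F base Y : Finset (Fin p.n)}
    (hl : s.Layout p F base) (hF : F.card ≤ part p.n) (hY : Y ⊆ F) (h4 : s.reg 4 = maskOf F Y)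
    {v : Fin p.n} (hv : v ∈ Y) {x : ℕ} (hx : s.reg x = v) :
    (Expr.var 4 - .arr 10 (.arr 6 (.var x))).val p s = maskOf F (Y.erase v) := by
  have hr : rankIn F v < p.n := (rankIn_lt (hY hv)).trans_le (hF.trans (part_le _))
  have hle : 2 ^ rankIn F v ≤ p.cap :=
    (two_pow_le_maskOf hv).trans ((maskOf_lt_big hp hF hY).le.trans hp.big_le)
  simp only [Expr.val_sub, Expr.val_var, Expr.val_arr, hx, hl.rank, hs.pow _ hr, h4,
    min_eq_left hle]
  exact (maskOf_erase hv).symm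

/-- The new entry is the maximum of cut(base ∪ Y) and the minimum over the predecessors of Y.
Entries at smaller codes are untouched. Numbers below `big` that encode no subset of F receive
meaningless entries, about which `Table` says nothing. -/
theorem tableStep_spec (hp : p.Fits G) (hs : s.Ready p G) {F base : Finset (Fin p.n)}
    (hl : s.Layout p F base) (hF : F.card ≤ part p.n) (hb : s.reg 13 ≤ 1)
    (hT : Table G.arcWeight base F (s.arr p 8) (s.reg 4)) :
    Table G.arcWeight base F ((tableStep.eval p s).arr p 8) (s.reg 4 + 1) := by
  have hn := hp.n_add_two_le
  obtain ⟨m, hm⟩ : ∃ m, s.reg 4 = m := ⟨_, rfl⟩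
  rw [hm] at hT ⊢
  simp only [tableStep, Cmd.eval_seq]
  have f1 : Frame p [5, 6, 0] [3, 7] s (decodeSet.eval p s) :=
    (Cmd.frame hp.sound decodeSet rfl s).mono (by decide) (by decide)
  set s1 := decodeSet.eval p s with hs1
  set s2 := (Cmd.set 9 (.cut fun x => .arr 7 (.var x))).eval p s1 with hs2
  have f2 : Frame p [9] [] s1 s2 := Cmd.frame hp.sound (.set 9 (.cut fun x => .arr 7 (.var x))) rfl s1
  set s3 := (Cmd.set 16 .cap).eval p s2 with hs3
  have f3 : Frame p [16] [] s2 s3 := Cmd.frame hp.sound (.set 16 .cap) rfl s2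
  have f13 : Frame p [5, 6, 0, 9, 16] [3, 7] s s3 :=
    ((f1.mono (by decide) (by decide)).trans f2 (by decide) (by decide)).trans f3
      (by decide) (by decide)
  set L : Cmd := .loop 1 (.set 16 (.ite (.and (.arr 5 (.var 1)) (.arr 7 (.var 1)))
      (.min (.var 16) (.arr 8 (.var 4 - .arr 10 (.arr 6 (.var 1))))) (.var 16))) with hL
  have f4 : Frame p [1, 16] [] s3 (L.eval p s3) := Cmd.frame hp.sound L rfl s3
  have f14 : Frame p [5, 6, 0, 9, 16, 1] [3, 7] s (L.eval p s3) :=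
    (f13.mono (by decide) (by decide)).trans f4 (by decide) (by decide)
  have h4 : (L.eval p s3).reg 4 = m := by rw [f14.reg 4 (by decide), hm]
  have hT8 : (L.eval p s3).arr p 8 = s.arr p 8 := f14.arr 8 (by decide)
  -- the new table
  have hT' : ∀ x, ((Cmd.put 8 (.var 4) (.ite (.var 4) (.max (.var 9) (.var 16)) 0)).eval p
      (L.eval p s3)).arr p 8 x = if x = m then
        (if m = 0 then 0 else min (max ((L.eval p s3).reg 9) ((L.eval p s3).reg 16)) p.cap)
      else s.arr p 8 x := by
    intro x
    simp only [Cmd.eval_put, Expr.val_var, h4, State.arr_setArr, true_and, Expr.val_ite,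
      Expr.val_max, Expr.val_zero, hT8]
    split_ifs <;> simp
  refine ⟨fun _ => ?_, fun Y hY hne hYm => ?_⟩
  · rw [hT']
    split_ifs with c
    · rfl
    · omega
    · exact hT.1 (by omega)
  rcases Nat.lt_succ_iff_lt_or_eq.1 hYm with hlt | heq
  · refine (hT.2 Y hY hne hlt).congr fun x hx => ?_
    rw [hT', if_neg (by omega)]
  · have hm0 : m ≠ 0 := fun h => hne.ne_empty (maskOf_eq_zero.1 (heq.trans h))
    have hset : ∀ v : Fin p.n, s1.arr p 7 v = if v ∈ base ∪ Y then 1 else 0 :=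
      decodeSet_spec hp hs hl hF hY (hm.trans heq.symm) hb
    have hr1 := hs.frame hp f1 (by decide) (by decide) (by decide)
    have hcut : s2.reg 9 = setCut G.arcWeight (base ∪ Y) := by
      rw [hs2, Cmd.eval_set, Expr.val_cut hp hr1.good (S := base ∪ Y)]
      · simp [(setCut_lt_cap hp (base ∪ Y)).le]
      · intro t x v ht hx
        simp only [Expr.val_arr, Expr.val_var, hx, ht.arr 7 (by decide), hset]
        split_ifs with c <;> simp [c]
    have h9 : (L.eval p s3).reg 9 = setCut G.arcWeight (base ∪ Y) := by
      rw [f4.reg 9 (by decide), f3.reg 9 (by decide), hcut]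
    have hle : ∀ x, s.arr p 8 x ≤ p.cap := fun x => hs.good.arr_le 8 x
    have hmin : (∀ v ∈ Y, (L.eval p s3).reg 16 ≤ s.arr p 8 (maskOf F (Y.erase v))) ∧
        ((L.eval p s3).reg 16 = p.cap ∨
          ∃ v ∈ Y, s.arr p 8 (maskOf F (Y.erase v)) = (L.eval p s3).reg 16) ∧
        (L.eval p s3).reg 16 ≤ p.cap := by
      have := Cmd.loop_induct hp.sound (s := s3) (x := 1)
        (P := .set 16 (.ite (.and (.arr 5 (.var 1)) (.arr 7 (.var 1)))
        (.min (.var 16) (.arr 8 (.var 4 - .arr 10 (.arr 6 (.var 1))))) (.var 16)))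
        (fun i t => (∀ v ∈ Y, (v : ℕ) < i → t.reg 16 ≤ s.arr p 8 (maskOf F (Y.erase v))) ∧
        (t.reg 16 = p.cap ∨ ∃ v ∈ Y, s.arr p 8 (maskOf F (Y.erase v)) = t.reg 16) ∧
        t.reg 16 ≤ p.cap) rfl ⟨by simp, Or.inl (by simp [hs3]), by simp [hs3]⟩ ?_
      · exact ⟨fun v hv => this.1 v hv v.2, this.2⟩
      rintro i hi t ht ⟨a1, a2, a3⟩
      obtain ⟨v, rfl⟩ : ∃ v : Fin p.n, (v : ℕ) = i := ⟨⟨i, hi⟩, rfl⟩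
      have ft : Frame p [5, 6, 0, 9, 16, 1] [3, 7] s (t.setReg 1 v) :=
        (f13.mono (by decide) (by decide)).trans ht (by decide) (by decide)
      have lt := hl.frame ft (by decide) (by decide) (by decide)
      have rt := hs.frame hp ft (by decide) (by decide) (by decide)
      have h1 : (t.setReg 1 v).reg 1 = v := by simp
      have h16 : (t.setReg 1 v).reg 16 = t.reg 16 := by simp
      have h7 : (t.setReg 1 v).arr p 7 v = if v ∈ base ∪ Y then 1 else 0 := by
        rw [ht.arr 7 (by decide), f3.arr 7 (by decide), f2.arr 7 (by decide), hset]
      have hnb : v ∈ F → v ∉ base := fun h => by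
        rw [hl.base_eq]; split_ifs <;> simp [h]
      by_cases hvY : v ∈ Y
      · have hvF := hY hvY
        have hcond : ¬ (Expr.and (.arr 5 (.var 1)) (.arr 7 (.var 1))).val p
            (t.setReg 1 v) = 0 := by
          simp only [Expr.val_and_eq_zero, Expr.val_arr, Expr.val_var, h1, lt.free, h7, hvF]
          simp [hvY]
        rw [Cmd.eval_set, Expr.val_ite, if_neg hcond, Expr.val_min, Expr.val_arr,
          predecessor_eq hp rt lt hF hY ((ft.reg 4 (by decide)).trans (hm.trans heq.symm)) hvY h1,
          ft.arr 8 (by decide), Expr.val_var, h16]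
        set y := s.arr p 8 (maskOf F (Y.erase v)) with hy
        have hyc := hle (maskOf F (Y.erase v))
        have hmn : min (min (t.reg 16) y) p.cap = min (t.reg 16) y :=
          min_eq_left ((min_le_left _ _).trans a3)
        rw [hmn]
        simp only [State.reg_setReg, if_true]
        refine ⟨fun u hu hui => ?_, ?_, (min_le_left _ _).trans a3⟩
        · rcases Nat.lt_succ_iff_lt_or_eq.1 hui with h | h
          · exact (min_le_left _ _).trans (a1 u hu h)
          · obtain rfl := Fin.ext h
            exact min_le_right _ _
        · rcases le_total (t.reg 16) y with h | h
          · rw [min_eq_left h]; exact a2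
          · rw [min_eq_right h]; exact Or.inr ⟨v, hvY, rfl⟩
      · have hcond : (Expr.and (.arr 5 (.var 1)) (.arr 7 (.var 1))).val p (t.setReg 1 v) = 0 := by
          simp only [Expr.val_and_eq_zero, Expr.val_arr, Expr.val_var, h1, lt.free, h7]
          by_cases hvF : v ∈ F
          · right; simp [hvY, hnb hvF]
          · left; simp [hvF]
        rw [Cmd.eval_set, Expr.val_ite, if_pos hcond, Expr.val_var, h16, min_eq_left a3]
        simp only [State.reg_setReg, if_true]
        refine ⟨fun u hu hui => ?_, a2, a3⟩
        rcases Nat.lt_succ_iff_lt_or_eq.1 hui with h | h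
        · exact a1 u hu h
        · obtain rfl := Fin.ext h
          exact absurd hu hvY
    obtain ⟨b1, b2, b3⟩ := hmin
    have hnew : ((Cmd.put 8 (.var 4) (.ite (.var 4) (.max (.var 9) (.var 16)) 0)).eval p
        (L.eval p s3)).arr p 8 (maskOf F Y) =
        max (setCut G.arcWeight (base ∪ Y)) ((L.eval p s3).reg 16) := by
      rw [hT', if_pos heq, if_neg hm0, h9,
        min_eq_left (max_le (setCut_lt_cap hp _).le b3)]
    have hold : ∀ v ∈ Y, ((Cmd.put 8 (.var 4) (.ite (.var 4) (.max (.var 9) (.var 16)) 0)).eval p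
        (L.eval p s3)).arr p 8 (maskOf F (Y.erase v)) = s.arr p 8 (maskOf F (Y.erase v)) := by
      intro v hv
      have h1 := maskOf_erase (F := F) hv
      have h2 := two_pow_le_maskOf (F := F) hv
      have h3 := Nat.two_pow_pos (rankIn F v)
      rw [hT', if_neg (by omega)]
    refine ⟨by rw [hnew]; exact le_max_left _ _, ?_, fun v hv => ?_⟩
    -- If the running minimum is still the cap, every predecessor will do, because all stored
    -- entries are at most the cap.
    · rcases b2 with b2 | ⟨v, hv, b2⟩
      · obtain ⟨v, hv⟩ := hne
        refine ⟨v, hv, ?_⟩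
        rw [hnew, hold v hv, b2]
        exact (hle _).trans (le_max_right _ _)
      · refine ⟨v, hv, ?_⟩
        rw [hnew, hold v hv, b2]
        exact le_max_right _ _
    · rw [hnew, hold v hv]
      exact max_le_max le_rfl (b1 v hv)

end RAM
namespace RAM

variable {p : Params} {G : WeightedDigraph p.n} {s t : State}

/-! #### Reading an optimal ordering off the table -/

/-- Writes a vertex that may be the last one of the current set to the variable 15. -/
def choose : Cmd :=
  .loop 1 (.set 15 (.ite (.and (.and (.arr 5 (.var 1)) (.arr 7 (.var 1)))
    (.not (.lt (.arr 8 (.var 4)) (.arr 8 (.var 4 - .arr 10 (.arr 6 (.var 1)))))))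
    (.var 1) (.var 15)))

theorem choose_spec (hp : p.Fits G) (hs : s.Ready p G) {F base Y : Finset (Fin p.n)}
    (hl : s.Layout p F base) (hF : F.card ≤ part p.n) (hY : Y ⊆ F) (h4 : s.reg 4 = maskOf F Y)
    (h7 : ∀ v : Fin p.n, s.arr p 7 v = if v ∈ base ∪ Y then 1 else 0)
    (hv : ∃ v ∈ Y, s.arr p 8 (maskOf F (Y.erase v)) ≤ s.arr p 8 (maskOf F Y)) :
    ∃ v ∈ Y, s.arr p 8 (maskOf F (Y.erase v)) ≤ s.arr p 8 (maskOf F Y) ∧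
      (choose.eval p s).reg 15 = v := by
  have hn := hp.n_add_two_le
  have key := Cmd.loop_induct hp.sound (s := s) (x := 1)
    (P := .set 15 (.ite (.and (.and (.arr 5 (.var 1)) (.arr 7 (.var 1)))
      (.not (.lt (.arr 8 (.var 4)) (.arr 8 (.var 4 - .arr 10 (.arr 6 (.var 1)))))))
      (.var 1) (.var 15)))
    (fun i t => (∃ v ∈ Y, s.arr p 8 (maskOf F (Y.erase v)) ≤ s.arr p 8 (maskOf F Y) ∧
      t.reg 15 = v) ∨ ∀ v ∈ Y, (v : ℕ) < i →
        ¬ s.arr p 8 (maskOf F (Y.erase v)) ≤ s.arr p 8 (maskOf F Y)) rfl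
    (Or.inr fun v _ h => absurd h (by omega)) ?_
  · rcases key with h | h
    · exact h
    · obtain ⟨v, hv, h'⟩ := hv
      exact absurd h' (h v hv v.2)
  rintro i hi t ft hI
  obtain ⟨v, rfl⟩ : ∃ v : Fin p.n, (v : ℕ) = i := ⟨⟨i, hi⟩, rfl⟩
  have lt := hl.frame ft (by decide) (by decide) (by decide)
  have rt := hs.frame hp ft (by decide) (by decide) (by decide)
  have h1 : (t.setReg 1 v).reg 1 = v := by simp
  have h15 : (t.setReg 1 v).reg 15 = t.reg 15 := by simp
  have h4' : (t.setReg 1 v).reg 4 = maskOf F Y := (ft.reg 4 (by decide)).trans h4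
  have hcond : (Expr.and (.and (.arr 5 (.var 1)) (.arr 7 (.var 1)))
      (.not (.lt (.arr 8 (.var 4)) (.arr 8 (.var 4 - .arr 10 (.arr 6 (.var 1))))))).val p
      (t.setReg 1 v) = 0 ↔
      ¬ (v ∈ Y ∧ s.arr p 8 (maskOf F (Y.erase v)) ≤ s.arr p 8 (maskOf F Y)) := by
    simp only [Expr.val_and_eq_zero, Expr.val_arr, Expr.val_var, h1, lt.free,
      ft.arr 7 (by decide), h7, Expr.val_not_eq_zero, ne_eq, Expr.val_lt_eq_zero, h4',
      ft.arr 8 (by decide)]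
    by_cases hvY : v ∈ Y
    · rw [predecessor_eq hp rt lt hF hY h4' hvY h1]
      simp [hY hvY, hvY]
    · have hnb : v ∈ F → v ∉ base := fun h => by
        rw [hl.base_eq]; split_ifs <;> simp [h]
      by_cases hvF : v ∈ F
      · simp [hvY, hnb hvF]
      · simp [hvY, hvF]
  rw [Cmd.eval_set, Expr.val_ite, State.reg_setReg, if_pos rfl]
  split_ifs with hc
  · rw [hcond] at hc
    rcases hI with ⟨u, hu, h, h'⟩ | hI
    · refine Or.inl ⟨u, hu, h, ?_⟩
      rw [Expr.val_var, h15, h']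
      exact min_eq_left (by omega)
    · refine Or.inr fun u hu hui h => ?_
      rcases Nat.lt_succ_iff_lt_or_eq.1 hui with h' | h'
      · exact hI u hu h' h
      · obtain rfl := Fin.ext h'
        exact hc ⟨hu, h⟩
  · rw [hcond, not_not] at hc
    refine Or.inl ⟨v, hc.1, hc.2, ?_⟩
    rw [Expr.val_var, h1]
    exact min_eq_left (by omega)

/-- Removes the last vertex of the current set and records its position. -/
def retreat : Cmd :=
  .seq decodeSet (.ite (.var 4) (.seq choose (.seq (.set 14 (.var 14 - 1))
    (.seq (.put 9 (.var 15) (.var 14)) (.set 4 (.var 4 - .arr 10 (.arr 6 (.var 15)))))))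
    (.set 15 0))

/-- The variable 4 encodes a subset of `F` with at most `k` elements, and the vertices outside this
set and the base have been placed. -/
def State.Track (p : Params) (G : WeightedDigraph p.n) (F base : Finset (Fin p.n)) (W k : ℕ)
    (s : State) : Prop :=
  ∃ Y ⊆ F, s.reg 4 = maskOf F Y ∧ Y.card ≤ k ∧ s.reg 14 = (base ∪ Y).card ∧
    s.arr p 8 (maskOf F Y) ≤ W ∧ Placed G.arcWeight W (base ∪ Y) fun v => s.arr p 9 v

/-- The entry at Y bounds the cut of base ∪ Y, which is what `Placed.erase` needs, and some
predecessor has no larger entry. So the bound W is inherited all the way down. On the empty set the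
step is idle, which is why k - 1 may be truncated. -/
theorem retreat_spec (hp : p.Fits G) (hs : s.Ready p G) {F base : Finset (Fin p.n)}
    (hl : s.Layout p F base) (hF : F.card ≤ part p.n) (hb : s.reg 13 ≤ 1)
    (hT : Table G.arcWeight base F (s.arr p 8) p.big) {W k : ℕ} (h : s.Track p G F base W k) :
    (retreat.eval p s).Track p G F base W (k - 1) := by
  have hn := hp.n_add_two_le
  obtain ⟨Y, hY, h4, hk, h14, hW, hpl⟩ := h
  have f1 : Frame p [5, 6, 0] [3, 7] s (decodeSet.eval p s) :=
    (Cmd.frame hp.sound decodeSet rfl s).mono (by decide) (by decide)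
  have h7 := decodeSet_spec hp hs hl hF hY h4 hb
  rw [retreat, Cmd.eval_seq]
  set s1 := decodeSet.eval p s with hs1
  have g4 : s1.reg 4 = maskOf F Y := (f1.reg 4 (by decide)).trans h4
  have g14 : s1.reg 14 = (base ∪ Y).card := (f1.reg 14 (by decide)).trans h14
  have a8 : s1.arr p 8 = s.arr p 8 := f1.arr 8 (by decide)
  have a9 : s1.arr p 9 = s.arr p 9 := f1.arr 9 (by decide)
  rw [Cmd.eval_ite, Expr.val_var, g4]
  split_ifs with hc
  · obtain rfl := maskOf_eq_zero.1 hc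
    refine ⟨∅, hY, ?_, by simp, ?_, ?_, ?_⟩
    · simp [g4]
    · simp [g14]
    · simpa [a8] using hW
    · simpa [a9] using hpl
  · have hne : Y.Nonempty := nonempty_iff_ne_empty.2 fun h => hc (maskOf_eq_zero.2 h)
    obtain ⟨hcut, hex, -⟩ := hT.2 Y hY hne (maskOf_lt_big hp hF hY)
    have r1 := hs.frame hp f1 (by decide) (by decide) (by decide)
    have l1 := hl.frame f1 (by decide) (by decide) (by decide)
    obtain ⟨v, hv, hle, h15⟩ := choose_spec hp r1 l1 hF hY g4 h7 (by rwa [a8])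
    rw [a8] at hle
    have f2 : Frame p [1, 15] [] s1 (choose.eval p s1) := Cmd.frame hp.sound choose rfl s1
    simp only [Cmd.eval_seq]
    set s2 := choose.eval p s1 with hs2
    have hcard : (base ∪ Y).card ≤ p.n := by simpa using card_le_univ (base ∪ Y)
    have e3 : (Cmd.set 14 (.var 14 - 1)).eval p s2 = s2.setReg 14 ((base ∪ Y).card - 1) := by
      rw [Cmd.eval_set, Expr.val_sub, Expr.val_var, Expr.val_one, f2.reg 14 (by decide), g14,
        min_eq_left (by omega)]
    rw [e3]
    set s3 := s2.setReg 14 ((base ∪ Y).card - 1) with hs3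
    have e4 : (Cmd.put 9 (.var 15) (.var 14)).eval p s3 = s3.setArr p 9 v ((base ∪ Y).card - 1) := by
      rw [Cmd.eval_put, Expr.val_var, Expr.val_var]
      have : s3.reg 15 = v := by simp [hs3, h15]
      rw [this]
      simp only [hs3, State.reg_setReg, if_true]
      rw [min_eq_left (by omega)]
    have f3 : Frame p [14] [9] s2 (s3.setArr p 9 v ((base ∪ Y).card - 1)) := by
      rw [← e4, ← e3]
      exact Cmd.frame hp.sound (.seq (.set 14 (.var 14 - 1)) (.put 9 (.var 15) (.var 14))) rfl s2
    rw [e4]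
    set s4 := s3.setArr p 9 v ((base ∪ Y).card - 1) with hs4
    have f4 : Frame p [1, 15, 14] [9] s1 s4 :=
      (f2.mono (by decide) (by decide)).trans f3 (by decide) (by decide)
    have i15 : s4.reg 15 = v := by rw [f3.reg 15 (by decide), h15]
    have r4 := r1.frame hp f4 (by decide) (by decide) (by decide)
    have l4 := l1.frame f4 (by decide) (by decide) (by decide)
    have i4 := (f4.reg 4 (by decide)).trans g4
    have hpred := predecessor_eq hp r4 l4 hF hY i4 hv i15
    have hmle : maskOf F (Y.erase v) ≤ p.cap :=
      (maskOf_lt_big hp hF ((erase_subset _ _).trans hY)).le.trans hp.big_le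
    have hbv : v ∉ base := by
      rw [hl.base_eq]; split_ifs <;> simp [hY hv]
    have hunion : base ∪ Y.erase v = (base ∪ Y).erase v := by
      rw [erase_union_distrib, erase_eq_of_notMem hbv]
    have hvQ : v ∈ base ∪ Y := mem_union_right _ hv
    rw [Cmd.eval_set, hpred, min_eq_left hmle]
    refine ⟨Y.erase v, (erase_subset _ _).trans hY, ?_, ?_, ?_, ?_, ?_⟩
    · simp
    · rw [card_erase_of_mem hv]; omega
    · rw [hunion, card_erase_of_mem hvQ]
      simp [hs4, hs3]
    · rw [State.arr_setReg, f4.arr 8 (by decide), a8]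
      exact hle.trans hW
    · rw [hunion]
      have hval : ∀ u : Fin p.n, s4.arr p 9 u =
          if u = v then (base ∪ Y).card - 1 else s.arr p 9 u := fun u => by
        rw [hs4, State.arr_setArr]
        have : s3.arr p 9 = s.arr p 9 := by
          funext x
          rw [hs3, State.arr_setReg, f2.arr 9 (by decide), a9]
        simp only [this, true_and, Fin.val_inj]
      refine hpl.erase hvQ (hcut.trans hW) (fun u hu => ?_) ?_
      · rw [State.arr_setReg, hval, if_neg hu]
      · rw [State.arr_setReg, hval, if_pos rfl]

/-- Records the positions of the vertices of `F`. -/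
def backtrack : Cmd :=
  .seq (.set 4 (.sum 20 (.ite (.arr 5 (.var 20)) (.arr 10 (.arr 6 (.var 20))) 0)))
    (.loop 8 retreat)

theorem backtrack_spec (hp : p.Fits G) (hs : s.Ready p G) {F base : Finset (Fin p.n)}
    (hl : s.Layout p F base) (hF : F.card ≤ part p.n) (hb : s.reg 13 ≤ 1)
    (hT : Table G.arcWeight base F (s.arr p 8) p.big) {W : ℕ}
    (hW : s.arr p 8 (maskOf F F) ≤ W) (h14 : s.reg 14 = (base ∪ F).card)
    (hpl : Placed G.arcWeight W (base ∪ F) fun v => s.arr p 9 v) :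
    (backtrack.eval p s).reg 14 = base.card ∧
      Placed G.arcWeight W base fun v => (backtrack.eval p s).arr p 9 v := by
  have hn := hp.n_add_two_le
  have hmask := maskOf_lt_big hp hF (Subset.refl F)
  have hcap := hp.big_le
  have hsum : (Expr.sum 20 (.ite (.arr 5 (.var 20)) (.arr 10 (.arr 6 (.var 20))) 0)).val p s =
      maskOf F F := by
    simp only [Expr.val_sum, sum_range, Expr.val_ite, Expr.val_arr, Expr.val_var,
      State.reg_setReg, if_true, State.arr_setReg, hl.free, hl.rank, Expr.val_zero, maskOf]
    rw [← sum_filter_add_sum_filter_not univ (fun u => u ∈ F), add_comm, sum_eq_zero, zero_add]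
    · rw [filter_mem_eq_inter, univ_inter]
      refine sum_congr rfl fun u hu => ?_
      have hr : rankIn F u < p.n := (rankIn_lt hu).trans_le (hF.trans (part_le _))
      have := two_pow_le_maskOf (F := F) hu
      rw [if_pos hu, if_neg (by decide), hs.pow _ hr, min_eq_left (by omega)]
    · intro u hu
      simp [(mem_filter.1 hu).2]
  rw [backtrack, Cmd.eval_seq, Cmd.eval_set, hsum, min_eq_left (by omega)]
  set s1 := s.setReg 4 (maskOf F F) with hs1
  have f1 : Frame p [4] [] s s1 := .setReg (by decide) (by omega)
  -- The loop makes n ≥ |F| rounds; the superfluous ones are idle.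
  have key := Cmd.loop_induct hp.sound (s := s1) (x := 8) (P := retreat)
    (fun i t => t.Track p G F base W (F.card - i)) rfl
    ⟨F, Subset.refl F, by simp [hs1], le_rfl, by simp [hs1, h14], hW, hpl⟩ ?_
  · obtain ⟨Y, hY, -, hk, h14', -, hpl'⟩ := key
    have hc : F.card ≤ p.n := by simpa using card_le_univ F
    have : Y = ∅ := card_eq_zero.1 (by omega)
    rw [this, union_empty] at h14' hpl'
    exact ⟨h14', hpl'⟩
  · intro i hi t ft h
    have ft' : Frame p (4 :: 8 :: retreat.vars) retreat.arrays s (t.setReg 8 i) :=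
      (f1.mono (by decide) (by decide)).trans ft (by decide) (by decide)
    have rt := hs.frame hp ft' (by decide) (by decide) (by decide)
    have lt := hl.frame ft' (by decide) (by decide) (by decide)
    have e8 : (t.setReg 8 i).arr p 8 = s.arr p 8 := ft'.arr 8 (by decide)
    refine retreat_spec hp rt lt hF (by rwa [ft'.reg 13 (by decide)]) (by rwa [e8]) (k := F.card - i) ?_
    obtain ⟨Y, hY, q⟩ := h
    exact ⟨Y, hY, by simpa using q⟩

/-! #### The whole program -/

/-- Places the free vertices of the part that the variable 13 selects. -/
def orderPart : Cmd := .seq layout (.seq (.longLoop 4 tableStep) backtrack)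

/-- Any ordering π that keeps the cuts of this side at most W is a witness for W: the table does no
worse, and backtracking turns its last entry into positions. -/
theorem orderPart_spec (hp : p.Fits G) (hs : s.Ready p G) {F base : Finset (Fin p.n)}
    (hFs : F = if s.reg 13 = 0 then s.best p else (s.best p)ᶜ)
    (hbase : base = if s.reg 13 = 0 then ∅ else Fᶜ) (hF : F.card ≤ part p.n) (hb : s.reg 13 ≤ 1)
    {W : ℕ} (hW : ∃ π : VertexOrdering p.n, ∀ j,
      setCut G.arcWeight (base ∪ (F ∩ prefixSet π j)) ≤ W)
    (h14 : s.reg 14 = (base ∪ F).card)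
    (hpl : Placed G.arcWeight W (base ∪ F) fun v => s.arr p 9 v) :
    (orderPart.eval p s).reg 14 = base.card ∧
      Placed G.arcWeight W base fun v => (orderPart.eval p s).arr p 9 v := by
  simp only [orderPart, Cmd.eval_seq]
  have f1 : Frame p [0, 20] [5, 6] s (layout.eval p s) :=
    (Cmd.frame hp.sound layout rfl s).mono (by decide) (by decide)
  have l1 := layout_spec hp hFs hbase
  have r1 := hs.frame hp f1 (by decide) (by decide) (by decide)
  set s1 := layout.eval p s with hs1
  have b1 : s1.reg 13 ≤ 1 := by rwa [f1.reg 13 (by decide)]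
  have f2 : Frame p [4, 5, 6, 0, 9, 16, 1] [3, 7, 8] s1 ((Cmd.longLoop 4 tableStep).eval p s1) :=
    (Cmd.frame hp.sound (Cmd.longLoop 4 tableStep) rfl s1).mono (by decide) (by decide)
  have hT : Table G.arcWeight base F (((Cmd.longLoop 4 tableStep).eval p s1).arr p 8) p.big := by
    refine Cmd.longLoop_induct hp.sound (fun i t => Table G.arcWeight base F (t.arr p 8) i) rfl
      ⟨fun h => absurd h (by omega), fun _ _ _ h => absurd h (by omega)⟩ fun i hi t ft hT => ?_
    have := tableStep_spec hp (r1.frame hp ft (by decide) (by decide) (by decide))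
      (l1.frame ft (by decide) (by decide) (by decide)) hF
      (by rwa [ft.reg 13 (by decide)]) (by rw [show (t.setReg 4 i).reg 4 = i by simp]; exact hT)
    simpa using this
  set s2 := (Cmd.longLoop 4 tableStep).eval p s1 with hs2
  have f := f1.mono (X' := [4, 5, 6, 0, 9, 16, 1, 20]) (K' := [3, 7, 8, 5, 6]) (by decide)
    (by decide) |>.trans f2 (by decide) (by decide)
  obtain ⟨π, hπ⟩ := hW
  have hle := hT.le_of_chain (maskOf_lt_big hp hF (Subset.refl F)) π hπ
  exact backtrack_spec hp (r1.frame hp f2 (by decide) (by decide) (by decide))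
    (l1.frame f2 (by decide) (by decide) (by decide)) hF (by rwa [f2.reg 13 (by decide)]) hT hle
    ((f.reg 14 (by decide)).trans h14) (by rwa [f.arr 9 (by decide)])

/-- Places all vertices, those of the best set first. -/
def order : Cmd :=
  .seq (.seq (.set 14 .size) (.set 13 1)) (.seq orderPart (.seq (.set 13 0) orderPart))

/-- Positions are given from the end, so the complement of the best set S is ordered first, with
base S, and then S itself with empty base. Balance guarantees that the codes of both sides stay
below `big`. -/
theorem order_spec (hp : p.Fits G) (hs : s.Ready p G) (hbal : Balanced (s.best p))
    (hcut : setCut G.arcWeight (s.best p) ≤ G.cutwidth) :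
    Placed G.arcWeight (2 * G.cutwidth) ∅ fun v => (order.eval p s).arr p 9 v := by
  have hn := hp.n_add_two_le
  obtain ⟨π, hπ⟩ := G.exists_orderingWidth_eq_cutwidth
  have hpre : ∀ j, setCut G.arcWeight (prefixSet π j) ≤ G.cutwidth := fun j =>
    (G.setCut_prefixSet_le π j).trans hπ.le
  set S := s.best p with hS
  have hcard : Sᶜ.card = p.n - S.card := by rw [card_compl, Fintype.card_fin]
  have hlen : S.card ≤ p.n := by simpa using card_le_univ S
  simp only [order, Cmd.eval_seq]
  have e1 : (Cmd.set 13 1).eval p ((Cmd.set 14 .size).eval p s) =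
      (s.setReg 14 p.n).setReg 13 1 := by
    simp only [Cmd.eval_set, Expr.val_size, Expr.val_one]
    rw [min_eq_left (by omega), min_eq_left (by omega)]
  rw [e1]
  set s1 := (s.setReg 14 p.n).setReg 13 1 with hs1
  have f1 : Frame p [14, 13] [] s s1 :=
    (Frame.setReg (X := [14, 13]) (K := []) (by decide) (by omega)).trans
      (Frame.setReg (X := [13]) (K := []) (by decide) (by omega)) (by decide) (by decide)
  have r1 := hs.frame hp f1 (by decide) (by decide) (by decide)
  have b1 : s1.best p = S := rfl
  have e13 : s1.reg 13 = 1 := by simp [hs1]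
  obtain ⟨h14, hpl⟩ := orderPart_spec hp r1 (F := Sᶜ) (base := S) (W := 2 * G.cutwidth)
    (by simp [b1, e13]) (by simp [e13]) (by have := hbal.1; omega) (by omega)
    -- The set after S and part of the complement is S ∪ Q for a prefix Q of the optimal ordering,
    -- with cut at most cut(S) + cut(Q).
    ⟨π, fun j => by
      have h1 := setCut_union_le G.arcWeight S (prefixSet π j)
      have h2 := hpre j
      have h3 : S ∪ Sᶜ ∩ prefixSet π j = S ∪ prefixSet π j := by
        ext v; simp only [mem_union, mem_inter, mem_compl]; tauto
      rw [h3]; omega⟩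
    (by simp [hs1]) (by rw [union_compl]; exact placed_univ ..)
  have f2 : Frame p orderPart.vars orderPart.arrays s1 (orderPart.eval p s1) :=
    Cmd.frame hp.sound orderPart rfl s1
  set s2 := orderPart.eval p s1 with hs2
  have r2 := r1.frame hp f2 (by decide) (by decide) (by decide)
  have e3 : (Cmd.set 13 0).eval p s2 = s2.setReg 13 0 := by simp
  rw [e3]
  have r3 := r2.frame hp (Frame.setReg (X := [13]) (K := []) (x := 13) (v := 0) (by decide)
    (by omega)) (by decide) (by decide) (by decide)
  have b3 : (s2.setReg 13 0).best p = S := by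
    rw [← b1]
    simp only [State.best, State.arr_setReg, f2.arr 4 (by decide)]
  refine (orderPart_spec hp r3 (F := S) (base := ∅) (W := 2 * G.cutwidth)
    (by simp [b3]) (by simp) hbal.2 (by simp) ⟨π, fun j => ?_⟩ ?_ ?_).2
  · have h1 := setCut_inter_le G.arcWeight S (prefixSet π j)
    have h2 := hpre j
    rw [empty_union]; omega
  · simp [h14]
  · rw [empty_union]; exact hpl

/-- Writes the positions to the output cells. -/
def output : Cmd := .loop 0 (.poke (.var 0) (.arr 9 (.var 0)))

/-- The output cells lie below n and the arrays above the cap, so writing positions does not disturb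
the ones still to be read. -/
theorem output_spec (hp : p.Fits G) (hs : s.Good p G) (v : Fin p.n) :
    (output.eval p s).mem v = s.arr p 9 v := by
  have hn := hp.n_add_two_le
  refine (iter_induct (f := (Cmd.poke (.var 0) (.arr 9 (.var 0))).eval p) (x := 0)
    (fun i t => t.arr p 9 = s.arr p 9 ∧ ∀ v < i, t.mem v = s.arr p 9 v) ⟨rfl, by simp⟩
    fun i hi t ht => ?_).2 v v.2
  obtain ⟨h1, h2⟩ := ht
  have e : (Cmd.poke (.var 0) (.arr 9 (.var 0))).eval p (t.setReg 0 i) =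
      (t.setReg 0 i).setMem i (s.arr p 9 i) := by
    rw [Cmd.eval_poke, Expr.val_arr, Expr.val_var, State.arr_setReg, h1, State.reg_setReg,
      if_pos rfl, min_eq_left (hs.arr_le 9 i)]
  rw [e]
  refine ⟨?_, fun v hv => ?_⟩
  · rw [← h1]
    funext x
    simp only [State.arr, State.mem_setMem, State.mem_setReg]
    rw [if_neg (by omega)]
  · rw [State.mem_setMem, State.mem_setReg]
    split_ifs with c
    · rw [c]
    · exact h2 v (by omega)

/-- The program. -/
def cutwidthProgram : Cmd :=
  .seq (.seq powers sizes) (.seq findSet (.seq order output))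

/-- Long loops run one after the other, never inside each other; this is what makes the running time
linear in 2^`part`. -/
theorem cutwidthProgram_longDepth : cutwidthProgram.longDepth = 1 := by decide

theorem cutwidthProgram_spec (hp : p.Fits G) (hs : s.Good p G) :
    ∃ π : VertexOrdering p.n, (cutwidthProgram.eval p s).Outputs π ∧
      G.orderingWidth π ≤ 2 * G.cutwidth := by
  rcases Nat.eq_zero_or_pos p.n with h0 | hn
  · refine ⟨Equiv.refl _, fun v => absurd v.2 (by omega), ?_⟩
    exact G.orderingWidth_le fun i h1 h2 => by omega
  simp only [cutwidthProgram, Cmd.eval_seq]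
  have f1 : Frame p [5, 6] [10] s (powers.eval p s) :=
    (Cmd.frame hp.sound powers rfl s).mono (by decide) (by decide)
  have h1 := powers_spec hp (s := s)
  set s1 := powers.eval p s with hs1
  have f2 : Frame p [11, 12] [] s1 (sizes.eval p s1) :=
    (Cmd.frame hp.sound sizes rfl s1).mono (by decide) (by decide)
  obtain ⟨h2, h2'⟩ := sizes_spec hp h1
  set s2 := sizes.eval p s1 with hs2
  have r2 : s2.Ready p G := ⟨(hs.frame hp f1).frame hp f2,
    fun j hj => by rw [f2.arr 10 (by decide)]; exact h1 j hj, h2, h2'⟩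
  have f3 : Frame p findSet.vars findSet.arrays s2 (findSet.eval p s2) :=
    Cmd.frame hp.sound findSet rfl s2
  obtain ⟨h3, h3'⟩ := findSet_spec hp hn r2
  set s3 := findSet.eval p s2 with hs3
  have r3 := r2.frame hp f3 (by decide) (by decide) (by decide)
  have h4 := order_spec hp r3 h3 h3'
  have g4 := r3.good.frame hp (Cmd.frame hp.sound order rfl s3)
  obtain ⟨π, h5, h6⟩ := h4.exists_ordering
  exact ⟨π, fun v => by rw [output_spec hp g4, h5], h6⟩

end RAM
namespace RAM

/-! ### Setting up the parameters -/

theorem Runs.loop_zero {x w : ℕ} {P : Program} {s : State} {Q : State → Prop}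
    (hx : s.reg x = 0) (h : Q s) : Runs (.loop x P) s (2 * w + 1) Q :=
  ⟨s, _, .loopDone hx, by simp [hx], h⟩

theorem Runs.loop_succ {x w c c' : ℕ} {P : Program} {s : State} {Q R : State → Prop}
    (hx : s.reg x ≠ 0) (hw : s.reg x < 2 ^ w) (h : Runs P s c R)
    (h' : ∀ s', R s' → Runs (.loop x P) s' c' Q) :
    Runs (.loop x P) s (2 * w + 1 + c + c') Q := by
  obtain ⟨s', t, e, ht, r⟩ := h
  obtain ⟨s'', t', e', ht', q⟩ := h' s' r
  have := Nat.size_le.2 hw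
  exact ⟨s'', _, .loopStep hx e e', by omega, q⟩

/-- Doubles the register `1` once or twice while it subtracts up to `3` from the register `5`. -/
def doubling : Program := Program.block [.add 1 1 1, .sub 5 5 7,
  .cond 5 (Program.block [.add 1 1 1, .sub 5 5 7, .sub 5 5 7]) (.const 9 0)]

/-- Three units of r contribute a factor 4, and remainders 1 and 2 contribute 2 and 4, which is the
rounding in (2r + 2) / 3. The exponent is thus obtained without a division. -/
theorem doubling_runs {w : ℕ} (r : ℕ) : ∀ (s : State) (b : ℕ), s.reg 5 = r →
    s.reg 1 = b → s.reg 7 = 1 → r < 2 ^ w → b * 2 ^ ((2 * r + 2) / 3) < 2 ^ w →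
    Runs (.loop 5 doubling) s (r * (8 * (2 * w + 1)) + (2 * w + 1)) fun s' =>
      s'.mem = s.mem ∧ s'.reg 1 = b * 2 ^ ((2 * r + 2) / 3) ∧
      ∀ x, x ≠ 1 → x ≠ 5 → x ≠ 9 → s'.reg x = s.reg x := by
  induction r using Nat.strong_induction_on with
  | _ r ih =>
  intro s b h5 h1 h7 hr hb
  rcases Nat.eq_zero_or_pos r with rfl | hpos
  · rw [zero_mul, zero_add]
    exact .loop_zero h5 ⟨rfl, by simpa using h1, fun _ _ _ _ => rfl⟩
  have hb1 : b < 2 ^ w := (Nat.le_mul_of_pos_right b (by positivity)).trans_lt hb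
  have hpow : 2 ^ ((2 * r + 2) / 3) = 2 * 2 ^ ((2 * r + 2) / 3 - 1) := by
    rw [← pow_succ']; congr 1; omega
  have hb2 : 2 * b < 2 ^ w := by
    have := Nat.le_mul_of_pos_right (2 * b) (Nat.two_pow_pos ((2 * r + 2) / 3 - 1))
    rw [hpow] at hb
    calc 2 * b ≤ 2 * b * 2 ^ ((2 * r + 2) / 3 - 1) := this
      _ = b * (2 * 2 ^ ((2 * r + 2) / 3 - 1)) := by ring
      _ < _ := hb
  have step : Runs doubling s (7 * (2 * w + 1)) fun s' => s'.mem = s.mem ∧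
      s'.reg 1 = (if r = 1 then 2 * b else 4 * b) ∧ s'.reg 5 = r - 3 ∧
      ∀ x, x ≠ 1 → x ≠ 5 → x ≠ 9 → s'.reg x = s.reg x := by
    refine Runs.mono (c := (2 * w + 1) + ((2 * w + 1) + (2 * w + 1 + ((2 * w + 1) +
      ((2 * w + 1) + (2 * w + 1))) + (2 * w + 1))))
      (.seq (R := fun s' => s' = s.setReg 1 (2 * b)) (.add (w := w) ?_ ?_ ?_) ?_)
      (le_of_eq (by ring)) fun _ h => h
    · omega
    · omega
    · rw [h1]; congr 1; omega
    rintro _ rfl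
    refine .seq (R := fun s' => s' = (s.setReg 1 (2 * b)).setReg 5 (r - 1))
      (.sub (w := w) ?_ ?_ ?_) ?_
    · simp; omega
    · simp; omega
    · simp [h5, h7]
    rintro _ rfl
    refine .cond (w := w) ?_ (fun hc => ?_) (fun hc => ?_)
    · simp; omega
    · have hr1 : r ≠ 1 := by rintro rfl; simp at hc
      refine .seq (R := fun s' => s' = ((s.setReg 1 (2 * b)).setReg 5 (r - 1)).setReg 1 (4 * b))
        (.add (w := w) ?_ ?_ ?_) ?_
      · simp; omega
      · simp; omega
      · simp only [State.reg_setReg]; norm_num; congr 1; omega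
      rintro _ rfl
      refine .seq (R := fun s' => s' = (((s.setReg 1 (2 * b)).setReg 5 (r - 1)).setReg 1
        (4 * b)).setReg 5 (r - 2)) (.sub (w := w) ?_ ?_ ?_) ?_
      · simp; omega
      · simp; omega
      · simp [h7]; congr 1
      rintro _ rfl
      refine .sub (w := w) ?_ ?_ ⟨rfl, ?_, ?_, fun x x1 x5 _ => ?_⟩
      · simp; omega
      · simp; omega
      · simp [hr1]
      · simp [h7]; omega
      · simp [x1, x5]
    · have hr1 : r = 1 := by simp at hc; omega
      subst hr1
      refine .const (w := w) (by positivity) ⟨rfl, ?_, ?_, fun x x1 x5 x9 => ?_⟩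
      · simp
      · simp
      · simp [x1, x5, x9]
  have hval : (if r = 1 then 2 * b else 4 * b) * 2 ^ ((2 * (r - 3) + 2) / 3) =
      b * 2 ^ ((2 * r + 2) / 3) := by
    split_ifs with c
    · subst c; norm_num; ring
    · rw [show (2 * r + 2) / 3 = (2 * (r - 3) + 2) / 3 + 2 by omega, pow_add]; ring
  refine Runs.mono (.loop_succ (w := w) (by omega) (by omega) step
    fun s' ⟨k1, k2, k3, k4⟩ => (ih (r - 3) (by omega) s' _ k3 k2
      ((k4 7 (by decide) (by decide) (by decide)).trans h7) (by omega)
      (by rwa [hval])).mono le_rfl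
      fun s'' ⟨q1, q2, q3⟩ => ⟨q1.trans k1, q2.trans hval,
        fun x x1 x5 x9 => (q3 x x1 x5 x9).trans (k4 x x1 x5 x9)⟩) ?_ fun _ h => h
  have h4 : r * (8 * (2 * w + 1)) = (r - 1) * (8 * (2 * w + 1)) + 8 * (2 * w + 1) := by
    rw [← Nat.succ_mul]; congr 1; omega
  have := Nat.mul_le_mul_right (8 * (2 * w + 1)) (show r - 3 ≤ r - 1 by omega)
  omega

/-- Reads the number of vertices, clears the accuracy parameter, which the program does not need,
and computes the number of iterations of long loops. -/
def startup : Program := Program.block [.const 5 1, .store 5 3, .load 0 3, .const 1 1, .sub 5 0 3,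
  .const 7 1, .loop 5 doubling]

variable {n : ℕ} (G : WeightedDigraph n)

/-- The memory after the startup. -/
noncomputable def startMem (a : ℕ) : ℕ := if a = 1 then 0 else (initState G 0).mem a

/-- The accuracy parameter is overwritten without being read. Afterwards neither the cost nor the
bound for the memory cells depends on q. -/
theorem startup_runs (q : ℕ) {w : ℕ} (hw : n < 2 ^ w) (hw' : 2 ^ ((2 * n + 2) / 3) < 2 ^ w) :
    Runs startup (initState G q) ((8 * n + 7) * (2 * w + 1)) fun s' =>
      s'.mem = startMem G ∧ s'.reg 0 = n ∧ s'.reg 1 = 2 ^ ((2 * n + 2) / 3) ∧ s'.reg 2 = 0 ∧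
      s'.reg 3 = 0 ∧ ∀ x, s'.reg (2 * x + 4) = 0 := by
  have h1 : 1 < 2 ^ w := (Nat.one_le_two_pow).trans_lt hw'
  have hreg : ∀ x, (initState G q).reg x = 0 := fun _ => rfl
  have hmem : ((initState G q).setMem 1 0).mem = startMem G := by
    funext a
    simp only [State.mem_setMem, startMem, initState]
    split_ifs <;> rfl
  have hn : startMem G 0 = n := by simp [startMem, initState]
  refine Runs.mono (c := (2 * w + 1) + ((2 * w + 1) + ((2 * w + 1) + ((2 * w + 1) +
    ((2 * w + 1) + ((2 * w + 1) + (n * (8 * (2 * w + 1)) + (2 * w + 1))))))))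
    (.seq (R := fun s' => s'.mem = (initState G q).mem ∧ s'.reg 5 = 1 ∧
      ∀ x, x ≠ 5 → s'.reg x = 0) (.const h1 ⟨rfl, by simp, fun x hx => by simp [hx, hreg]⟩) ?_)
    (le_of_eq (by ring)) fun _ h => h
  rintro s1 ⟨m1, a1, b1⟩
  refine .seq (R := fun s' => s'.mem = startMem G ∧ ∀ x, x ≠ 5 → s'.reg x = 0)
    (.store (w := w) (by omega) (by rw [b1 3 (by decide)]; omega) ⟨?_, b1⟩) ?_
  · rw [← hmem, a1, b1 3 (by decide), State.setMem, m1]; rfl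
  rintro s2 ⟨m2, b2⟩
  have e3 := b2 3 (by decide)
  refine .seq (R := fun s' => s'.mem = startMem G ∧ s'.reg 0 = n ∧ ∀ x, x ≠ 0 → x ≠ 5 →
    s'.reg x = 0) (.load (w := w) (by omega) (by rw [e3, m2, hn]; exact hw)
      ⟨m2, by rw [e3, m2, hn]; simp, fun x hx hx' => by simp [hx, b2 x hx']⟩) ?_
  rintro s3 ⟨m3, a3, b3⟩
  refine .seq (R := fun s' => s'.mem = startMem G ∧ s'.reg 0 = n ∧ s'.reg 1 = 1 ∧ ∀ x, x ≠ 0 →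
    x ≠ 1 → x ≠ 5 → s'.reg x = 0) (.const h1
      ⟨m3, by simp [a3], by simp, fun x h0 h1 h5 => by simp [h1, b3 x h0 h5]⟩) ?_
  rintro s4 ⟨m4, a4, c4, b4⟩
  have e4 := b4 3 (by decide) (by decide) (by decide)
  refine .seq (R := fun s' => s'.mem = startMem G ∧ s'.reg 0 = n ∧ s'.reg 1 = 1 ∧ s'.reg 5 = n ∧
    ∀ x, x ≠ 0 → x ≠ 1 → x ≠ 5 → s'.reg x = 0) (.sub (w := w) (by omega) (by omega)
      ⟨m4, by simp [a4], by simp [c4], by simp [a4, e4],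
        fun x h0 h1 h5 => by simp [h5, b4 x h0 h1 h5]⟩) ?_
  rintro s5 ⟨m5, a5, c5, d5, b5⟩
  refine .seq (R := fun s' => s'.mem = startMem G ∧ s'.reg 0 = n ∧ s'.reg 1 = 1 ∧ s'.reg 5 = n ∧
    s'.reg 7 = 1 ∧ ∀ x, x ≠ 0 → x ≠ 1 → x ≠ 5 → x ≠ 7 → s'.reg x = 0) (.const h1
      ⟨m5, by simp [a5], by simp [c5], by simp [d5], by simp,
        fun x h0 h1 h5 h7 => by simp [h7, b5 x h0 h1 h5]⟩) ?_
  rintro s6 ⟨m6, a6, c6, d6, e6, b6⟩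
  refine (doubling_runs n s6 1 d6 c6 e6 hw (by rwa [one_mul])).mono le_rfl ?_
  rintro s7 ⟨m7, a7, b7⟩
  refine ⟨m7.trans m6, ?_, by rw [a7, one_mul], ?_, ?_, fun x => ?_⟩
  · rw [b7 0 (by decide) (by decide) (by decide), a6]
  · rw [b7 2 (by decide) (by decide) (by decide), b6 2 (by decide) (by decide) (by decide)
      (by decide)]
  · rw [b7 3 (by decide) (by decide) (by decide), b6 3 (by decide) (by decide) (by decide)
      (by decide)]
  · rw [b7 _ (by omega) (by omega) (by omega), b6 _ (by omega) (by omega) (by omega) (by omega)]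

end RAM
-- The cap, and the cost of the whole machine
namespace RAM

variable {n : ℕ} (G : WeightedDigraph n)

/-- The cap. -/
def capExpr : Expr := .big + .sum 20 .size + .size + .const 3 +
  .sum 20 (.sum 21 (.mem (2 + .index 20 21) + .mem (2 + .index 20 21)))

theorem startMem_input (u v : Fin n) : startMem G (2 + (n * u + v)) = arcCode G u v := by
  have h := index_lt u v
  have e : finProdFinEquiv (u, v) = ⟨2 + (n * u + v) - 2, by omega⟩ := by
    ext; simp [finProdFinEquiv]; ring
  rw [startMem, if_neg (by omega), initState]
  simp only
  rw [if_neg (by omega), if_neg (by omega), dif_pos (by omega), ← e, Equiv.symm_apply_apply]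

theorem startMem_le {M : ℕ} (hn : n ≤ M) (hG : ∀ u v, arcCode G u v ≤ M) (a : ℕ) :
    startMem G a ≤ M := by
  simp only [startMem, initState]
  split_ifs
  exacts [Nat.zero_le _, hn, hG _ _, Nat.zero_le _]

/-- The value of the cap. -/
noncomputable def capOf : ℕ :=
  2 ^ ((2 * n + 2) / 3) + n * n + n + 3 + ∑ u, ∑ v, (arcCode G u v + arcCode G u v)

theorem arcCode_le_capOf (u v : Fin n) : arcCode G u v ≤ capOf G := by
  have h1 := single_le_sum (f := fun v => arcCode G u v + arcCode G u v)
    (fun _ _ => Nat.zero_le _) (mem_univ v)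
  have h2 := single_le_sum (f := fun u => ∑ v, (arcCode G u v + arcCode G u v))
    (fun _ _ => Nat.zero_le _) (mem_univ u)
  simp only [capOf] at h1 h2 ⊢
  have := Nat.two_pow_pos ((2 * n + 2) / 3)
  omega

theorem val_capExpr (c : ℕ) {s : State} (hs : s.mem = startMem G) :
    capExpr.val ⟨n, 2 ^ ((2 * n + 2) / 3), c⟩ s = capOf G := by
  have : ∀ u v : Fin n, s.mem (2 + (n * u + v)) = arcCode G u v := fun u v => by
    rw [hs, startMem_input]
  simp [capExpr, capOf, sum_range, this]

theorem fits : Params.Fits ⟨n, 2 ^ ((2 * n + 2) / 3), capOf G⟩ G where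
  big_eq := rfl
  big_le := by simp only [capOf]; omega
  n_add_two_le := by
    have := Nat.two_pow_pos ((2 * n + 2) / 3)
    simp only [capOf]
    omega
  sq_add_two_le := by
    have := Nat.two_pow_pos ((2 * n + 2) / 3)
    simp only [capOf]
    omega
  total_lt := by
    have : 2 * ∑ u, ∑ v, G.arcWeight u v ≤ ∑ u, ∑ v, (arcCode G u v + arcCode G u v) := by
      simp only [mul_sum]
      refine sum_le_sum fun u _ => sum_le_sum fun v _ => ?_
      simp only [WeightedDigraph.arcWeight]
      omega
    have := Nat.two_pow_pos ((2 * n + 2) / 3)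
    simp only [capOf]
    omega

theorem arcCode_le (u v : Fin n) : arcCode G u v ≤ G.wMax + 1 := by
  classical
  unfold arcCode
  split_ifs with h
  · have : (u, v) ∈ G.arcs := by simp [WeightedDigraph.arcs, h]
    have := le_sup (f := fun a : Fin n × Fin n => G.weight a.1 a.2) this
    simpa [WeightedDigraph.wMax] using this
  · omega

/-- Crude: n + 1 ≤ 2^n and `wMax` + 1 ≤ 2^`size`. Only linearity of the exponent in the bit length
of the largest weight matters. -/
theorem capOf_lt : capOf G < 2 ^ (3 * n + 7 + G.wMax.size) := by
  have hsum : ∑ u, ∑ v, (arcCode G u v + arcCode G u v) ≤ n * (n * (2 * (G.wMax + 1))) := by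
    refine (sum_le_card_nsmul univ _ (n * (2 * (G.wMax + 1))) fun u _ => ?_).trans (by simp)
    refine (sum_le_card_nsmul univ _ (2 * (G.wMax + 1)) fun v _ => ?_).trans (by simp)
    have := arcCode_le G u v
    omega
  have hbig : 2 ^ ((2 * n + 2) / 3) ≤ 2 ^ n := Nat.pow_le_pow_right (by omega) (by omega)
  have hn : n + 1 ≤ 2 ^ n := Nat.lt_two_pow_self
  have hw : G.wMax + 1 ≤ 2 ^ G.wMax.size := Nat.lt_size_self _
  set x := 2 ^ n
  set y := 2 ^ G.wMax.size
  have hx : 1 ≤ x := by omega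
  have hy : 1 ≤ y := by omega
  have e : 2 ^ (3 * n + 7 + G.wMax.size) = 128 * (x * (x * x) * y) := by
    simp only [x, y]; rw [pow_add, pow_add, pow_mul, ← pow_mul, mul_comm 3 n, pow_mul]; ring
  have h1 : n * (n * (2 * (G.wMax + 1))) ≤ 2 * (x * x * y) := by
    calc n * (n * (2 * (G.wMax + 1))) ≤ x * (x * (2 * y)) := by gcongr <;> omega
      _ = _ := by ring
  have h2 : n * n ≤ x * x := by gcongr <;> omega
  have h3 : x ≤ x * x := Nat.le_mul_of_pos_left _ hx
  have h4 : x * x ≤ x * x * y := Nat.le_mul_of_pos_right _ hy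
  have h5 : x * x * y ≤ x * (x * x) * y := by
    gcongr
  rw [e, capOf]
  omega

/-- The compiled program. -/
def machine : Program :=
  .seq startup (.seq (capExpr.code 0) (.seq (.sub 2 5 3) (cutwidthProgram.code 0)))

theorem machine_runs : ∃ c d : ℕ, ∀ (n : ℕ) (G : WeightedDigraph n) (q : ℕ),
    Runs machine (initState G q) (c * (n + 1) ^ d * 2 ^ ((2 * n + 2) / 3) * (G.wMax.size + 1))
      fun s => ∃ π : VertexOrdering n, s.Outputs π ∧ G.orderingWidth π ≤ 2 * G.cutwidth := by
  obtain ⟨f, hf, hsteps⟩ := cutwidthProgram.steps_le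
  rw [cutwidthProgram_longDepth] at hsteps
  obtain ⟨W, hW⟩ : ∃ W, W = capExpr.weight + cutwidthProgram.weight := ⟨_, rfl⟩
  -- The word length will be g n plus the bit length of the largest weight: (n + 2)^W is at most
  -- 2^((n + 1) W), and the rest bounds the cap.
  let g : ℕ → ℕ := fun n => (n + 1) * W + (3 * n + 7)
  have hg : PolyBound g := by
    refine PolyBound.add (PolyBound.mul (polyBound_id.add (polyBound_const 1)) (polyBound_const W))
      (PolyBound.add (PolyBound.mul (polyBound_const 3) polyBound_id) (polyBound_const 7))
  have hpoly : PolyBound fun n => (((8 * n + 7) + capExpr.steps n + 1) + f n) * (2 * g n + 3) :=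
    PolyBound.mul (PolyBound.add (PolyBound.add (PolyBound.add (PolyBound.add
      (PolyBound.mul (polyBound_const 8) polyBound_id) (polyBound_const 7))
      capExpr.polyBound_steps) (polyBound_const 1)) hf)
      (PolyBound.add (PolyBound.mul (polyBound_const 2) hg) (polyBound_const 3))
  obtain ⟨c, d, hcd⟩ := hpoly
  refine ⟨c, d, fun n G q => ?_⟩
  have hfit := fits G
  set B := 2 ^ ((2 * n + 2) / 3) with hB
  have hB1 : 1 ≤ B := Nat.one_le_two_pow
  set M := capOf G with hM
  set w := g n + G.wMax.size with hw
  have hlarge : (n + 2) ^ W * M < 2 ^ w := by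
    have h1 : n + 2 ≤ 2 ^ (n + 1) := Nat.lt_two_pow_self
    have h2 : (n + 2) ^ W ≤ 2 ^ ((n + 1) * W) := by
      rw [pow_mul]; exact Nat.pow_le_pow_left h1 W
    calc (n + 2) ^ W * M ≤ 2 ^ ((n + 1) * W) * M := Nat.mul_le_mul_right _ h2
      _ < 2 ^ ((n + 1) * W) * 2 ^ (3 * n + 7 + G.wMax.size) :=
        Nat.mul_lt_mul_of_pos_left (capOf_lt G) (by positivity)
      _ = 2 ^ w := by rw [← pow_add, hw]; simp only [g]; congr 1; ring
  have hMw : M < 2 ^ w := lt_of_pow_mul_lt hlarge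
  have hnM : n ≤ M := by have := hfit.n_add_two_le; simp only at this; omega
  have hBM : B ≤ M := hfit.big_le
  -- The cap is itself computed by a compiled expression, evaluated while the cap register still
  -- holds 0; `capExpr` does not mention the cap.
  have hb0 : Params.Bounded ⟨n, B, 0⟩ M := ⟨hB1.trans hBM, hnM, hBM, Nat.zero_le _⟩
  have hb1 : Params.Bounded ⟨n, B, M⟩ M := ⟨hB1.trans hBM, hnM, hBM, le_rfl⟩
  have hcost : (8 * n + 7) * (2 * w + 1) + (capExpr.steps n * (2 * w + 1) + ((2 * w + 1) +
      cutwidthProgram.steps n B * (2 * w + 1))) ≤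
      c * (n + 1) ^ d * B * (G.wMax.size + 1) := by
    have h1 := hsteps n B hB1
    rw [pow_one] at h1
    have h2 : 2 * w + 1 ≤ (2 * g n + 3) * (G.wMax.size + 1) := by
      rw [hw]; nlinarith [Nat.zero_le (g n * G.wMax.size)]
    calc _ = ((8 * n + 7) + capExpr.steps n + 1 + cutwidthProgram.steps n B) * (2 * w + 1) := by
          ring
      _ ≤ (((8 * n + 7) + capExpr.steps n + 1) * B + f n * B) *
          ((2 * g n + 3) * (G.wMax.size + 1)) := by
          gcongr
          exact Nat.le_mul_of_pos_right _ hB1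
      _ = ((((8 * n + 7) + capExpr.steps n + 1) + f n) * (2 * g n + 3)) * B *
          (G.wMax.size + 1) := by ring
      _ ≤ _ := Nat.mul_le_mul_right _ (Nat.mul_le_mul_right _ (hcd n))
  refine Runs.mono (.seq (startup_runs G q (w := w) (by omega) (by omega)) ?_) hcost fun _ h => h
  rintro s1 ⟨m1, r0, r1, r2, r3, ru⟩
  have hu1 : s1.user.Bounded M := ⟨fun x => by simp [State.user, ru], fun a => by
    simp only [State.user, m1]
    exact startMem_le G hnM (arcCode_le_capOf G) a⟩
  have a1 : Ambient ⟨n, B, 0⟩ M s1 := ⟨r0, r1, r2, r3, hu1⟩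
  refine .seq (capExpr.runs hb0 0 s1 a1 (pow_mul_lt_of_le hlarge (by omega))) ?_
  rintro s2 ⟨k2, e2⟩
  have e2' : s2.reg 5 = M := e2.trans (val_capExpr G 0 m1)
  have e3 : s2.reg 3 = 0 := (k2.2 3 (by omega)).trans r3
  refine .seq (R := fun s3 => Ambient ⟨n, B, M⟩ M s3 ∧ s3.user = s1.user)
    (.sub (w := w) (by omega) (by rw [e3]; positivity) ?_) ?_
  · have hu : (s2.setReg 2 (s2.reg 5 - s2.reg 3)).user = s1.user := by
      rw [← k2.user]
      simp only [State.user, State.mem_setReg, State.reg_setReg]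
      congr 1
    refine ⟨⟨?_, ?_, ?_, ?_, hu ▸ hu1⟩, hu⟩
    · simp [k2.2 0, r0]
    · simp [k2.2 1, r1, hB]
    · simp [e2', e3]
    · simp [e3]
  rintro s3 ⟨a3, u3⟩
  refine (cutwidthProgram.runs hb1 0 s3 a3 (pow_mul_lt_of_le hlarge (by omega))).mono le_rfl ?_
  rintro s4 ⟨-, u4, -⟩
  have hgood : s3.user.Good ⟨n, B, M⟩ G := ⟨a3.bounded, fun u v => by
    rw [u3]
    simp only [State.user, m1]
    exact startMem_input G u v⟩
  obtain ⟨π, h1, h2⟩ := cutwidthProgram_spec hfit hgood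
  refine ⟨π, fun v => ?_, h2⟩
  rw [← h1 v, ← u4]
  rfl

end RAM

/-! ### The exponent of matrix multiplication is at least two -/

theorem hasBilinearMatMul_cube (N : ℕ) : HasBilinearMatMul N (N * N * N) := by
  let e : Fin (N * N * N) ≃ (Fin N × Fin N) × Fin N :=
    (Fintype.equivFinOfCardEq (by simp)).symm
  refine ⟨fun l => Matrix.single (e l).1.1 (e l).1.2 1, fun l => Matrix.single (e l).1.2 (e l).2 1,
    fun l => Matrix.single (e l).1.1 (e l).2 1, fun A B => ?_⟩
  rw [Equiv.sum_comp e fun l => ((∑ i, ∑ j, Matrix.single l.1.1 l.1.2 (1 : ℚ) i j * A i j) *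
    (∑ i, ∑ j, Matrix.single l.1.2 l.2 (1 : ℚ) i j * B i j)) • Matrix.single l.1.1 l.2 (1 : ℚ)]
  ext i k
  simp [Matrix.mul_apply, Matrix.sum_apply, Matrix.single_apply, Fintype.sum_prod_type, ite_and]

/-- Multiplying by the identity shows that the r matrices γ span the N²-dimensional matrix space. -/
theorem HasBilinearMatMul.sq_le {N r : ℕ} (h : HasBilinearMatMul N r) : N * N ≤ r := by
  obtain ⟨α, β, γ, h⟩ := h
  have hspan : Submodule.span ℚ (Set.range γ) = ⊤ := by
    refine eq_top_iff.2 fun A _ => ?_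
    have := h A 1
    rw [mul_one] at this
    rw [this]
    exact Submodule.sum_mem _ fun l _ =>
      Submodule.smul_mem _ _ (Submodule.subset_span ⟨l, rfl⟩)
  have h1 := finrank_range_le_card (R := ℚ) γ
  rw [Set.finrank, hspan, finrank_top] at h1
  simpa [Module.finrank_matrix] using h1

/-- If τ < 2, then N² ≤ C N^τ fails for large N. The cubic algorithm is needed because the infimum
of an empty set of reals would be 0. -/
theorem two_le_matMulExponent : 2 ≤ matMulExponent := by
  refine le_csInf ⟨3, 1, fun N _ => ⟨N * N * N, ?_, hasBilinearMatMul_cube N⟩⟩ ?_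
  · push_cast
    rw [one_mul, show (3 : ℝ) = ((3 : ℕ) : ℝ) by norm_num, Real.rpow_natCast]
    exact le_of_eq (by ring)
  rintro τ ⟨C, hC⟩
  by_contra! hτ
  have h1 : Filter.Tendsto (fun N : ℕ => (N : ℝ) ^ (2 - τ)) Filter.atTop Filter.atTop :=
    (tendsto_rpow_atTop (by linarith)).comp tendsto_natCast_atTop_atTop
  obtain ⟨N, hN, hN1⟩ := ((h1.eventually_gt_atTop C).and (Filter.eventually_ge_atTop 1)).exists
  obtain ⟨r, hr, hb⟩ := hC N hN1
  have h2 : ((N * N : ℕ) : ℝ) ≤ r := by exact_mod_cast hb.sq_le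
  have hpos : (0 : ℝ) < N := by exact_mod_cast hN1
  have h3 : (N : ℝ) ^ (2 - τ) * (N : ℝ) ^ τ = ((N * N : ℕ) : ℝ) := by
    rw [← Real.rpow_add hpos, sub_add_cancel]
    push_cast
    rw [Real.rpow_two, sq]
  have h4 := mul_lt_mul_of_pos_right hN (Real.rpow_pos_of_pos hpos τ)
  linarith

/-! ### The running time -/

/-- From x^d / d! ≤ e^x at x = (n + 1) a log 2. -/
theorem exists_poly_le_two_rpow (d : ℕ) {a : ℝ} (ha : 0 < a) :
    ∃ C : ℝ, 0 < C ∧ ∀ n : ℕ, ((n : ℝ) + 1) ^ d ≤ C * (2 : ℝ) ^ (a * n) := by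
  set b := a * Real.log 2 with hb
  have hb0 : 0 < b := mul_pos ha (Real.log_pos (by norm_num))
  refine ⟨d.factorial * Real.exp b / b ^ d, by positivity, fun n => ?_⟩
  have h := Real.pow_div_factorial_le_exp (b * (n + 1)) (by positivity) d
  rw [div_le_iff₀ (by positivity), mul_pow] at h
  rw [Real.rpow_def_of_pos (by norm_num), div_mul_eq_mul_div, le_div_iff₀ (by positivity)]
  calc ((n : ℝ) + 1) ^ d * b ^ d = b ^ d * ((n : ℝ) + 1) ^ d := mul_comm _ _
    _ ≤ Real.exp (b * (n + 1)) * d.factorial := h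
    _ = d.factorial * Real.exp b * Real.exp (Real.log 2 * (a * n)) := by
      rw [show b * ((n : ℝ) + 1) = b + Real.log 2 * (a * n) by rw [hb]; ring, Real.exp_add]
      ring

theorem two_pow_part_le (n : ℕ) :
    (2 : ℝ) ^ ((2 * n + 2) / 3) ≤ 2 * (2 : ℝ) ^ (2 * (n : ℝ) / 3) := by
  have h : (((2 * n + 2) / 3 : ℕ) : ℝ) ≤ 1 + 2 * (n : ℝ) / 3 := by
    have : 3 * ((2 * n + 2) / 3) ≤ 2 * n + 3 := by omega
    have : (3 : ℝ) * (((2 * n + 2) / 3 : ℕ) : ℝ) ≤ 2 * n + 3 := by exact_mod_cast this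
    linarith
  calc (2 : ℝ) ^ ((2 * n + 2) / 3) = (2 : ℝ) ^ (((2 * n + 2) / 3 : ℕ) : ℝ) :=
        (Real.rpow_natCast _ _).symm
    _ ≤ (2 : ℝ) ^ (1 + 2 * (n : ℝ) / 3) := Real.rpow_le_rpow_of_exponent_le (by norm_num) h
    _ = _ := by rw [Real.rpow_add (by norm_num), Real.rpow_one]

theorem size_add_one_le (W : ℕ) : ((W.size + 1 : ℕ) : ℝ) ≤ 3 * max 1 (Real.logb 2 W) := by
  have h1 := le_max_left (1 : ℝ) (Real.logb 2 W)
  have h2 := le_max_right (1 : ℝ) (Real.logb 2 W)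
  rcases hs : W.size with _ | m
  · norm_num
    linarith
  · have h3 : 2 ^ m ≤ W := Nat.lt_size.1 (by omega)
    have h4 : (0 : ℝ) < W := by exact_mod_cast (Nat.two_pow_pos m).trans_le h3
    have h5 : (m : ℝ) ≤ Real.logb 2 W := by
      rw [Real.le_logb_iff_rpow_le (by norm_num) h4, Real.rpow_natCast]
      exact_mod_cast h3
    push_cast
    linarith

end CutwidthProof

theorem mainTheorem9 (τ : ℝ) (hτ : matMulExponent < τ) :
    ∃ (P : RAM.Program) (C : ℝ), ∀ (ε : ℝ), 0 < ε → ∀ (n : ℕ) (G : WeightedDigraph n),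
      ∃ (s : RAM.State) (t : ℕ) (π : VertexOrdering n),
        RAM.Exec P (RAM.initState G ⌈1 / ε⌉₊) s t ∧
        s.Outputs π ∧
        (G.orderingWidth π : ℝ) ≤ (2 + ε) * (G.cutwidth : ℝ) ∧
        (t : ℝ) ≤ C * ((2 : ℝ) ^ (τ * (n : ℝ) / 3) * max 1 (Real.logb 2 (G.wMax : ℝ)) *
          (max 1 (1 / ε)) ^ 2 * (max 1 ((n / 2 : ℕ) : ℝ)) ^ 2) := by
  have hτ2 : 2 < τ := two_le_matMulExponent.trans_lt hτ
  obtain ⟨c, d, hrun⟩ := RAM.machine_runs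
  obtain ⟨C, hC, hpoly⟩ := exists_poly_le_two_rpow d (a := (τ - 2) / 3) (by linarith)
  -- The factor C absorbs the polynomial in n, 2 the rounding in ⌈2n/3⌉, and 3 the passage from bit
  -- length to logarithm.
  refine ⟨RAM.machine, c * C * 2 * 3, fun ε hε n G => ?_⟩
  obtain ⟨s, t, hexec, ht, π, hout, hwidth⟩ := hrun n G ⌈1 / ε⌉₊
  refine ⟨s, t, π, hexec, hout, ?_, ?_⟩
  · have h1 : (G.orderingWidth π : ℝ) ≤ 2 * G.cutwidth := by exact_mod_cast hwidth
    have h2 : 0 ≤ ε * (G.cutwidth : ℝ) := by positivity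
    linarith
  · set L := max 1 (Real.logb 2 (G.wMax : ℝ)) with hL
    have h1 : (t : ℝ) ≤ c * ((n : ℝ) + 1) ^ d * (2 : ℝ) ^ ((2 * n + 2) / 3) *
        ((G.wMax.size + 1 : ℕ) : ℝ) := by exact_mod_cast ht
    have hE : (2 : ℝ) ^ ((τ - 2) / 3 * n) * (2 : ℝ) ^ (2 * (n : ℝ) / 3) =
        (2 : ℝ) ^ (τ * (n : ℝ) / 3) := by
      rw [← Real.rpow_add (by norm_num)]
      congr 1
      ring
    have hL0 : 0 < L := lt_of_lt_of_le one_pos (le_max_left _ _)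
    have h2 : (t : ℝ) ≤ c * C * 2 * 3 * ((2 : ℝ) ^ (τ * (n : ℝ) / 3) * L) := by
      calc (t : ℝ) ≤ _ := h1
        _ ≤ c * (C * (2 : ℝ) ^ ((τ - 2) / 3 * n)) * (2 * (2 : ℝ) ^ (2 * (n : ℝ) / 3)) *
            (3 * L) := by
          gcongr
          · exact hpoly n
          · exact two_pow_part_le n
          · exact size_add_one_le _
        _ = _ := by rw [← hE]; ring
    refine h2.trans (mul_le_mul_of_nonneg_left ?_ (by positivity))
    -- The factors in 1/ε and k are not needed; they are at least 1 and only weaken the bound.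
    have h3 : (1 : ℝ) ≤ (max 1 (1 / ε)) ^ 2 := one_le_pow₀ (le_max_left _ _)
    have h4 : (1 : ℝ) ≤ (max 1 ((n / 2 : ℕ) : ℝ)) ^ 2 := one_le_pow₀ (le_max_left _ _)
    have h5 : 0 ≤ (2 : ℝ) ^ (τ * (n : ℝ) / 3) * L := by positivity
    exact (le_mul_of_one_le_right h5 h3).trans
      (le_mul_of_one_le_right (mul_nonneg h5 (by positivity)) h4)
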